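/- Consider the processor sharing queue with Poisson arrivals of rate $\rho>0$, i.i.d. exponential service times with mean $1$, and capacity $K\ge 1$ (arrivals that find $K$ customers present are lost). Let $\mathbf V$ be the sojourn time of a tagged accepted customer and $N(0^-)\in\{0,\dots,K-1\}$ the number of customers it finds on arrival. Equivalently, $\mathbf V$ is the absorption time of the continuous-time Markov chain on $\{0,\dots,K-1\}\cup\{\text{departed}\}$, started at $N(0^-)$, whose state $n$ is the number of other customers present and whose jump rates are $\rho$ for $n\to n+1$ (if $n\le K-2$), $\frac{n}{n+1}$ for $n\to n-1$, and $\frac1{n+1}$ for $n\to\text{departed}$. Let $p_n(t)$ be the density of $\mathbf V$ given $N(0^-)=n$, and let $\widehat p_n(\theta)=\int_0^\infty e^{-\theta t}p_n(t)\,dt$, continued meromorphically to $\theta\in\mathbb C$. Let $Ai(x)=\frac1{2\pi}\int_{-\infty}^{\infty}e^{-i(t^3/3+xt)}\,dt$ (improper integral) be the Airy function. **Theorem.** For all $K\ge1$ and $\rho>0$ there is a real number $\theta_s=\theta_s(K,\rho)<0$ that is, for every $n\in\{0,\dots,K-1\}$, the dominant singularity of $\widehat p_n$: it is a pole of $\widehat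 p_n$, and all other poles $\theta$ satisfy $\operatorname{Re}\theta<\theta_s$. It is the tail exponent: $\lim_{t\to\infty}t^{-1}\log\Pr[\mathbf V>t]=\theta_s$, for every distribution of $N(0^-)$ on $\{0,\dots,K-1\}$. As $K\to\infty$ it has the following expansions. 1. For fixed $0<\rho<1$, $$\theta_s=-(1-\sqrt\rho)^2-\frac{\sqrt\rho}{K}+\frac{\sqrt\rho\,r_0}{K^{4/3}}-\frac{8\sqrt\rho\,r_0^2}{15K^{5/3}}+O(K^{-2}),$$ where $r_0\approx-2.3381$ (that is, $|r_0+2.3381|<5\cdot10^{-5}$) is the largest real root of $Ai$. 2. For $\rho=1+\eta K^{-2/3}$, uniformly for $\eta$ in bounded subsets of $\mathbb R$, $$\theta_s=-\frac1K+\frac{r_1}{K^{4/3}}-\frac{16r_1^3+8\eta^2r_1^2+(\eta^4+19\eta)r_1+\eta^3+9}{30\,r_1K^{5/3}}+O(K^{-2}),$$ where $r_1=r_1(\eta)\neq0$ is the largest real root of $\dfrac{Ai'(r_1+\eta^2/4)}{Ai(r_1+\eta^2/4)}=-\dfrac\eta2$. 3. For fixed $\rho>1$, $$\theta_s=-\frac1K-\frac1{(\rho-1)K^2}-\frac1{(\rho-1)^2K^3}+\frac{\rho^2+1}{(\rho-1)^4K^4}+O(K^{-5}).$$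 -/

import Mathlib

open Filter Topology Asymptotics

noncomputable section

/-- Jump rates of the Markov chain that follows a tagged customer in the processor sharing queue
with Poisson arrivals of rate `ρ`, exponential service times of mean `1` and room for `K` customers.
State `some n` means that the tagged customer is present together with `n` other customers
(`0 ≤ n ≤ K - 1`); state `none` means that the tagged customer has left. With `n + 1` customers
present each of them is served at rate `1 / (n + 1)`; arrivals that find `K` customers are lost. -/
def psRate (K : ℕ) (ρ : ℝ) : Option (Fin K) → Option (Fin K) → ℝ
  | some n, some m =>
      if (m : ℕ) = (n : ℕ) + 1 then ρ
      else if (m : ℕ) + 1 = (n : ℕ) then (n : ℝ) / ((n : ℝ) + 1)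
      else 0
  | some n, none => 1 / ((n : ℝ) + 1)
  | none, _ => 0

/-- The generator (infinitesimal matrix) of the chain with jump rates `psRate`. -/
def psGenerator (K : ℕ) (ρ : ℝ) : Matrix (Option (Fin K)) (Option (Fin K)) ℝ :=
  Matrix.of fun i j => if i = j then -∑ k, psRate K ρ i k else psRate K ρ i j

/-- The transition probabilities over a time interval of length `t` (`i` to `j`). -/
def psTransition (K : ℕ) (ρ : ℝ) (t : ℝ) : Matrix (Option (Fin K)) (Option (Fin K)) ℝ :=
  NormedSpace.exp (t • psGenerator K ρ)

/-- `Pr[V > t | N(0⁻) = n]`: the probability that a tagged customer who finds `n` customers on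
arrival is still in the system after time `t`. -/
def sojournTail (K : ℕ) (ρ : ℝ) (n : Fin K) (t : ℝ) : ℝ :=
  ∑ m : Fin K, psTransition K ρ t (some n) (some m)

/-- The conditional density `p_n(t)` of the sojourn time `V` given `N(0⁻) = n`. -/
def sojournDensity (K : ℕ) (ρ : ℝ) (n : Fin K) (t : ℝ) : ℝ :=
  -deriv (sojournTail K ρ n) t

/-- `F` is the Laplace transform of `p`, continued meromorphically to the whole plane: it is
meromorphic on `ℂ` and agrees with `∫₀^∞ e^{-zt} p(t) dt` (absolutely convergent) on some right
half-plane. Such an `F` is unique up to its values on a discrete set. -/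
def IsContinuedLaplaceTransform (p : ℝ → ℝ) (F : ℂ → ℂ) : Prop :=
  Meromorphic F ∧
    ∃ σ : ℝ, ∀ z : ℂ, σ < z.re →
      MeasureTheory.IntegrableOn (fun t : ℝ => Complex.exp (-z * t) * (p t : ℂ)) (Set.Ioi 0) ∧
        F z = ∫ t in Set.Ioi (0 : ℝ), Complex.exp (-z * t) * (p t : ℂ)

/-- The real number `s` is the dominant singularity of the (meromorphically continued) Laplace
transform of `p`: it is a pole, and every other pole lies strictly to its left. -/
def IsDominantSingularity (p : ℝ → ℝ) (s : ℝ) : Prop :=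
  ∃ F : ℂ → ℂ, IsContinuedLaplaceTransform p F ∧
    meromorphicOrderAt F (s : ℂ) < 0 ∧
    ∀ z : ℂ, meromorphicOrderAt F z < 0 → z ≠ (s : ℂ) → z.re < s

/-- The Airy function on the real line, as the improper integral
`Ai(x) = (1 / 2π) ∫_{-∞}^{∞} e^{-i(t³/3 + xt)} dt = (1 / π) ∫_0^∞ cos(t³/3 + xt) dt`. -/
def airyAi (x : ℝ) : ℝ :=
  limUnder atTop fun R : ℝ => (1 / Real.pi) * ∫ t in (0 : ℝ)..R, Real.cos (t ^ 3 / 3 + x * t)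

end

/-! Killed at the departure of the tagged customer, the chain has a tridiagonal generator that is
reversible for the weights `ρ ^ n * (n + 1)`. It is therefore similar to a symmetric tridiagonal
matrix with positive off-diagonal entries, whose largest eigenvalue θ is simple and has a positive
eigenvector. Expanding the constant function 1 in eigenvectors writes every tail as a positive
multiple of `exp (θ t)` plus exponentials that decay faster (`exists_isDecayRate`). The pole
statement and the tail exponent follow at once.

The asymptotics of θ come from comparison. Pairing with the positive left eigenvector shows that a
positive supersolution bounds θ from above and a nonnegative, nonzero subsolution bounds it from
below. It therefore suffices to write down explicit approximate eigenvectors that err on a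
prescribed side. They are indexed by `j = K - n`, counted from the full queue, where the recursion
has a reflecting boundary.

For loads below or near one the vector is `√ρ ^ j * u j`. With `h = K ^ (-1/3)` and `x = j * h ^ 2`
the recursion for `u` is to leading order the Airy equation `u'' = (x + r) u`. A Langer ansatz, an
amplitude times a recessive solution of the Airy equation at a corrected phase, makes it accurate
enough for an error `O(h ^ 6) = O(K ^ (-2))` in the eigenvalue (`langer_supersolution`,
`langer_subsolution`). The reflecting boundary selects `r`: for `ρ < 1` the solution has to vanish
at the boundary to leading order, so `r` is the largest Airy zero; near one the condition is `f' / f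
= -η / 2`. Small changes of amplitude and phase produce the two signs of the error.

For `ρ > 1` the eigenvector is nearly constant at the full end. It is described by its consecutive
ratios `1 - d i`, with `d i` a polynomial in `1 / K` (`overload_decayRate_le`,
`le_overload_decayRate`).

The Airy function enters only as a solution of `f'' = x f` that is bounded on the right and positive
at 1 (`IsRecessiveAiry`). The contour integral gives these properties. Positivity of the energy `f'
^ 2 - x * f ^ 2` makes `f' / f` strictly decreasing beyond the largest zero, which gives the roots
`r₁ η`. The zero itself is located by Wronskians with Taylor polynomials. -/

/-! ### Perron-Frobenius theory for symmetric tridiagonal matrices. -/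

open Matrix in
/-- A real symmetric matrix has an orthonormal eigenbasis, phrased with dot products. -/
theorem exists_orthonormal_eigenbasis {K : ℕ} (S : Matrix (Fin K) (Fin K) ℝ) (hS : S.IsSymm) :
    ∃ (l : Fin K → ℝ) (e : Fin K → Fin K → ℝ),
      (∀ k, S *ᵥ e k = l k • e k) ∧
      (∀ k m, e k ⬝ᵥ e m = if k = m then 1 else 0) ∧
      (∀ x y : Fin K → ℝ, x ⬝ᵥ y = ∑ k, (e k ⬝ᵥ x) * (e k ⬝ᵥ y)) ∧
      (∀ x : Fin K → ℝ, ∀ n, x n = ∑ k, (e k ⬝ᵥ x) * e k n) := by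
  have hH : S.IsHermitian := by
    rw [Matrix.IsHermitian, Matrix.conjTranspose_eq_transpose_of_trivial]; exact hS
  set b := hH.eigenvectorBasis with hb
  have hin : ∀ x y : EuclideanSpace ℝ (Fin K), inner ℝ x y = (x : Fin K → ℝ) ⬝ᵥ (y : Fin K → ℝ) := by
    intro x y
    simp [PiLp.inner_apply, dotProduct, mul_comm]
  refine ⟨hH.eigenvalues, fun k => ⇑(b k), fun k => hH.mulVec_eigenvectorBasis k, ?_, ?_, ?_⟩
  · intro k m
    rw [← hin]
    exact orthonormal_iff_ite.mp b.orthonormal k m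
  · intro x y
    have h := b.sum_inner_mul_inner (WithLp.toLp 2 x) (WithLp.toLp 2 y)
    simp only [hin] at h
    rw [← h]
    refine Finset.sum_congr rfl fun k _ => ?_
    rw [dotProduct_comm x]
  · intro x n
    have h := b.sum_repr' (WithLp.toLp 2 x)
    simp only [hin] at h
    have h2 := congrArg (fun z : EuclideanSpace ℝ (Fin K) => z n) h
    simpa using h2.symm

section Tridiagonal

variable {K : ℕ} {S : Matrix (Fin K) (Fin K) ℝ}

-- Row `m` expresses `y (m + 1)` through earlier entries, so the first entry determines the whole
-- eigenvector. Eigenspaces are thus at most one-dimensional.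
open Matrix in
theorem tridiagonal_eigenvector_eq_zero (htri : ∀ i j : Fin K, (i : ℕ) + 1 < j → S i j = 0)
    (hadj : ∀ i j : Fin K, (i : ℕ) + 1 = j → 0 < S i j) {θ : ℝ} {y : Fin K → ℝ}
    (hy : S *ᵥ y = θ • y) (h0 : ∀ i : Fin K, (i : ℕ) = 0 → y i = 0) : y = 0 := by
  have key : ∀ m : ℕ, ∀ i : Fin K, (i : ℕ) ≤ m → y i = 0 := by
    intro m
    induction m with
    | zero => intro i hi; exact h0 i (by omega)
    | succ m ih =>
      intro i hi
      rcases Nat.lt_or_ge (i : ℕ) (m + 1) with h | h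
      · exact ih i (by omega)
      have him : (i : ℕ) = m + 1 := by omega
      have hm : m < K := by have := i.2; omega
      have hrow := congrFun hy ⟨m, hm⟩
      simp only [Matrix.mulVec, dotProduct, Pi.smul_apply, smul_eq_mul] at hrow
      rw [ih ⟨m, hm⟩ le_rfl, mul_zero, Finset.sum_eq_single i] at hrow
      · have := hadj ⟨m, hm⟩ i (by simp [him])
        exact (mul_eq_zero.mp hrow).resolve_left this.ne'
      · intro j _ hj
        rcases Nat.lt_or_ge (m + 1) (j : ℕ) with h' | h'
        · rw [htri _ _ h', zero_mul]
        · have : (j : ℕ) ≠ m + 1 := fun h'' => hj (Fin.ext (by omega))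
          rw [ih j (by omega), mul_zero]
      · simp
  funext i
  exact key i i le_rfl

-- At a zero entry the eigenvector equation is a vanishing sum of nonnegative terms, so the left
-- neighbour vanishes too. Descending to index 0 makes the whole vector zero.
open Matrix in
theorem tridiagonal_nonneg_eigenvector_pos (hoff : ∀ i j, i ≠ j → 0 ≤ S i j) (hsym : S.IsSymm)
    (htri : ∀ i j : Fin K, (i : ℕ) + 1 < j → S i j = 0)
    (hadj : ∀ i j : Fin K, (i : ℕ) + 1 = j → 0 < S i j) {θ : ℝ} {x : Fin K → ℝ}
    (hx : S *ᵥ x = θ • x) (h0 : ∀ i, 0 ≤ x i) (hne : x ≠ 0) : ∀ i, 0 < x i := by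
  by_contra hcon
  push Not at hcon
  obtain ⟨i, hi⟩ := hcon
  have hi0 : x i = 0 := le_antisymm hi (h0 i)
  have key : ∀ m : ℕ, ∀ i : Fin K, (i : ℕ) = m → x i = 0 → ∀ j : Fin K, (j : ℕ) = 0 → x j = 0 := by
    intro m
    induction m with
    | zero => intro i hi hxi j hj; rw [show j = i from Fin.ext (by omega)]; exact hxi
    | succ m ih =>
      intro i hi hxi j hj
      have hm : m < K := by have := i.2; omega
      refine ih ⟨m, hm⟩ rfl ?_ j hj
      have hrow := congrFun hx i
      simp only [Matrix.mulVec, dotProduct, Pi.smul_apply, smul_eq_mul, hxi, mul_zero] at hrow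
      rw [Finset.sum_eq_zero_iff_of_nonneg] at hrow
      · have h := hrow ⟨m, hm⟩ (Finset.mem_univ _)
        have hp := hadj ⟨m, hm⟩ i (by simp [hi])
        rw [← hsym.apply] at hp
        exact (mul_eq_zero.mp h).resolve_left hp.ne'
      · intro k _
        by_cases hk : i = k
        · rw [← hk, hxi, mul_zero]
        · exact mul_nonneg (hoff _ _ hk) (h0 k)
  exact hne (tridiagonal_eigenvector_eq_zero htri hadj hx (key i i rfl hi0))

open Matrix in
/-- Perron-Frobenius for a symmetric tridiagonal matrix with positive off-diagonal. -/
theorem tridiagonal_perron (hK : 0 < K) (hsym : S.IsSymm) (hoff : ∀ i j, i ≠ j → 0 ≤ S i j)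
    (htri : ∀ i j : Fin K, (i : ℕ) + 1 < j → S i j = 0)
    (hadj : ∀ i j : Fin K, (i : ℕ) + 1 = j → 0 < S i j) {l : Fin K → ℝ} {e : Fin K → Fin K → ℝ}
    (he : ∀ k, S *ᵥ e k = l k • e k)
    (horth : ∀ k m, e k ⬝ᵥ e m = if k = m then 1 else 0)
    (hdot : ∀ x y : Fin K → ℝ, x ⬝ᵥ y = ∑ k, (e k ⬝ᵥ x) * (e k ⬝ᵥ y)) :
    ∃ k₀, (∀ k, k ≠ k₀ → l k < l k₀) ∧ ∀ i j, 0 < e k₀ i * e k₀ j := by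
  have : Nonempty (Fin K) := ⟨⟨0, hK⟩⟩
  obtain ⟨k₀, hk₀⟩ := Finite.exists_max l
  set θ := l k₀ with hθ
  set p : Fin K → ℝ := fun i => |e k₀ i| with hp
  have hcoef : ∀ k (x : Fin K → ℝ), e k ⬝ᵥ (S *ᵥ x) = l k * (e k ⬝ᵥ x) := by
    intro k x
    rw [dotProduct_mulVec, ← mulVec_transpose, hsym, he k, smul_dotProduct, smul_eq_mul]
  have hquad : ∀ x : Fin K → ℝ, θ * (x ⬝ᵥ x) - x ⬝ᵥ (S *ᵥ x)
      = ∑ k, (θ - l k) * (e k ⬝ᵥ x) ^ 2 := by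
    intro x
    rw [hdot x x, hdot x (S *ᵥ x), Finset.mul_sum, ← Finset.sum_sub_distrib]
    refine Finset.sum_congr rfl fun k _ => ?_
    rw [hcoef]; ring
  have hpp : p ⬝ᵥ p = 1 := by
    have := horth k₀ k₀
    simp only [if_true] at this
    rw [← this]
    refine Finset.sum_congr rfl fun i _ => ?_
    simp [hp]
  -- Replacing entries by absolute values cannot lower the quadratic form, because the off-diagonal
  -- entries of `S` are nonnegative.
  have hle : θ ≤ p ⬝ᵥ (S *ᵥ p) := by
    have h1 : e k₀ ⬝ᵥ (S *ᵥ e k₀) = θ := by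
      rw [hcoef, horth]; simp [hθ]
    rw [← h1]
    simp only [dotProduct, mulVec, Finset.mul_sum]
    refine Finset.sum_le_sum fun i _ => Finset.sum_le_sum fun j _ => ?_
    by_cases hij : i = j
    · subst hij
      have : p i * (S i i * p i) = S i i * (|e k₀ i| * |e k₀ i|) := by simp only [hp]; ring
      rw [this, abs_mul_abs_self]
      exact le_of_eq (by ring)
    · have h2 := hoff i j hij
      have : e k₀ i * (S i j * e k₀ j) = S i j * (e k₀ i * e k₀ j) := by ring
      rw [this]
      have h3 : p i * (S i j * p j) = S i j * |e k₀ i * e k₀ j| := by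
        simp only [hp, abs_mul]; ring
      rw [h3]
      exact mul_le_mul_of_nonneg_left (le_abs_self _) h2
  -- The unit vector `p` maximises the Rayleigh quotient, so its coefficients outside the top
  -- eigenspace vanish.
  have hSp : S *ᵥ p = θ • p := by
    have hz : ∑ k, (θ - l k) * (e k ⬝ᵥ p) ^ 2 ≤ 0 := by
      rw [← hquad, hpp]; linarith
    have hnn : ∀ k ∈ Finset.univ, 0 ≤ (θ - l k) * (e k ⬝ᵥ p) ^ 2 := fun k _ =>
      mul_nonneg (sub_nonneg.mpr (hk₀ k)) (sq_nonneg _)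
    have hz' := (Finset.sum_eq_zero_iff_of_nonneg hnn).mp
      (le_antisymm hz (Finset.sum_nonneg hnn))
    have hd : (S *ᵥ p - θ • p) ⬝ᵥ (S *ᵥ p - θ • p) = 0 := by
      rw [hdot]
      refine Finset.sum_eq_zero fun k _ => ?_
      have : e k ⬝ᵥ (S *ᵥ p - θ • p) = 0 := by
        rw [dotProduct_sub, hcoef, dotProduct_smul, smul_eq_mul]
        rcases mul_eq_zero.mp (hz' k (Finset.mem_univ _)) with h | h
        · rw [show l k = θ by linarith]; ring
        · rw [pow_eq_zero_iff two_ne_zero] at h; rw [h]; ring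
      rw [this, zero_mul]
    exact sub_eq_zero.mp (dotProduct_self_eq_zero.mp hd)
  have hp0 : p ≠ 0 := by
    intro h; rw [h] at hpp; simp at hpp
  have hppos := tridiagonal_nonneg_eigenvector_pos hoff hsym htri hadj hSp
    (fun i => abs_nonneg _) hp0
  -- Two eigenvectors for θ are proportional: the combination that cancels the first entry is zero.
  have hprop : ∀ (y z : Fin K → ℝ), S *ᵥ y = θ • y → S *ᵥ z = θ • z →
      ∀ i, z ⟨0, hK⟩ * y i = y ⟨0, hK⟩ * z i := by
    intro y z hy hz i
    have h0 : (z ⟨0, hK⟩ • y - y ⟨0, hK⟩ • z) = 0 := by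
      refine tridiagonal_eigenvector_eq_zero htri hadj (θ := θ) ?_ ?_
      · rw [mulVec_sub, mulVec_smul, mulVec_smul, hy, hz, smul_sub, smul_comm θ, smul_comm θ]
      · intro i hi
        rw [show i = ⟨0, hK⟩ from Fin.ext hi]
        simp [mul_comm]
    have := congrFun h0 i
    simp only [Pi.sub_apply, Pi.smul_apply, smul_eq_mul, Pi.zero_apply] at this
    linarith
  refine ⟨k₀, ?_, ?_⟩
  · intro k hk
    refine lt_of_le_of_ne (hk₀ k) fun hEq => ?_
    have h1 := hprop (e k) p (by rw [he k, hEq]) hSp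
    have h2 := hprop (e k₀) p (he k₀) hSp
    have ho := horth k k₀
    rw [if_neg hk] at ho
    -- Both vectors are multiples of `p`, so orthogonality forces one of the two first entries to
    -- vanish.
    have hc : p ⟨0, hK⟩ ^ 2 * (e k ⬝ᵥ e k₀) = e k ⟨0, hK⟩ * e k₀ ⟨0, hK⟩ * (p ⬝ᵥ p) := by
      simp only [dotProduct, Finset.mul_sum]
      refine Finset.sum_congr rfl fun i _ => ?_
      calc p ⟨0, hK⟩ ^ 2 * (e k i * e k₀ i) = (p ⟨0, hK⟩ * e k i) * (p ⟨0, hK⟩ * e k₀ i) := by ring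
        _ = _ := by rw [h1, h2]; ring
    rw [ho, hpp, mul_zero, mul_one] at hc
    have hz0 : e k ⟨0, hK⟩ = 0 := by
      refine (mul_eq_zero.mp hc.symm).resolve_right fun h => ?_
      have := hppos ⟨0, hK⟩
      simp [hp, h] at this
    have hz := tridiagonal_eigenvector_eq_zero htri hadj (he k)
      (fun i hi => by rw [show i = ⟨0, hK⟩ from Fin.ext hi]; exact hz0)
    have := horth k k
    rw [hz] at this
    simp at this
  · intro i j
    have h2 := hprop (e k₀) p (he k₀) hSp
    have hq := hppos ⟨0, hK⟩
    have h3 : p ⟨0, hK⟩ ^ 2 * (e k₀ i * e k₀ j) = e k₀ ⟨0, hK⟩ ^ 2 * (p i * p j) := by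
      calc _ = (p ⟨0, hK⟩ * e k₀ i) * (p ⟨0, hK⟩ * e k₀ j) := by ring
        _ = _ := by rw [h2, h2]; ring
    have h4 : 0 < e k₀ ⟨0, hK⟩ ^ 2 := by
      rw [← sq_abs]; exact pow_pos hq 2
    have h5 : 0 < p ⟨0, hK⟩ ^ 2 * (e k₀ i * e k₀ j) := by
      rw [h3]; exact mul_pos h4 (mul_pos (hppos i) (hppos j))
    exact (pos_iff_pos_of_mul_pos h5).mp (pow_pos hq 2)

end Tridiagonal

/-! ### The killed generator and the spectral representation of the tails. -/

/-- The truncated predecessor `(n : ℕ) - 1` is harmless at `n = 0`, where its coefficient vanishes.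
-/
theorem sum_psRate_mul {K : ℕ} (ρ : ℝ) (n : Fin K) (g : ℕ → ℝ) :
    ∑ m : Fin K, psRate K ρ (some n) (some m) * g m
      = (if (n : ℕ) + 1 < K then ρ * g (n + 1) else 0)
        + (n : ℝ) / ((n : ℝ) + 1) * g ((n : ℕ) - 1) := by
  have h1 : ∀ m : Fin K, psRate K ρ (some n) (some m) * g m =
      (fun m : ℕ => (if m = (n : ℕ) + 1 then ρ * g (n + 1) else 0)
        + (if m + 1 = (n : ℕ) then (n : ℝ) / ((n : ℝ) + 1) * g ((n : ℕ) - 1) else 0)) m := by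
    intro m
    simp only [psRate]
    by_cases hm : (m : ℕ) = n + 1
    · rw [if_pos hm, if_pos hm, if_neg (by omega), add_zero, hm]
    · by_cases hm2 : (m : ℕ) + 1 = n
      · have : (n : ℕ) - 1 = m := by omega
        rw [if_neg hm, if_pos hm2, if_neg hm, if_pos hm2, this, zero_add]
      · simp [hm, hm2]
  rw [Finset.sum_congr rfl fun m _ => h1 m, Fin.sum_univ_eq_sum_range (fun m : ℕ =>
    (if m = (n : ℕ) + 1 then ρ * g (n + 1) else 0)
        + (if m + 1 = (n : ℕ) then (n : ℝ) / ((n : ℝ) + 1) * g ((n : ℕ) - 1) else 0)) K,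
    Finset.sum_add_distrib]
  congr 1
  · rw [Finset.sum_ite_eq' (Finset.range K)]
    simp
  · rcases Nat.eq_zero_or_pos (n : ℕ) with h | h
    · simp [h]
    · rw [Finset.sum_eq_single ((n : ℕ) - 1)]
      · rw [if_pos (by omega)]
      · intro b _ hb
        rw [if_neg (by omega)]
      · intro hb
        have := n.2
        simp at hb; omega

/-- The generator restricted to the states in which the tagged customer is present. -/
noncomputable def psBlock (K : ℕ) (ρ : ℝ) : Matrix (Fin K) (Fin K) ℝ :=
  Matrix.of fun i j => psGenerator K ρ (some i) (some j)

/-- The rates `n / (n + 1)` and `1 / (n + 1)` add up to one, so only the arrival term depends on the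
state. -/
theorem psBlock_diag {K : ℕ} (ρ : ℝ) (n : Fin K) :
    psBlock K ρ n n = -((if (n : ℕ) + 1 < K then ρ else 0) + 1) := by
  have h := sum_psRate_mul ρ n (fun _ => 1)
  simp only [mul_one] at h
  simp only [psBlock, psGenerator, Matrix.of_apply, if_true, Fintype.sum_option, h]
  simp only [psRate]
  have : (n : ℝ) + 1 ≠ 0 := by positivity
  field_simp
  split_ifs <;> ring

theorem psBlock_off {K : ℕ} (ρ : ℝ) {n m : Fin K} (h : n ≠ m) :
    psBlock K ρ n m = psRate K ρ (some n) (some m) := by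
  simp [psBlock, psGenerator, h]

theorem psRate_self {K : ℕ} (ρ : ℝ) (n : Fin K) : psRate K ρ (some n) (some n) = 0 := by
  simp [psRate]

open Matrix in
/-- The action of the generator on a function of the number of other customers. -/
theorem psBlock_mulVec {K : ℕ} (ρ : ℝ) (n : Fin K) (g : ℕ → ℝ) :
    (psBlock K ρ *ᵥ fun m => g m) n
      = (if (n : ℕ) + 1 < K then ρ * (g (n + 1) - g n) else 0)
        + (n : ℝ) / ((n : ℝ) + 1) * g ((n : ℕ) - 1) - g n := by
  have h : ∀ m : Fin K, psBlock K ρ n m * g m = psRate K ρ (some n) (some m) * g m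
      + (if n = m then psBlock K ρ n n * g n else 0) := by
    intro m
    by_cases hnm : n = m
    · subst hnm; simp [psRate_self]
    · simp [hnm, psBlock_off]
  simp only [mulVec, dotProduct, h, Finset.sum_add_distrib, sum_psRate_mul, Finset.sum_ite_eq,
    Finset.mem_univ, if_true, psBlock_diag]
  split_ifs <;> ring

attribute [local instance] Matrix.linftyOpNormedRing Matrix.linftyOpNormedAlgebra in
open Matrix in
theorem exp_mulVec_of_eigenvector {ι : Type*} [Fintype ι] [DecidableEq ι] (M : Matrix ι ι ℝ)
    (v : ι → ℝ) (c : ℝ) (h : M *ᵥ v = c • v) :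
    NormedSpace.exp M *ᵥ v = Real.exp c • v := by
  have hpow : ∀ n : ℕ, (M ^ n) *ᵥ v = c ^ n • v := by
    intro n
    induction n with
    | zero => simp
    | succ n ih => rw [pow_succ, ← mulVec_mulVec, h, mulVec_smul, ih, smul_smul, pow_succ, mul_comm]
  have h1 := NormedSpace.exp_series_hasSum_exp' (𝕂 := ℝ) M
  have hcont : Continuous fun B : Matrix ι ι ℝ => B *ᵥ v := by fun_prop
  have h2 := h1.map (Matrix.mulVecBilin ℝ ℝ |>.flip v) hcont
  have h3 : HasSum (fun n : ℕ => ((n.factorial : ℝ)⁻¹ * c ^ n) • v) (Real.exp c • v) := by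
    have := NormedSpace.exp_series_hasSum_exp' (𝕂 := ℝ) c
    rw [← Real.exp_eq_exp_ℝ] at this
    exact this.smul_const v
  refine HasSum.unique h2 ?_
  convert! h3 using 2 with n
  simp [hpow, smul_smul]

-- Since the departed state is absorbing, extension by zero turns an eigenvector of the block into
-- one of the full generator, on which the semigroup acts by a scalar.
open Matrix in
theorem psTransition_mulVec_some {K : ℕ} (ρ t : ℝ) (f : Fin K → ℝ) (c : ℝ)
    (h : psBlock K ρ *ᵥ f = c • f) (n : Fin K) :
    ∑ m, psTransition K ρ t (some n) (some m) * f m = Real.exp (c * t) * f n := by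
  set φ : Option (Fin K) → ℝ := fun o => o.elim 0 f with hφ
  have h1 : (t • psGenerator K ρ) *ᵥ φ = (c * t) • φ := by
    rw [smul_mulVec]
    funext o
    cases o with
    | none =>
      simp only [mulVec, dotProduct, Pi.smul_apply, Fintype.sum_option, hφ, smul_eq_mul,
        Option.elim_none, Option.elim_some, mul_zero, zero_add]
      simp [psGenerator, psRate]
    | some i =>
      have := congrFun h i
      simp only [mulVec, dotProduct, Pi.smul_apply, smul_eq_mul, psBlock, of_apply] at this
      simp only [mulVec, dotProduct, Pi.smul_apply, Fintype.sum_option, hφ, smul_eq_mul,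
        Option.elim_none, Option.elim_some, mul_zero, zero_add, this]
      ring
  have h2 := congrFun (exp_mulVec_of_eigenvector _ _ _ h1) (some n)
  simpa [mulVec, dotProduct, Fintype.sum_option, hφ, psTransition] using h2

/-- Detailed balance: the flow `ρ * ρ ^ n * (n + 1)` up from `n` equals the flow down from `n + 1`.
Conjugation by the square roots of the weights makes the block symmetric. -/
theorem psBlock_symmetrizable {K : ℕ} {ρ : ℝ} (i j : Fin K) :
    (ρ ^ (i : ℕ) * ((i : ℝ) + 1)) * psBlock K ρ i j
      = (ρ ^ (j : ℕ) * ((j : ℝ) + 1)) * psBlock K ρ j i := by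
  by_cases h : i = j
  · rw [h]
  · rw [psBlock_off ρ h, psBlock_off ρ (Ne.symm h)]
    have hi : (i : ℝ) + 1 ≠ 0 := by positivity
    have hj : (j : ℝ) + 1 ≠ 0 := by positivity
    simp only [psRate]
    by_cases h1 : (j : ℕ) = i + 1
    · rw [if_pos h1, if_neg (by omega), if_pos (by omega)]
      field_simp
      rw [h1]; push_cast; ring
    · by_cases h2 : (i : ℕ) = j + 1
      · rw [if_neg h1, if_pos (by omega), if_pos h2]
        field_simp
        rw [h2]; push_cast; ring
      · rw [if_neg h1, if_neg (by omega), if_neg h2, if_neg (by omega)]; ring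

/-- `θ` is the strictly dominant exponent in a spectral representation of all the tails of the
sojourn time, and the generator has a positive left eigenvector with eigenvalue `θ`. -/
def IsDecayRate (K : ℕ) (ρ θ : ℝ) : Prop :=
  ∃ (C : Fin K → ℝ) (B : Fin K → Fin K → ℝ) (l : Fin K → ℝ) (w : Fin K → ℝ),
    (∀ n, 0 < C n) ∧ (∀ k, l k < θ) ∧
    (∀ n t, sojournTail K ρ n t
      = C n * Real.exp (θ * t) + ∑ k, B n k * Real.exp (l k * t)) ∧
    (∀ n, 0 < w n) ∧ (∀ m, ∑ n, w n * psBlock K ρ n m = θ * w m)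

open Matrix in
theorem exists_isDecayRate {K : ℕ} {ρ : ℝ} (hK : 0 < K) (hρ : 0 < ρ) :
    ∃ θ : ℝ, IsDecayRate K ρ θ := by
  set d : Fin K → ℝ := fun i => √(ρ ^ (i : ℕ) * ((i : ℝ) + 1)) with hd
  have hd0 : ∀ i, 0 < d i := fun i => Real.sqrt_pos.mpr (by positivity)
  have hdd : ∀ i, d i * d i = ρ ^ (i : ℕ) * ((i : ℝ) + 1) :=
    fun i => Real.mul_self_sqrt (by positivity)
  set S : Matrix (Fin K) (Fin K) ℝ := Matrix.of fun i j => d i * psBlock K ρ i j / d j with hS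
  have hsym : S.IsSymm := by
    ext i j
    simp only [transpose_apply, hS, of_apply]
    rw [div_eq_div_iff (hd0 _).ne' (hd0 _).ne']
    have := psBlock_symmetrizable (ρ := ρ) j i
    rw [← hdd, ← hdd] at this
    linarith
  have hoff : ∀ i j, i ≠ j → 0 ≤ S i j := by
    intro i j hij
    simp only [hS, of_apply, psBlock_off ρ hij, psRate]
    have := hd0 i
    have := hd0 j
    positivity
  have htri : ∀ i j : Fin K, (i : ℕ) + 1 < j → S i j = 0 := by
    intro i j hij
    have hne : i ≠ j := by intro h; rw [h] at hij; omega
    simp only [hS, of_apply, psBlock_off ρ hne, psRate]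
    rw [if_neg (by omega), if_neg (by omega)]; simp
  have hadj : ∀ i j : Fin K, (i : ℕ) + 1 = j → 0 < S i j := by
    intro i j hij
    have hne : i ≠ j := by intro h; rw [h] at hij; omega
    simp only [hS, of_apply, psBlock_off ρ hne, psRate]
    rw [if_pos hij.symm]
    have := hd0 i
    have := hd0 j
    positivity
  obtain ⟨l, e, he, horth, hdot, hexp⟩ := exists_orthonormal_eigenbasis S hsym
  obtain ⟨k₀, hlt, hpos⟩ := tridiagonal_perron hK hsym hoff htri hadj he horth hdot
  have hA : ∀ k, psBlock K ρ *ᵥ (fun n => e k n / d n) = l k • fun n => e k n / d n := by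
    intro k
    funext i
    have h := congrFun (he k) i
    simp only [mulVec, dotProduct, Pi.smul_apply, smul_eq_mul, hS, of_apply] at h ⊢
    rw [← mul_div_assoc, ← h, Finset.sum_div]
    refine Finset.sum_congr rfl fun j _ => ?_
    have := (hd0 i).ne'
    have := (hd0 j).ne'
    field_simp
  have htail : ∀ n t, sojournTail K ρ n t
      = ∑ k, (e k ⬝ᵥ d) * (e k n / d n) * Real.exp (l k * t) := by
    intro n t
    -- The tail is the semigroup applied to the constant function 1, which is expanded in the
    -- eigenbasis here.
    have hone : ∀ m, (1 : ℝ) = ∑ k, (e k ⬝ᵥ d) * (e k m / d m) := by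
      intro m
      have h := hexp d m
      simp only [← mul_div_assoc]
      rw [← Finset.sum_div, ← h, div_self (hd0 m).ne']
    calc sojournTail K ρ n t
        = ∑ m, psTransition K ρ t (some n) (some m) * ∑ k, (e k ⬝ᵥ d) * (e k m / d m) := by
          simp only [sojournTail, ← hone, mul_one]
      _ = ∑ k, (e k ⬝ᵥ d) * ∑ m, psTransition K ρ t (some n) (some m) * (e k m / d m) := by
          simp only [Finset.mul_sum]
          rw [Finset.sum_comm]
          refine Finset.sum_congr rfl fun k _ => Finset.sum_congr rfl fun m _ => ?_
          ring
      _ = _ := by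
          refine Finset.sum_congr rfl fun k _ => ?_
          rw [psTransition_mulVec_some ρ t _ _ (hA k) n]; ring
  -- The index `k₀` stays in the remaining sum with coefficient 0 and a dummy exponent below θ. The
  -- factor `e k₀ ⟨0, hK⟩` in the left eigenvector fixes its sign.
  refine ⟨l k₀, fun n => (e k₀ ⬝ᵥ d) * (e k₀ n / d n),
    fun n k => if k = k₀ then 0 else (e k ⬝ᵥ d) * (e k n / d n),
    fun k => if k = k₀ then l k₀ - 1 else l k, fun n => d n * (e k₀ ⟨0, hK⟩ * e k₀ n),
    ?_, ?_, ?_, ?_, ?_⟩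
  · intro n
    simp only [dotProduct, Finset.sum_mul]
    have : Nonempty (Fin K) := ⟨⟨0, hK⟩⟩
    refine Finset.sum_pos (fun i _ => ?_) Finset.univ_nonempty
    have h1 := hpos i n
    have h2 := hd0 i
    have h3 := hd0 n
    have : e k₀ i * d i * (e k₀ n / d n) = (e k₀ i * e k₀ n) * d i / d n := by ring
    rw [this]; positivity
  · intro k
    show (if k = k₀ then l k₀ - 1 else l k) < l k₀
    split_ifs with h
    · linarith
    · exact hlt k h
  · intro n t
    rw [htail, ← Finset.add_sum_erase _ _ (Finset.mem_univ k₀)]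
    congr 1
    rw [← Finset.add_sum_erase (a := k₀) (f := fun k => (if k = k₀ then 0 else (e k ⬝ᵥ d) *
      (e k n / d n)) * Real.exp ((if k = k₀ then l k₀ - 1 else l k) * t)) _ (Finset.mem_univ k₀)]
    simp only [if_true, zero_mul, zero_add]
    refine Finset.sum_congr rfl fun k hk => ?_
    rw [if_neg (Finset.ne_of_mem_erase hk), if_neg (Finset.ne_of_mem_erase hk)]
  · intro n
    exact mul_pos (hd0 n) (hpos _ n)
  · intro m
    have h := congrFun (he k₀) m
    rw [← hsym] at h
    simp only [mulVec, dotProduct, Pi.smul_apply, smul_eq_mul, hS, of_apply, transpose_apply] at h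
    have h2 : ∑ n, d n * (e k₀ ⟨0, hK⟩ * e k₀ n) * psBlock K ρ n m
        = d m * e k₀ ⟨0, hK⟩ * ∑ x, d x * psBlock K ρ x m / d m * e k₀ x := by
      rw [Finset.mul_sum]
      refine Finset.sum_congr rfl fun x _ => ?_
      have := (hd0 m).ne'
      field_simp
    rw [h2, h]; ring

/-! ### Comparison principles for the decay rate. -/

-- Collatz-Wielandt: with the positive left eigenvector `w`, `θ ⟨w, v⟩ = ⟨w, A v⟩ ≤ lam ⟨w, v⟩`.
open Matrix in
theorem IsDecayRate.le_of_mulVec_le {K : ℕ} {ρ θ lam : ℝ} (hK : 0 < K) (h : IsDecayRate K ρ θ)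
    (v : Fin K → ℝ) (hv : ∀ n, 0 < v n) (hle : ∀ n, (psBlock K ρ *ᵥ v) n ≤ lam * v n) :
    θ ≤ lam := by
  obtain ⟨-, -, -, w, -, -, -, hw, hwA⟩ := h
  have : Nonempty (Fin K) := ⟨⟨0, hK⟩⟩
  have hpos : 0 < ∑ n, w n * v n :=
    Finset.sum_pos (fun n _ => mul_pos (hw n) (hv n)) Finset.univ_nonempty
  have h1 : θ * ∑ n, w n * v n = ∑ n, w n * (psBlock K ρ *ᵥ v) n := by
    simp only [mulVec, dotProduct, Finset.mul_sum]
    rw [Finset.sum_comm]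
    refine Finset.sum_congr rfl fun m _ => ?_
    rw [← mul_assoc, ← hwA, Finset.sum_mul]
    exact Finset.sum_congr rfl fun n _ => by ring
  have h2 : θ * ∑ n, w n * v n ≤ lam * ∑ n, w n * v n := by
    rw [h1, Finset.mul_sum]
    refine Finset.sum_le_sum fun n _ => ?_
    have := mul_le_mul_of_nonneg_left (hle n) (hw n).le
    linarith
  exact le_of_mul_le_mul_right h2 hpos

-- The same pairing, but `v` may vanish at some states. This is what permits truncated test vectors.
open Matrix in
theorem IsDecayRate.ge_of_le_mulVec {K : ℕ} {ρ θ lam : ℝ} (h : IsDecayRate K ρ θ)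
    (v : Fin K → ℝ) (hv : ∀ n, 0 ≤ v n) (hv' : ∃ n, 0 < v n)
    (hle : ∀ n, lam * v n ≤ (psBlock K ρ *ᵥ v) n) : lam ≤ θ := by
  obtain ⟨-, -, -, w, -, -, -, hw, hwA⟩ := h
  obtain ⟨n₀, hn₀⟩ := hv'
  have hpos : 0 < ∑ n, w n * v n :=
    Finset.sum_pos' (fun n _ => mul_nonneg (hw n).le (hv n))
      ⟨n₀, Finset.mem_univ _, mul_pos (hw n₀) hn₀⟩
  have h1 : θ * ∑ n, w n * v n = ∑ n, w n * (psBlock K ρ *ᵥ v) n := by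
    simp only [mulVec, dotProduct, Finset.mul_sum]
    rw [Finset.sum_comm]
    refine Finset.sum_congr rfl fun m _ => ?_
    rw [← mul_assoc, ← hwA, Finset.sum_mul]
    exact Finset.sum_congr rfl fun n _ => by ring
  have h2 : lam * ∑ n, w n * v n ≤ θ * ∑ n, w n * v n := by
    rw [h1, Finset.mul_sum]
    refine Finset.sum_le_sum fun n _ => ?_
    have := mul_le_mul_of_nonneg_left (hle n) (hw n).le
    linarith
  exact le_of_mul_le_mul_right h2 hpos

/-- Test with the constant function: the killing rate `1 / (n + 1)` is at least `1 / K` in every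
state. -/
theorem IsDecayRate.neg {K : ℕ} {ρ θ : ℝ} (hK : 0 < K) (h : IsDecayRate K ρ θ) : θ < 0 := by
  have h1 : θ ≤ -1 / K := by
    refine h.le_of_mulVec_le hK (fun _ => 1) (fun _ => one_pos) fun n => ?_
    have := psBlock_mulVec ρ n (fun _ => 1)
    rw [this]
    have hn : ((n : ℕ) : ℝ) + 1 ≤ K := by exact_mod_cast n.2
    have hn0 : (0 : ℝ) < ((n : ℕ) : ℝ) + 1 := by positivity
    have h2 : 1 / (K : ℝ) ≤ 1 / (((n : ℕ) : ℝ) + 1) := one_div_le_one_div_of_le hn0 hn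
    have h3 : ((n : ℕ) : ℝ) / (((n : ℕ) : ℝ) + 1) = 1 - 1 / (((n : ℕ) : ℝ) + 1) := by
      field_simp; ring
    simp only [sub_self, mul_zero, ite_self, mul_one, h3, neg_div]
    linarith
  have : (0 : ℝ) < 1 / K := by positivity
  have h2 : -1 / (K : ℝ) = -(1 / K) := by ring
  linarith

/-! ### Dominant singularity and tail exponent. -/

/-- The transform is a sum of simple fractions. The term `c / (z - s)` gives a simple pole at `s`,
and the others are analytic wherever `s ≤ z.re`. -/
theorem isDominantSingularity_of_exp_sum {ι : Type*} [Fintype ι] {p : ℝ → ℝ} {s c : ℝ}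
    {b l : ι → ℝ} (hc : c ≠ 0) (hl : ∀ k, l k < s)
    (hp : ∀ t, p t = c * Real.exp (s * t) + ∑ k, b k * Real.exp (l k * t)) :
    IsDominantSingularity p s := by
  set g : ℂ → ℂ := fun z => ∑ k, (b k : ℂ) / (z - (l k : ℂ)) with hg
  have hgan : ∀ z : ℂ, (∀ k, z ≠ (l k : ℂ)) → AnalyticAt ℂ g z := by
    intro z hz
    refine Finset.analyticAt_fun_sum _ fun k _ => ?_
    exact analyticAt_const.div (analyticAt_id.sub analyticAt_const) (sub_ne_zero.mpr (hz k))
  have hs : ∀ k, (s : ℂ) ≠ (l k : ℂ) := fun k h => (hl k).ne' (by exact_mod_cast h)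
  refine ⟨fun z => (c : ℂ) / (z - (s : ℂ)) + g z, ⟨?_, s, ?_⟩, ?_, ?_⟩
  · intro z
    refine MeromorphicAt.add ?_ ?_
    · exact (MeromorphicAt.const _ z).div ((MeromorphicAt.id z).sub (MeromorphicAt.const _ z))
    · refine MeromorphicAt.fun_sum fun k _ => ?_
      exact (MeromorphicAt.const _ z).div ((MeromorphicAt.id z).sub (MeromorphicAt.const _ z))
  · intro z hz
    have hterm : ∀ r q : ℝ, q ≤ s → MeasureTheory.IntegrableOn
        (fun t : ℝ => (r : ℂ) * Complex.exp (((q : ℂ) - z) * t)) (Set.Ioi 0) ∧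
        ∫ t in Set.Ioi (0 : ℝ), (r : ℂ) * Complex.exp (((q : ℂ) - z) * t) = r / (z - q) := by
      intro r q hq
      have hre : ((q : ℂ) - z).re < 0 := by simp; linarith
      refine ⟨(integrableOn_exp_mul_complex_Ioi hre 0).const_mul _, ?_⟩
      rw [MeasureTheory.integral_const_mul, integral_exp_mul_complex_Ioi hre]
      have h1 : (q : ℂ) - z ≠ 0 := fun h => by rw [h] at hre; simp at hre
      have h2 : z - (q : ℂ) ≠ 0 := by rw [← neg_sub]; exact neg_ne_zero.mpr h1
      simp only [Complex.ofReal_zero, mul_zero, Complex.exp_zero]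
      rw [← neg_sub z (q : ℂ)]
      field_simp
    have hfun : (fun t : ℝ => Complex.exp (-z * t) * (p t : ℂ)) = fun t : ℝ =>
        (c : ℂ) * Complex.exp (((s : ℂ) - z) * t)
          + ∑ k, (b k : ℂ) * Complex.exp (((l k : ℂ) - z) * t) := by
      funext t
      rw [hp]
      push_cast
      rw [mul_add, Finset.mul_sum]
      congr 1
      · rw [mul_left_comm, ← Complex.exp_add]; ring_nf
      · refine Finset.sum_congr rfl fun k _ => ?_
        rw [mul_left_comm, ← Complex.exp_add]; ring_nf
    have hsumint : MeasureTheory.IntegrableOn (fun t : ℝ =>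
        ∑ k, (b k : ℂ) * Complex.exp (((l k : ℂ) - z) * t)) (Set.Ioi 0) :=
      MeasureTheory.integrable_finsetSum _ fun k _ => (hterm (b k) (l k) (hl k).le).1
    rw [hfun]
    refine ⟨(hterm c s le_rfl).1.add hsumint, ?_⟩
    rw [MeasureTheory.integral_add (hterm c s le_rfl).1 hsumint, (hterm c s le_rfl).2,
      MeasureTheory.integral_finsetSum _ fun k _ => (hterm (b k) (l k) (hl k).le).1]
    simp only [hg, add_right_inj]
    exact Finset.sum_congr rfl fun k _ => ((hterm (b k) (l k) (hl k).le).2).symm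
  · have hmer : MeromorphicAt (fun z => (c : ℂ) / (z - (s : ℂ)) + g z) (s : ℂ) :=
      ((MeromorphicAt.const _ _).div ((MeromorphicAt.id _).sub (MeromorphicAt.const _ _))).add
        (hgan _ hs).meromorphicAt
    have : meromorphicOrderAt (fun z => (c : ℂ) / (z - (s : ℂ)) + g z) (s : ℂ) = (-1 : ℤ) := by
      rw [meromorphicOrderAt_eq_int_iff hmer]
      refine ⟨fun z => (c : ℂ) + (z - (s : ℂ)) * g z, ?_, ?_, ?_⟩
      · exact analyticAt_const.add ((analyticAt_id.sub analyticAt_const).mul (hgan _ hs))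
      · simpa using hc
      · filter_upwards [self_mem_nhdsWithin] with z hz
        have : z - (s : ℂ) ≠ 0 := sub_ne_zero.mpr hz
        simp only [zpow_neg, zpow_one, smul_eq_mul]
        field_simp
    rw [this]
    exact_mod_cast (by norm_num : (-1 : ℤ) < 0)
  · intro z hz hzs
    by_contra hcon
    push Not at hcon
    have hzl : ∀ k, z ≠ (l k : ℂ) := by
      intro k h
      rw [h, Complex.ofReal_re] at hcon
      exact absurd (hl k) (not_lt.mpr hcon)
    have han : AnalyticAt ℂ (fun z => (c : ℂ) / (z - (s : ℂ)) + g z) z :=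
      (analyticAt_const.div (analyticAt_id.sub analyticAt_const) (sub_ne_zero.mpr hzs)).add
        (hgan z hzl)
    exact absurd hz (not_lt.mpr han.meromorphicOrderAt_nonneg)

theorem IsDecayRate.isDominantSingularity {K : ℕ} {ρ θ : ℝ} (hK : 0 < K)
    (h : IsDecayRate K ρ θ) (n : Fin K) : IsDominantSingularity (sojournDensity K ρ n) θ := by
  have hneg := h.neg hK
  obtain ⟨C, B, l, -, hC, hl, htail, -⟩ := h
  refine isDominantSingularity_of_exp_sum (c := -(θ * C n)) (b := fun k => -(l k * B n k)) (l := l)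
    (neg_ne_zero.mpr (mul_ne_zero hneg.ne (hC n).ne')) hl fun t => ?_
  have hd : HasDerivAt (sojournTail K ρ n) (C n * (Real.exp (θ * t) * θ)
      + ∑ k, B n k * (Real.exp (l k * t) * l k)) t := by
    rw [show sojournTail K ρ n = fun t => C n * Real.exp (θ * t)
      + ∑ k, B n k * Real.exp (l k * t) from funext (htail n)]
    have hexp : ∀ a : ℝ, HasDerivAt (fun t => Real.exp (a * t)) (Real.exp (a * t) * a) t := by
      intro a
      simpa using ((hasDerivAt_id t).const_mul a).exp
    refine ((hexp θ).const_mul _).add ?_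
    exact HasDerivAt.fun_sum fun k _ => (hexp (l k)).const_mul _
  rw [sojournDensity, hd.deriv, neg_add, ← Finset.sum_neg_distrib]
  congr 1
  · ring
  · exact Finset.sum_congr rfl fun k _ => by ring

/-- After extraction of `exp (θ t)` the remaining factor converges to a mean of the positive
constants `C n`, so its logarithm is bounded for large `t`. -/
theorem IsDecayRate.tendsto_log_tail {K : ℕ} {ρ θ : ℝ}
    (h : IsDecayRate K ρ θ) (w : Fin K → ℝ) (hw : ∀ n, 0 ≤ w n) (hw1 : ∑ n, w n = 1) :
    Tendsto (fun t : ℝ => t⁻¹ * Real.log (∑ n, w n * sojournTail K ρ n t)) atTop (𝓝 θ) := by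
  obtain ⟨C, B, l, -, hC, hl, htail, -⟩ := h
  set G : ℝ → ℝ := fun t => ∑ n, w n * (C n + ∑ k, B n k * Real.exp ((l k - θ) * t)) with hG
  have hfac : ∀ t, ∑ n, w n * sojournTail K ρ n t = Real.exp (θ * t) * G t := by
    intro t
    simp only [hG, htail, Finset.mul_sum]
    refine Finset.sum_congr rfl fun n _ => ?_
    have hk : ∑ k, B n k * Real.exp (l k * t)
        = Real.exp (θ * t) * ∑ k, B n k * Real.exp ((l k - θ) * t) := by
      rw [Finset.mul_sum]
      refine Finset.sum_congr rfl fun k _ => ?_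
      rw [mul_left_comm, ← Real.exp_add]; ring_nf
    rw [hk]; ring
  have hlim : Tendsto G atTop (𝓝 (∑ n, w n * (C n + ∑ k : Fin K, B n k * 0))) := by
    refine tendsto_finsetSum _ fun n _ => Tendsto.const_mul _ (Tendsto.const_add _ ?_)
    refine tendsto_finsetSum _ fun k _ => Tendsto.const_mul _ ?_
    refine Real.tendsto_exp_atBot.comp ?_
    exact tendsto_id.const_mul_atTop_of_neg (sub_neg.mpr (hl k))
  have hpos : 0 < ∑ n, w n * (C n + ∑ k : Fin K, B n k * 0) := by
    simp only [mul_zero, Finset.sum_const_zero, add_zero]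
    obtain ⟨n, -, hn⟩ : ∃ n ∈ Finset.univ, 0 < w n := by
      by_contra hcon
      push Not at hcon
      have := Finset.sum_nonpos hcon
      linarith
    exact Finset.sum_pos' (fun n _ => mul_nonneg (hw n) (hC n).le)
      ⟨n, Finset.mem_univ _, mul_pos hn (hC n)⟩
  have hlog := (hlim.log hpos.ne')
  have h0 : Tendsto (fun t : ℝ => θ + t⁻¹ * Real.log (G t)) atTop (𝓝 (θ + 0 * _)) :=
    (tendsto_inv_atTop_zero.mul hlog).const_add θ
  rw [zero_mul, add_zero] at h0
  refine h0.congr' ?_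
  filter_upwards [hlim.eventually (lt_mem_nhds hpos), eventually_gt_atTop 0] with t ht ht0
  rw [hfac, Real.log_mul (Real.exp_pos _).ne' ht.ne', Real.log_exp]
  field_simp

/-! ### The recursion counted from the full queue. -/

/-- With `j = K - n` the rate `n / (n + 1)` becomes `1 - 1 / (K + 1 - j)`. It vanishes at `j = K`,
so the far end needs no boundary condition. -/
theorem reflected_recursion {K : ℕ} (ρ : ℝ) (a : ℕ → ℝ) (n : Fin K) :
    Matrix.mulVec (psBlock K ρ) (fun m => a (K - m)) n
      = (if (n : ℕ) + 1 < K then ρ * (a (K - n - 1) - a (K - n)) else 0)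
        + (1 - 1 / ((K : ℝ) + 1 - (K - n : ℕ))) * (if (n : ℕ) = 0 then 0 else a (K - n + 1))
        - a (K - n) := by
  rw [psBlock_mulVec ρ n (fun m => a (K - m))]
  have hn := n.2
  have hcast : ((K - n : ℕ) : ℝ) = (K : ℝ) - n := by
    rw [Nat.cast_sub hn.le]
  rw [hcast, show K - ((n : ℕ) + 1) = K - n - 1 by omega]
  congr 2
  rcases Nat.eq_zero_or_pos (n : ℕ) with h | h
  · simp [h]
  · rw [if_neg h.ne', show K - ((n : ℕ) - 1) = K - n + 1 by omega]
    have h1 : (n : ℝ) + 1 ≠ 0 := by positivity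
    rw [show (K : ℝ) + 1 - (K - n) = n + 1 by ring]
    congr 1
    field_simp; ring

/-- Supersolutions of the recursion bound the decay rate from above. The index `j` counts from the
reflecting end: `j = K - n`. -/
theorem IsDecayRate.le_of_supersolution {K : ℕ} {ρ θ lam : ℝ} (hK : 0 < K) (hρ : 0 < ρ)
    (h : IsDecayRate K ρ θ) (a : ℕ → ℝ) (hpos : ∀ j, 1 ≤ j → j ≤ K → 0 < a j) (h0 : a 1 ≤ a 0)
    (hrec : ∀ j, 1 ≤ j → j ≤ K → ρ * a (j - 1) + (1 - 1 / ((K : ℝ) + 1 - j)) * a (j + 1)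
      - (1 + ρ) * a j ≤ lam * a j) : θ ≤ lam := by
  refine h.le_of_mulVec_le hK (fun m => a (K - m)) (fun n => hpos _ ?_ ?_) fun n => ?_
  · have := n.2; omega
  · omega
  · have hn := n.2
    rw [reflected_recursion]
    have hr := hrec (K - n) (by omega) (by omega)
    -- The full queue `j = 1` has no arrival term; `a 1 ≤ a 0` allows it to be added with the right
    -- sign.
    have h1 : (if (n : ℕ) + 1 < K then ρ * (a (K - n - 1) - a (K - n)) else 0)
        ≤ ρ * (a (K - n - 1) - a (K - n)) := by
      split_ifs with hc
      · exact le_rfl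
      · have : K - (n : ℕ) = 1 := by omega
        rw [this]
        exact mul_nonneg hρ.le (by simpa using h0)
    have h2 : (1 - 1 / ((K : ℝ) + 1 - (K - n : ℕ))) * (if (n : ℕ) = 0 then 0 else a (K - n + 1))
        = (1 - 1 / ((K : ℝ) + 1 - (K - n : ℕ))) * a (K - n + 1) := by
      split_ifs with hc
      · simp [hc]
      · rfl
    rw [h2]
    linarith

/-- Truncated subsolutions of the recursion bound the decay rate from below. -/
theorem IsDecayRate.ge_of_subsolution {K : ℕ} {ρ θ lam : ℝ} (hρ : 0 < ρ)
    (h : IsDecayRate K ρ θ) (a : ℕ → ℝ) (J : ℕ) (hJ : 1 ≤ J) (hJK : J ≤ K)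
    (hpos : ∀ j, 1 ≤ j → j ≤ J → 0 < a j) (hend : a (J + 1) ≤ 0) (h0 : a 0 ≤ a 1)
    (hrec : ∀ j, 1 ≤ j → j ≤ J → lam * a j ≤ ρ * a (j - 1)
      + (1 - 1 / ((K : ℝ) + 1 - j)) * a (j + 1) - (1 + ρ) * a j) : lam ≤ θ := by
  set b : ℕ → ℝ := fun j => if j ≤ J then a j else 0 with hb
  have hb0 : ∀ j, 1 ≤ j → 0 ≤ b j := by
    intro j hj
    simp only [hb]
    split_ifs with hc
    · exact (hpos j hj hc).le
    · exact le_rfl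
  refine h.ge_of_le_mulVec (fun m => b (K - m)) (fun n => hb0 _ ?_) ⟨⟨K - J, ?_⟩, ?_⟩ fun n => ?_
  · have := n.2; omega
  · omega
  · show 0 < b (K - (K - J))
    rw [show K - (K - J) = J by omega]
    simpa [hb] using hpos J hJ le_rfl
  · have hn := n.2
    rw [reflected_recursion]
    set j := K - (n : ℕ) with hj
    have hj1 : 1 ≤ j := by omega
    have hjK : j ≤ K := by omega
    have hcoef : 0 ≤ 1 - 1 / ((K : ℝ) + 1 - j) := by
      have h1 : (1 : ℝ) ≤ (K : ℝ) + 1 - j := by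
        have : (j : ℝ) ≤ K := by exact_mod_cast hjK
        linarith
      rw [sub_nonneg, div_le_one (by linarith)]; exact h1
    have h2 : (1 - 1 / ((K : ℝ) + 1 - j)) * (if (n : ℕ) = 0 then 0 else b (j + 1))
        = (1 - 1 / ((K : ℝ) + 1 - j)) * b (j + 1) := by
      split_ifs with hc
      · have : j = K := by omega
        simp [this]
      · rfl
    rw [h2]
    by_cases hjJ : j ≤ J
    · have hr := hrec j hj1 hjJ
      have hbj : b j = a j := by simp [hb, hjJ]
      have hbj' : b (j - 1) = a (j - 1) := by simp [hb, (show j - 1 ≤ J by omega)]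
      -- At `j = J` the truncation replaces a nonpositive value by 0, and its coefficient is
      -- nonnegative.
      have hbj1 : a (j + 1) ≤ b (j + 1) := by
        simp only [hb]
        split_ifs with hc
        · exact le_rfl
        · rw [show j + 1 = J + 1 by omega]; exact hend
      have h1 : ρ * (b (j - 1) - b j) ≤
          (if (n : ℕ) + 1 < K then ρ * (b (j - 1) - b j) else 0) := by
        split_ifs with hc
        · exact le_rfl
        · have : j = 1 := by omega
          rw [hbj, hbj', this]
          exact mul_nonpos_of_nonneg_of_nonpos hρ.le (by simpa using h0)
      have h3 := mul_le_mul_of_nonneg_left hbj1 hcoef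
      rw [hbj, hbj'] at *
      linarith
    · have hbj : b j = 0 := by simp [hb, hjJ]
      have h1 : 0 ≤ (if (n : ℕ) + 1 < K then ρ * (b (j - 1) - b j) else 0) := by
        split_ifs with hc
        · rw [hbj, sub_zero]; exact mul_nonneg hρ.le (hb0 _ (by omega))
        · exact le_rfl
      have h3 := mul_nonneg hcoef (hb0 (j + 1) (by omega))
      rw [hbj] at h1 ⊢
      rw [mul_zero]
      linarith

/-- The supersolution bound after the substitution `a j = √ρ ^ j * u j`. -/
theorem IsDecayRate.le_of_scaled_supersolution {K : ℕ} {ρ θ mu : ℝ} (hK : 0 < K) (hρ : 0 < ρ)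
    (h : IsDecayRate K ρ θ) (u : ℕ → ℝ) (hpos : ∀ j, 1 ≤ j → j ≤ K → 0 < u j)
    (h0 : √ρ * u 1 ≤ u 0)
    (hrec : ∀ j, 1 ≤ j → j ≤ K → u (j - 1) - 2 * u j + (1 - 1 / ((K : ℝ) + 1 - j)) * u (j + 1)
      ≤ mu * u j) : θ ≤ -(1 - √ρ) ^ 2 + √ρ * mu := by
  have hs : 0 < √ρ := Real.sqrt_pos.mpr hρ
  have hss : √ρ * √ρ = ρ := Real.mul_self_sqrt hρ.le
  refine h.le_of_supersolution hK hρ (fun j => √ρ ^ j * u j)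
    (fun j h1 h2 => mul_pos (pow_pos hs j) (hpos j h1 h2)) (by simpa using h0) fun j h1 h2 => ?_
  obtain ⟨i, rfl⟩ : ∃ i, j = i + 1 := ⟨j - 1, by omega⟩
  have hr := mul_le_mul_of_nonneg_left (hrec (i + 1) h1 h2) (pow_pos hs (i + 2)).le
  simp only [Nat.add_sub_cancel] at hr ⊢
  have e1 : ρ * (√ρ ^ i * u i) = √ρ ^ (i + 2) * u i := by rw [pow_add, pow_two, hss]; ring
  rw [e1]
  have e2 : (1 + ρ) * (√ρ ^ (i + 1) * u (i + 1)) = √ρ ^ (i + 1) * u (i + 1) * (1 + √ρ * √ρ) := by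
    rw [hss]; ring
  rw [e2]
  have e3 : √ρ ^ (i + 2) = √ρ ^ (i + 1) * √ρ := pow_succ _ _
  rw [e3] at hr ⊢
  linarith

/-- The subsolution bound after the substitution `a j = √ρ ^ j * u j`. -/
theorem IsDecayRate.ge_of_scaled_subsolution {K : ℕ} {ρ θ mu : ℝ} (hρ : 0 < ρ)
    (h : IsDecayRate K ρ θ) (u : ℕ → ℝ) (J : ℕ) (hJ : 1 ≤ J) (hJK : J ≤ K)
    (hpos : ∀ j, 1 ≤ j → j ≤ J → 0 < u j) (hend : u (J + 1) ≤ 0) (h0 : u 0 ≤ √ρ * u 1)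
    (hrec : ∀ j, 1 ≤ j → j ≤ J → mu * u j
      ≤ u (j - 1) - 2 * u j + (1 - 1 / ((K : ℝ) + 1 - j)) * u (j + 1)) :
    -(1 - √ρ) ^ 2 + √ρ * mu ≤ θ := by
  have hs : 0 < √ρ := Real.sqrt_pos.mpr hρ
  have hss : √ρ * √ρ = ρ := Real.mul_self_sqrt hρ.le
  refine h.ge_of_subsolution hρ (fun j => √ρ ^ j * u j) J hJ hJK
    (fun j h1 h2 => mul_pos (pow_pos hs j) (hpos j h1 h2))
    (mul_nonpos_of_nonneg_of_nonpos (pow_pos hs _).le hend) (by simpa using h0) fun j h1 h2 => ?_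
  obtain ⟨i, rfl⟩ : ∃ i, j = i + 1 := ⟨j - 1, by omega⟩
  have hr := mul_le_mul_of_nonneg_left (hrec (i + 1) h1 h2) (pow_pos hs (i + 2)).le
  simp only [Nat.add_sub_cancel] at hr ⊢
  have e1 : ρ * (√ρ ^ i * u i) = √ρ ^ (i + 2) * u i := by rw [pow_add, pow_two, hss]; ring
  rw [e1]
  have e2 : (1 + ρ) * (√ρ ^ (i + 1) * u (i + 1)) = √ρ ^ (i + 1) * u (i + 1) * (1 + √ρ * √ρ) := by
    rw [hss]; ring
  rw [e2]
  have e3 : √ρ ^ (i + 2) = √ρ ^ (i + 1) * √ρ := pow_succ _ _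
  rw [e3] at hr ⊢
  linarith

/-! ### Difference estimates for an amplitude times an Airy solution at a phase. -/

/-- `f` solves the Airy equation `f'' = x f`, with derivative `f'`. -/
structure IsAirySolution (f f' : ℝ → ℝ) : Prop where
  deriv_fst : ∀ x, HasDerivAt f (f' x) x
  deriv_snd : ∀ x, HasDerivAt f' (x * f x) x

theorem abs_le_mul_of_abs_deriv_le {F F' : ℝ → ℝ} {B δ : ℝ} (n : ℕ) (hB : 0 ≤ B)
    (hF : ∀ t, HasDerivAt F (F' t) t) (h0 : F 0 = 0)
    (hb : ∀ t ∈ Set.Icc 0 δ, |F' t| ≤ B * t ^ n) : ∀ t ∈ Set.Icc 0 δ, |F t| ≤ B * t ^ (n + 1) := by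
  intro t ht
  have := (convex_Icc (0 : ℝ) t).norm_image_sub_le_of_norm_hasDerivWithin_le (f := F) (f' := F')
    (C := B * t ^ n) (fun s _ => (hF s).hasDerivWithinAt)
    (fun s hs => (hb s ⟨hs.1, hs.2.trans ht.2⟩).trans
      (mul_le_mul_of_nonneg_left (pow_le_pow_left₀ hs.1 hs.2 n) hB))
    (Set.left_mem_Icc.mpr ht.1) (Set.right_mem_Icc.mpr ht.1)
  simp only [h0, sub_zero, Real.norm_eq_abs, abs_of_nonneg ht.1] at this
  rw [pow_succ, ← mul_assoc]; exact this

/-- Taylor's formula for the even part in δ, by four integrations starting from the fourth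
derivative; the odd orders cancel. Factorials are given away. -/
theorem second_difference_bound {U U1 U2 U3 U4 : ℝ → ℝ} {x δ B : ℝ} (hδ : 0 ≤ δ)
    (h1 : ∀ t, HasDerivAt U (U1 t) t) (h2 : ∀ t, HasDerivAt U1 (U2 t) t)
    (h3 : ∀ t, HasDerivAt U2 (U3 t) t) (h4 : ∀ t, HasDerivAt U3 (U4 t) t)
    (hB : ∀ t, |t - x| ≤ δ → |U4 t| ≤ B) :
    |U (x + δ) + U (x - δ) - 2 * U x - δ ^ 2 * U2 x| ≤ 2 * B * δ ^ 4 := by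
  have hB0 : 0 ≤ B := (abs_nonneg _).trans (hB x (by simpa using hδ))
  have hp : ∀ {V V' : ℝ → ℝ}, (∀ t, HasDerivAt V (V' t) t) → ∀ t,
      HasDerivAt (fun t => V (x + t)) (V' (x + t)) t := fun hV t => by
    simpa using (hV (x + t)).comp_const_add x t
  have hm : ∀ {V V' : ℝ → ℝ}, (∀ t, HasDerivAt V (V' t) t) → ∀ t,
      HasDerivAt (fun t => V (x - t)) (-V' (x - t)) t := fun hV t => by
    simpa using (hV (x - t)).comp_const_sub x t
  have k3 := abs_le_mul_of_abs_deriv_le (F := fun t => U3 (x + t) - U3 (x - t))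
    (F' := fun t => U4 (x + t) - -U4 (x - t)) (B := 2 * B) (δ := δ) 0 (by positivity)
    (fun t => (hp h4 t).sub (hm h4 t)) (by simp) (fun t ht => by
      have e1 := hB (x + t) (by simpa [abs_of_nonneg ht.1] using ht.2)
      have e2 := hB (x - t) (by
        rw [show x - t - x = -t by ring, abs_neg, abs_of_nonneg ht.1]; exact ht.2)
      rw [sub_neg_eq_add, pow_zero, mul_one]
      exact (abs_add_le _ _).trans (by linarith))
  have k2 := abs_le_mul_of_abs_deriv_le (F := fun t => U2 (x + t) + U2 (x - t) - 2 * U2 x)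
    (F' := fun t => U3 (x + t) + -U3 (x - t)) (B := 2 * B) (δ := δ) 1 (by positivity)
    (fun t => ((hp h3 t).add (hm h3 t)).sub_const _) (by simp; ring)
    (fun t ht => by simpa [sub_eq_add_neg] using k3 t ht)
  have k1 := abs_le_mul_of_abs_deriv_le (F := fun t => U1 (x + t) - U1 (x - t) - t * (2 * U2 x))
    (F' := fun t => U2 (x + t) - -U2 (x - t) - 1 * (2 * U2 x)) (B := 2 * B) (δ := δ) 2
    (by positivity)
    (fun t => ((hp h2 t).sub (hm h2 t)).sub ((hasDerivAt_id t).mul_const _)) (by simp)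
    (fun t ht => by simpa [sub_neg_eq_add] using k2 t ht)
  have k0 := abs_le_mul_of_abs_deriv_le
    (F := fun t => U (x + t) + U (x - t) - t ^ 2 * U2 x - 2 * U x)
    (F' := fun t => U1 (x + t) + -U1 (x - t) - (2 * t) * U2 x) (B := 2 * B) (δ := δ) 3
    (by positivity)
    (fun t => (((hp h1 t).add (hm h1 t)).sub
      (by simpa using (hasDerivAt_pow 2 t).mul_const (U2 x))).sub_const _) (by simp; ring)
    (fun t ht => by
      have := k1 t ht
      rw [show U1 (x + t) + -U1 (x - t) - (2 * t) * U2 x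
        = U1 (x + t) - U1 (x - t) - t * (2 * U2 x) by ring]
      exact this)
  have := k0 δ ⟨hδ, le_rfl⟩
  rw [show U (x + δ) + U (x - δ) - 2 * U x - δ ^ 2 * U2 x
    = U (x + δ) + U (x - δ) - δ ^ 2 * U2 x - 2 * U x by ring]
  exact this

theorem first_difference_bound {U U1 U2 : ℝ → ℝ} {x δ B : ℝ} (hδ : 0 ≤ δ)
    (h1 : ∀ t, HasDerivAt U (U1 t) t) (h2 : ∀ t, HasDerivAt U1 (U2 t) t)
    (hB : ∀ t, |t - x| ≤ δ → |U2 t| ≤ B) :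
    |U (x + δ) - U x - δ * U1 x| ≤ B * δ ^ 2 := by
  have hB0 : 0 ≤ B := (abs_nonneg _).trans (hB x (by simpa using hδ))
  have hp : ∀ {V V' : ℝ → ℝ}, (∀ t, HasDerivAt V (V' t) t) → ∀ t,
      HasDerivAt (fun t => V (x + t)) (V' (x + t)) t := fun hV t => by
    simpa using (hV (x + t)).comp_const_add x t
  have k1 := abs_le_mul_of_abs_deriv_le (F := fun t => U1 (x + t) - U1 x)
    (F' := fun t => U2 (x + t)) (B := B) (δ := δ) 0 hB0
    (fun t => (hp h2 t).sub_const _) (by simp)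
    (fun t ht => by
      rw [pow_zero, mul_one]
      exact hB (x + t) (by simpa [abs_of_nonneg ht.1] using ht.2))
  have k0 := abs_le_mul_of_abs_deriv_le (F := fun t => U (x + t) - t * U1 x - U x)
    (F' := fun t => U1 (x + t) - 1 * U1 x) (B := B) (δ := δ) 1 hB0
    (fun t => ((hp h1 t).sub ((hasDerivAt_id t).mul_const _)).sub_const _) (by simp)
    (fun t ht => by simpa using k1 t ht)
  have := k0 δ ⟨hδ, le_rfl⟩
  rw [show U (x + δ) - U x - δ * U1 x = U (x + δ) - δ * U1 x - U x by ring]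
  exact this

/-- Growth estimate for solutions of the Airy equation. -/
theorem IsAirySolution.energy_le {f f' : ℝ → ℝ} (hf : IsAirySolution f f') {y ξ R : ℝ}
    (hR : ∀ t ∈ Set.uIcc y ξ, |t| ≤ R) :
    f ξ ^ 2 + f' ξ ^ 2 ≤ (f y ^ 2 + f' y ^ 2) * Real.exp ((1 + R) * |ξ - y|) := by
  have hE : ∀ t, HasDerivAt (fun t => f t ^ 2 + f' t ^ 2) (2 * (f t * f' t) * (1 + t)) t := by
    intro t
    refine (((hf.deriv_fst t).pow 2).add ((hf.deriv_snd t).pow 2)).congr_deriv ?_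
    simp; ring
  have hbound : ∀ t, |t| ≤ R → |2 * (f t * f' t) * (1 + t)| ≤ (1 + R) * (f t ^ 2 + f' t ^ 2) := by
    intro t ht
    rw [abs_mul]
    have e1 : |2 * (f t * f' t)| ≤ f t ^ 2 + f' t ^ 2 := by
      rw [abs_le]; constructor <;> nlinarith [sq_nonneg (f t + f' t), sq_nonneg (f t - f' t)]
    have e2 : |1 + t| ≤ 1 + R := (abs_add_le _ _).trans (by simpa using ht)
    rw [mul_comm (1 + R)]
    exact mul_le_mul e1 e2 (abs_nonneg _) (by positivity)
  have hexp : ∀ c t : ℝ, HasDerivAt (fun t => Real.exp (c * t)) (Real.exp (c * t) * c) t := by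
    intro c t
    simpa using ((hasDerivAt_id t).const_mul c).exp
  -- Gronwall in both directions: multiplication by `exp (∓(1 + R) t)` makes the energy monotone.
  rcases le_total y ξ with h | h
  · rw [Set.uIcc_of_le h] at hR
    have hanti : AntitoneOn (fun t => (f t ^ 2 + f' t ^ 2) * Real.exp (-(1 + R) * t))
        (Set.Icc y ξ) := by
      refine antitoneOn_of_deriv_nonpos (convex_Icc _ _)
        (fun t _ => ((hE t).fun_mul (hexp _ t)).continuousAt.continuousWithinAt)
        (fun t _ => ((hE t).fun_mul (hexp _ t)).differentiableAt.differentiableWithinAt) fun t ht => ?_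
      rw [interior_Icc] at ht
      rw [((hE t).fun_mul (hexp (-(1 + R)) t)).deriv]
      have := (abs_le.mp (hbound t (hR t (Set.Ioo_subset_Icc_self ht)))).2
      have hpos := Real.exp_pos (-(1 + R) * t)
      nlinarith
    have := hanti (Set.left_mem_Icc.mpr h) (Set.right_mem_Icc.mpr h) h
    simp only at this
    rw [abs_of_nonneg (sub_nonneg.mpr h)]
    calc f ξ ^ 2 + f' ξ ^ 2
        = (f ξ ^ 2 + f' ξ ^ 2) * Real.exp (-(1 + R) * ξ) * Real.exp ((1 + R) * ξ) := by
          rw [mul_assoc, ← Real.exp_add, show -(1 + R) * ξ + (1 + R) * ξ = 0 by ring,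
            Real.exp_zero, mul_one]
      _ ≤ (f y ^ 2 + f' y ^ 2) * Real.exp (-(1 + R) * y) * Real.exp ((1 + R) * ξ) := by gcongr
      _ = _ := by rw [mul_assoc, ← Real.exp_add]; ring_nf
  · rw [Set.uIcc_of_ge h] at hR
    have hmono : MonotoneOn (fun t => (f t ^ 2 + f' t ^ 2) * Real.exp ((1 + R) * t))
        (Set.Icc ξ y) := by
      refine monotoneOn_of_deriv_nonneg (convex_Icc _ _)
        (fun t _ => ((hE t).fun_mul (hexp _ t)).continuousAt.continuousWithinAt)
        (fun t _ => ((hE t).fun_mul (hexp _ t)).differentiableAt.differentiableWithinAt) fun t ht => ?_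
      rw [interior_Icc] at ht
      rw [((hE t).fun_mul (hexp (1 + R) t)).deriv]
      have := (abs_le.mp (hbound t (hR t (Set.Ioo_subset_Icc_self ht)))).1
      have hpos := Real.exp_pos ((1 + R) * t)
      nlinarith
    have := hmono (Set.left_mem_Icc.mpr h) (Set.right_mem_Icc.mpr h) h
    simp only at this
    rw [abs_of_nonpos (sub_nonpos.mpr h)]
    calc f ξ ^ 2 + f' ξ ^ 2
        = (f ξ ^ 2 + f' ξ ^ 2) * Real.exp ((1 + R) * ξ) * Real.exp (-((1 + R) * ξ)) := by
          rw [mul_assoc, ← Real.exp_add]; simp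
      _ ≤ (f y ^ 2 + f' y ^ 2) * Real.exp ((1 + R) * y) * Real.exp (-((1 + R) * ξ)) := by gcongr
      _ = _ := by rw [mul_assoc, ← Real.exp_add]; ring_nf

theorem IsAirySolution.abs_le {f f' : ℝ → ℝ} (hf : IsAirySolution f f') {y ξ R : ℝ}
    (hR : ∀ t ∈ Set.uIcc y ξ, |t| ≤ R) :
    |f ξ| ≤ (|f y| + |f' y|) * Real.exp ((1 + R) * |ξ - y|) ∧
    |f' ξ| ≤ (|f y| + |f' y|) * Real.exp ((1 + R) * |ξ - y|) := by
  have h := hf.energy_le hR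
  have hR0 : 0 ≤ R := (abs_nonneg _).trans (hR y Set.left_mem_uIcc)
  set e := Real.exp ((1 + R) * |ξ - y|) with he
  have he1 : 1 ≤ e := Real.one_le_exp (by positivity)
  have hS : f y ^ 2 + f' y ^ 2 ≤ (|f y| + |f' y|) ^ 2 := by
    rw [← sq_abs (f y), ← sq_abs (f' y)]
    nlinarith [abs_nonneg (f y), abs_nonneg (f' y)]
  have h2 : f ξ ^ 2 + f' ξ ^ 2 ≤ ((|f y| + |f' y|) * e) ^ 2 := by
    calc _ ≤ (f y ^ 2 + f' y ^ 2) * e := h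
      _ ≤ (|f y| + |f' y|) ^ 2 * e ^ 2 := by gcongr; nlinarith
      _ = _ := by ring
  have h0 : 0 ≤ (|f y| + |f' y|) * e := by positivity
  constructor
  · exact abs_le_of_sq_le_sq (by nlinarith [sq_nonneg (f' ξ)]) h0
  · exact abs_le_of_sq_le_sq (by nlinarith [sq_nonneg (f ξ)]) h0

/-- A phase `φ` with constant second derivative `c` and an amplitude `g` with derivatives
`g1`, ..., `g4`. -/
structure IsPhaseAmplitude (φ φ1 : ℝ → ℝ) (c : ℝ) (g g1 g2 g3 g4 : ℝ → ℝ) : Prop where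
  phase : ∀ x, HasDerivAt φ (φ1 x) x
  phase1 : ∀ x, HasDerivAt φ1 c x
  amp : ∀ x, HasDerivAt g (g1 x) x
  amp1 : ∀ x, HasDerivAt g1 (g2 x) x
  amp2 : ∀ x, HasDerivAt g2 (g3 x) x
  amp3 : ∀ x, HasDerivAt g3 (g4 x) x

section Expansion

variable {f f' φ φ1 g g1 g2 g3 g4 : ℝ → ℝ} {c : ℝ}

/-- The Airy equation eliminates `f''`, so every derivative of `g * f ∘ φ` remains a combination of
`f ∘ φ` and `f' ∘ φ`. The next three lemmas continue this to order four. -/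
theorem IsPhaseAmplitude.hasDerivAt_zero (hf : IsAirySolution f f')
    (H : IsPhaseAmplitude φ φ1 c g g1 g2 g3 g4) (x : ℝ) :
    HasDerivAt (fun x => g x * f (φ x)) (g1 x * f (φ x) + g x * φ1 x * f' (φ x)) x := by
  refine ((H.amp x).fun_mul ((hf.deriv_fst (φ x)).comp x (H.phase x))).congr_deriv ?_
  simp only [Function.comp]
  ring

theorem IsPhaseAmplitude.hasDerivAt_one (hf : IsAirySolution f f')
    (H : IsPhaseAmplitude φ φ1 c g g1 g2 g3 g4) (x : ℝ) :
    HasDerivAt (fun x => g1 x * f (φ x) + g x * φ1 x * f' (φ x))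
      ((g2 x + g x * φ1 x ^ 2 * φ x) * f (φ x) + (2 * g1 x * φ1 x + g x * c) * f' (φ x)) x := by
  have hF := (hf.deriv_fst (φ x)).comp x (H.phase x)
  have hG := (hf.deriv_snd (φ x)).comp x (H.phase x)
  refine (((H.amp1 x).fun_mul hF).fun_add
    (((H.amp x).fun_mul (H.phase1 x)).fun_mul hG)).congr_deriv ?_
  simp only [Function.comp]
  ring

theorem IsPhaseAmplitude.hasDerivAt_two (hf : IsAirySolution f f')
    (H : IsPhaseAmplitude φ φ1 c g g1 g2 g3 g4) (x : ℝ) :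
    HasDerivAt (fun x => (g2 x + g x * φ1 x ^ 2 * φ x) * f (φ x)
        + (2 * g1 x * φ1 x + g x * c) * f' (φ x))
      ((g3 x + 3 * g1 x * φ1 x ^ 2 * φ x + 3 * g x * φ1 x * c * φ x + g x * φ1 x ^ 3) * f (φ x)
        + (3 * g2 x * φ1 x + 3 * g1 x * c + g x * φ1 x ^ 3 * φ x) * f' (φ x)) x := by
  have hF := (hf.deriv_fst (φ x)).comp x (H.phase x)
  have hG := (hf.deriv_snd (φ x)).comp x (H.phase x)
  refine ((((H.amp2 x).fun_add (((H.amp x).fun_mul ((H.phase1 x).fun_pow 2)).fun_mul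
    (H.phase x))).fun_mul hF).fun_add
    (((((H.amp1 x).const_mul 2).fun_mul (H.phase1 x)).fun_add
      ((H.amp x).mul_const c)).fun_mul hG)).congr_deriv ?_
  simp only [Function.comp]
  push_cast
  ring

theorem IsPhaseAmplitude.hasDerivAt_three (hf : IsAirySolution f f')
    (H : IsPhaseAmplitude φ φ1 c g g1 g2 g3 g4) (x : ℝ) :
    HasDerivAt (fun x =>
      (g3 x + 3 * g1 x * φ1 x ^ 2 * φ x + 3 * g x * φ1 x * c * φ x + g x * φ1 x ^ 3) * f (φ x)
        + (3 * g2 x * φ1 x + 3 * g1 x * c + g x * φ1 x ^ 3 * φ x) * f' (φ x))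
      ((g4 x + 6 * g2 x * φ1 x ^ 2 * φ x + 12 * g1 x * φ1 x * c * φ x + 4 * g1 x * φ1 x ^ 3
          + 3 * g x * c ^ 2 * φ x + 6 * g x * φ1 x ^ 2 * c + g x * φ1 x ^ 4 * φ x ^ 2) * f (φ x)
        + (4 * g3 x * φ1 x + 6 * g2 x * c + 4 * g1 x * φ1 x ^ 3 * φ x
          + 6 * g x * φ1 x ^ 2 * c * φ x + 2 * g x * φ1 x ^ 4) * f' (φ x)) x := by
  have hF := (hf.deriv_fst (φ x)).comp x (H.phase x)
  have hG := (hf.deriv_snd (φ x)).comp x (H.phase x)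
  have a1 := ((((H.amp1 x).const_mul 3).fun_mul ((H.phase1 x).fun_pow 2)).fun_mul (H.phase x))
  have a2 := ((((H.amp x).const_mul 3).fun_mul (H.phase1 x)).mul_const c).fun_mul (H.phase x)
  have a3 := (H.amp x).fun_mul ((H.phase1 x).fun_pow 3)
  have b1 := ((H.amp2 x).const_mul 3).fun_mul (H.phase1 x)
  have b2 := ((H.amp1 x).const_mul 3).mul_const c
  have b3 := a3.fun_mul (H.phase x)
  refine (((((H.amp3 x).fun_add a1).fun_add a2).fun_add a3).fun_mul hF |>.fun_add
    (((b1.fun_add b2).fun_add b3).fun_mul hG)).congr_deriv ?_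
  simp only [Function.comp]
  push_cast
  ring

/-- The constants 33 and 22 are the sums of the numerical coefficients. The worst monomial, `a * p1
^ 4 * p ^ 2`, has degree 7 in `A` and 2 in `X`. -/
theorem jet_four_bound {A X p p1 c a a1 a2 a3 a4 : ℝ} (hA : 1 ≤ A) (hX : 1 ≤ X)
    (hp : |p| ≤ A * X) (hp1 : |p1| ≤ A) (hc : |c| ≤ A) (ha : |a| ≤ A) (ha1 : |a1| ≤ A)
    (ha2 : |a2| ≤ A) (ha3 : |a3| ≤ A) (ha4 : |a4| ≤ A) :
    |a4 + 6 * a2 * p1 ^ 2 * p + 12 * a1 * p1 * c * p + 4 * a1 * p1 ^ 3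
          + 3 * a * c ^ 2 * p + 6 * a * p1 ^ 2 * c + a * p1 ^ 4 * p ^ 2| ≤ 33 * A ^ 7 * X ^ 2 ∧
    |4 * a3 * p1 + 6 * a2 * c + 4 * a1 * p1 ^ 3 * p
          + 6 * a * p1 ^ 2 * c * p + 2 * a * p1 ^ 4| ≤ 22 * A ^ 7 * X ^ 2 := by
  have hA0 : 0 ≤ A := by linarith
  have hX0 : 0 ≤ X := by linarith
  have hpow : ∀ m k : ℕ, m ≤ 7 → k ≤ 2 → A ^ m * X ^ k ≤ A ^ 7 * X ^ 2 := fun m k hm hk => by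
    have := pow_le_pow_right₀ hA hm
    have := pow_le_pow_right₀ hX hk
    gcongr
  constructor
  · calc _ ≤ |a4| + |6 * a2 * p1 ^ 2 * p| + |12 * a1 * p1 * c * p| + |4 * a1 * p1 ^ 3|
          + |3 * a * c ^ 2 * p| + |6 * a * p1 ^ 2 * c| + |a * p1 ^ 4 * p ^ 2| := by
          refine (abs_add_le _ _).trans (add_le_add ?_ le_rfl)
          refine (abs_add_le _ _).trans (add_le_add ?_ le_rfl)
          refine (abs_add_le _ _).trans (add_le_add ?_ le_rfl)
          refine (abs_add_le _ _).trans (add_le_add ?_ le_rfl)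
          refine (abs_add_le _ _).trans (add_le_add ?_ le_rfl)
          exact abs_add_le _ _
      _ ≤ A + 6 * A * A ^ 2 * (A * X) + 12 * A * A * A * (A * X) + 4 * A * A ^ 3
          + 3 * A * A ^ 2 * (A * X) + 6 * A * A ^ 2 * A + A * A ^ 4 * (A * X) ^ 2 := by
          simp only [abs_mul, abs_pow, Nat.abs_ofNat]
          gcongr
      _ ≤ _ := by
          linarith [hpow 1 0 (by norm_num) (by norm_num), hpow 4 1 (by norm_num) (by norm_num),
            hpow 4 0 (by norm_num) (by norm_num)]
  · calc _ ≤ |4 * a3 * p1| + |6 * a2 * c| + |4 * a1 * p1 ^ 3 * p|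
          + |6 * a * p1 ^ 2 * c * p| + |2 * a * p1 ^ 4| := by
          refine (abs_add_le _ _).trans (add_le_add ?_ le_rfl)
          refine (abs_add_le _ _).trans (add_le_add ?_ le_rfl)
          refine (abs_add_le _ _).trans (add_le_add ?_ le_rfl)
          exact abs_add_le _ _
      _ ≤ 4 * A * A + 6 * A * A + 4 * A * A ^ 3 * (A * X)
          + 6 * A * A ^ 2 * A * (A * X) + 2 * A * A ^ 4 := by
          simp only [abs_mul, abs_pow, Nat.abs_ofNat]
          gcongr
      _ ≤ _ := by
          linarith [hpow 2 0 (by norm_num) (by norm_num), hpow 5 1 (by norm_num) (by norm_num),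
            hpow 5 0 (by norm_num) (by norm_num)]

theorem jet_two_bound {A X p p1 c a a1 a2 : ℝ} (hA : 1 ≤ A) (hX : 1 ≤ X)
    (hp : |p| ≤ A * X) (hp1 : |p1| ≤ A) (hc : |c| ≤ A) (ha : |a| ≤ A) (ha1 : |a1| ≤ A)
    (ha2 : |a2| ≤ A) :
    |a2 + a * p1 ^ 2 * p| ≤ 2 * A ^ 4 * X ∧ |2 * a1 * p1 + a * c| ≤ 3 * A ^ 4 * X := by
  have hA0 : 0 ≤ A := by linarith
  have hpow : ∀ m k : ℕ, m ≤ 4 → k ≤ 1 → A ^ m * X ^ k ≤ A ^ 4 * X := fun m k hm hk => by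
    have h1 := pow_le_pow_right₀ hA hm
    have h2 := pow_le_pow_right₀ hX hk
    rw [pow_one] at h2
    have : 0 ≤ X := by linarith
    gcongr
  constructor
  · calc _ ≤ |a2| + |a * p1 ^ 2 * p| := abs_add_le _ _
      _ ≤ A + A * A ^ 2 * (A * X) := by
          simp only [abs_mul, abs_pow]
          gcongr
      _ ≤ _ := by linarith [hpow 1 0 (by norm_num) (by norm_num)]
  · calc _ ≤ |2 * a1 * p1| + |a * c| := abs_add_le _ _
      _ ≤ 2 * A * A + A * A := by
          simp only [abs_mul, Nat.abs_ofNat]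
          gcongr
      _ ≤ _ := by linarith [hpow 2 0 (by norm_num) (by norm_num)]

/-- Local bounds on the phase and the amplitude near `x`. -/
structure PhaseAmplitudeBound (φ φ1 : ℝ → ℝ) (c : ℝ) (g g1 g2 g3 g4 : ℝ → ℝ) (A X x δ : ℝ) :
    Prop where
  phase : ∀ t, |t - x| ≤ δ → |φ t| ≤ A * X
  phase1 : ∀ t, |t - x| ≤ δ → |φ1 t| ≤ A
  phase2 : |c| ≤ A
  amp : ∀ t, |t - x| ≤ δ → |g t| ≤ A
  amp1 : ∀ t, |t - x| ≤ δ → |g1 t| ≤ A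
  amp2 : ∀ t, |t - x| ≤ δ → |g2 t| ≤ A
  amp3 : ∀ t, |t - x| ≤ δ → |g3 t| ≤ A
  amp4 : ∀ t, |t - x| ≤ δ → |g4 t| ≤ A

/-- Over one step the phase moves by at most `A * δ` in a region where it is at most `A * X`. As `X
* δ ≤ 4`, `f` and `f'` change by a bounded factor only. The errors are therefore relative to `|f| +
|f'|` at `x` itself, even where the solution is exponentially small. -/
theorem langer_expansion (hf : IsAirySolution f f') (H : IsPhaseAmplitude φ φ1 c g g1 g2 g3 g4)
    {A X x δ : ℝ} (hA : 1 ≤ A) (hX : 1 ≤ X) (hδ : 0 ≤ δ) (hXδ : X * δ ≤ 4)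
    (hb : PhaseAmplitudeBound φ φ1 c g g1 g2 g3 g4 A X x δ) :
    |g (x + δ) * f (φ (x + δ)) + g (x - δ) * f (φ (x - δ)) - 2 * (g x * f (φ x))
      - δ ^ 2 * ((g2 x + g x * φ1 x ^ 2 * φ x) * f (φ x)
        + (2 * g1 x * φ1 x + g x * c) * f' (φ x))|
      ≤ 110 * A ^ 7 * Real.exp (4 * (A * (1 + A))) * X ^ 2 * δ ^ 4 * (|f (φ x)| + |f' (φ x)|) ∧
    |g (x + δ) * f (φ (x + δ)) - g x * f (φ x)
      - δ * (g1 x * f (φ x) + g x * φ1 x * f' (φ x))|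
      ≤ 5 * A ^ 4 * Real.exp (4 * (A * (1 + A))) * X * δ ^ 2 * (|f (φ x)| + |f' (φ x)|) := by
  have hA0 : 0 ≤ A := by linarith
  set e := Real.exp (4 * (A * (1 + A))) with he
  set s := |f (φ x)| + |f' (φ x)| with hs
  have hs0 : 0 ≤ s := by positivity
  have he0 : 0 < e := Real.exp_pos _
  have hff : ∀ t, |t - x| ≤ δ → |f (φ t)| ≤ s * e ∧ |f' (φ t)| ≤ s * e := by
    intro t ht
    have hR : ∀ u ∈ Set.uIcc (φ x) (φ t), |u| ≤ A * X := by
      intro u hu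
      have h1 := abs_le.mp (hb.phase t ht)
      have h2 := abs_le.mp (hb.phase x (by simpa using hδ))
      rw [Set.mem_uIcc] at hu
      rw [abs_le]
      rcases hu with hu | hu <;> constructor <;> linarith [hu.1, hu.2]
    have hlip : |φ t - φ x| ≤ A * δ := by
      have := (convex_Icc (x - δ) (x + δ)).norm_image_sub_le_of_norm_hasDerivWithin_le (f := φ)
        (f' := φ1) (C := A) (x := x) (y := t) (fun u _ => (H.phase u).hasDerivWithinAt)
        (fun u hu => hb.phase1 u (by rw [abs_le]; constructor <;> linarith [hu.1, hu.2]))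
        ⟨by linarith, by linarith⟩ (by
          have := abs_le.mp ht
          constructor <;> linarith)
      exact this.trans (mul_le_mul_of_nonneg_left ht hA0)
    have hexp : Real.exp ((1 + A * X) * |φ t - φ x|) ≤ e := by
      refine Real.exp_le_exp.mpr ?_
      calc (1 + A * X) * |φ t - φ x| ≤ ((1 + A) * X) * (A * δ) := by
            gcongr; nlinarith
        _ = A * (1 + A) * (X * δ) := by ring
        _ ≤ A * (1 + A) * 4 := by gcongr
        _ = _ := by ring
    have := hf.abs_le hR
    exact ⟨this.1.trans (by gcongr), this.2.trans (by gcongr)⟩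
  constructor
  · refine (second_difference_bound (U := fun x => g x * f (φ x))
      (B := 55 * A ^ 7 * X ^ 2 * (s * e)) hδ (H.hasDerivAt_zero hf)
      (H.hasDerivAt_one hf) (H.hasDerivAt_two hf) (H.hasDerivAt_three hf) fun t ht => ?_).trans ?_
    · have hj := jet_four_bound hA hX (hb.phase t ht) (hb.phase1 t ht) hb.phase2 (hb.amp t ht)
        (hb.amp1 t ht) (hb.amp2 t ht) (hb.amp3 t ht) (hb.amp4 t ht)
      refine (abs_add_le _ _).trans ?_
      rw [abs_mul, abs_mul]
      have h1 := mul_le_mul hj.1 (hff t ht).1 (abs_nonneg _) (by positivity)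
      have h2 := mul_le_mul hj.2 (hff t ht).2 (abs_nonneg _) (by positivity)
      linarith
    · exact le_of_eq (by ring)
  · refine (first_difference_bound (U := fun x => g x * f (φ x))
      (B := 5 * A ^ 4 * X * (s * e)) hδ (H.hasDerivAt_zero hf)
      (H.hasDerivAt_one hf) fun t ht => ?_).trans ?_
    · have hj := jet_two_bound hA hX (hb.phase t ht) (hb.phase1 t ht) hb.phase2 (hb.amp t ht)
        (hb.amp1 t ht) (hb.amp2 t ht)
      refine (abs_add_le _ _).trans ?_
      rw [abs_mul, abs_mul]
      have h1 := mul_le_mul hj.1 (hff t ht).1 (abs_nonneg _) (by positivity)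
      have h2 := mul_le_mul hj.2 (hff t ht).2 (abs_nonneg _) (by positivity)
      linarith
    · exact le_of_eq (by ring)

end Expansion

/-! ### The Langer ansatz and its consistency with the recursion. -/

/-- Langer phase. -/
noncomputable def langerPhase (h r b k x : ℝ) : ℝ :=
  x + r + k * h ^ 2 + h * (x ^ 2 / 5 - 4 * r * x / 15 + b)

/-- Derivative of the Langer phase. -/
noncomputable def langerPhase1 (h r x : ℝ) : ℝ := 1 + h * (2 * x / 5 - 4 * r / 15)

/-- Amplitude that multiplies the Airy function. -/
def langerAmp (h a N x : ℝ) : ℝ := 1 + h * a * x - N * h ^ 2 * x ^ 4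

/-- Derivative of the amplitude. -/
def langerAmp1 (h a N x : ℝ) : ℝ := h * a - 4 * (N * h ^ 2 * x ^ 3)

/-- Second derivative of the amplitude. -/
def langerAmp2 (h N x : ℝ) : ℝ := -12 * (N * h ^ 2 * x ^ 2)

/-- The approximate eigenvector in the scaled variable. -/
noncomputable def langerU (f : ℝ → ℝ) (h r b k a N x : ℝ) : ℝ :=
  langerAmp h a N x * f (langerPhase h r b k x)

theorem langer_isPhaseAmplitude (h r b k a N : ℝ) :
    IsPhaseAmplitude (langerPhase h r b k) (langerPhase1 h r) (2 * h / 5) (langerAmp h a N)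
      (langerAmp1 h a N) (langerAmp2 h N) (fun x => -24 * (N * h ^ 2 * x))
      (fun _ => -24 * (N * h ^ 2)) where
  phase x := by
    have := ((((hasDerivAt_id x).add_const r).add_const (k * h ^ 2)).fun_add
      ((((hasDerivAt_pow 2 x).div_const 5).fun_sub
        (((hasDerivAt_id x).const_mul (4 * r)).div_const 15) |>.add_const b).const_mul h))
    refine this.congr_deriv ?_
    simp [langerPhase1]
  phase1 x := by
    have := (((((hasDerivAt_id x).const_mul 2).div_const 5).sub_const (4 * r / 15)).const_mul
      h).const_add 1
    refine this.congr_deriv ?_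
    simp; ring
  amp x := by
    have := (((hasDerivAt_id x).const_mul (h * a)).const_add 1).fun_sub
      ((hasDerivAt_pow 4 x).const_mul (N * h ^ 2))
    refine this.congr_deriv ?_
    simp [langerAmp1]; ring
  amp1 x := by
    have := (((hasDerivAt_pow 3 x).const_mul (N * h ^ 2)).const_mul 4).const_sub (h * a)
    refine this.congr_deriv ?_
    simp [langerAmp2]; ring
  amp2 x := by
    have := ((hasDerivAt_pow 2 x).const_mul (N * h ^ 2)).const_mul (-12)
    refine this.congr_deriv ?_
    simp; ring
  amp3 x := by
    have := ((hasDerivAt_id x).const_mul (N * h ^ 2)).const_mul (-24)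
    refine this.congr_deriv ?_
    simp

/-- The condition `h * x ≤ 1` covers the whole queue, since `h * (j * h ^ 2) = j / K`. The last
hypothesis is empty for `N = 0`; for `N = 10` it restricts `x` to the order `h ^ (-1/2)`. -/
theorem langer_bound {R h r b k a N x : ℝ} (hh : 0 < h) (hh1 : h ≤ 1) (hr : |r| ≤ R)
    (hb : |b| ≤ R) (hk : |k| ≤ R) (ha : |a| ≤ 1) (hN : 0 ≤ N) (hx : 0 ≤ x) (hhx : h * x ≤ 1)
    (hNx : N * h ^ 2 * (1 + x) ^ 4 ≤ 200) :
    PhaseAmplitudeBound (langerPhase h r b k) (langerPhase1 h r) (2 * h / 5) (langerAmp h a N)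
      (langerAmp1 h a N) (langerAmp2 h N) (fun x => -24 * (N * h ^ 2 * x))
      (fun _ => -24 * (N * h ^ 2)) (5000 * (1 + R)) (1 + x) x (h ^ 2) := by
  have hR0 : 0 ≤ R := (abs_nonneg _).trans hr
  have hX1 : 1 ≤ 1 + x := by linarith
  have hh2 : h ^ 2 ≤ 1 := pow_le_one₀ hh.le hh1
  have hhX : h * (1 + x) ≤ 2 := by linarith
  have ht0 : ∀ t, |t - x| ≤ h ^ 2 → |t| ≤ 1 + x := by
    intro t ht
    have := abs_le.mp ht
    rw [abs_le]; constructor <;> linarith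
  have hNk : ∀ m : ℕ, m ≤ 4 → ∀ t, |t - x| ≤ h ^ 2 → |N * h ^ 2 * t ^ m| ≤ 200 := by
    intro m hm t ht
    rw [abs_mul, abs_mul, abs_of_nonneg hN, abs_of_nonneg (sq_nonneg h), abs_pow]
    calc N * h ^ 2 * |t| ^ m ≤ N * h ^ 2 * (1 + x) ^ m := by
          gcongr; exact ht0 t ht
      _ ≤ N * h ^ 2 * (1 + x) ^ 4 := by gcongr
      _ ≤ 200 := hNx
  refine ⟨fun t ht => ?_, fun t ht => ?_, ?_, fun t ht => ?_, fun t ht => ?_, fun t ht => ?_,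
    fun t ht => ?_, fun t ht => ?_⟩
  · have h1 := ht0 t ht
    have e : |h * (t ^ 2 / 5 - 4 * r * t / 15 + b)| ≤ 2 * (1 + x) + 4 * R + R := by
      have : |h * (t ^ 2 / 5 - 4 * r * t / 15 + b)|
          ≤ h * ((1 + x) ^ 2 / 5 + 4 * R * (1 + x) / 15 + R) := by
        rw [abs_mul, abs_of_pos hh]
        gcongr
        refine (abs_add_le _ _).trans (add_le_add ((abs_sub _ _).trans ?_) hb)
        rw [abs_div, abs_div, abs_mul, abs_mul, abs_pow]
        simp only [Nat.abs_ofNat]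
        gcongr
      refine this.trans ?_
      have e1 : h * (1 + x) ^ 2 ≤ 2 * (1 + x) := by nlinarith
      have e2 : h * (R * (1 + x)) ≤ 2 * R := by nlinarith
      have e3 : h * R ≤ R := by nlinarith
      nlinarith
    have e2 : |k * h ^ 2| ≤ R := by
      rw [abs_mul, abs_of_nonneg (sq_nonneg h)]
      calc |k| * h ^ 2 ≤ R * 1 := by gcongr
        _ = R := mul_one R
    calc |langerPhase h r b k t| ≤ |t| + |r| + |k * h ^ 2|
          + |h * (t ^ 2 / 5 - 4 * r * t / 15 + b)| := by
          refine (abs_add_le _ _).trans (add_le_add ?_ le_rfl)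
          refine (abs_add_le _ _).trans (add_le_add ?_ le_rfl)
          exact abs_add_le _ _
      _ ≤ (1 + x) + R + R + (2 * (1 + x) + 4 * R + R) := by gcongr
      _ ≤ _ := by nlinarith
  · have h1 := ht0 t ht
    calc |langerPhase1 h r t| ≤ 1 + h * (2 * (1 + x) / 5 + 4 * R / 15) := by
          refine (abs_add_le _ _).trans ?_
          rw [abs_one, abs_mul, abs_of_pos hh]
          gcongr
          refine (abs_sub _ _).trans ?_
          rw [abs_div, abs_div, abs_mul, abs_mul]
          simp only [Nat.abs_ofNat]
          gcongr
      _ ≤ _ := by nlinarith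
  · rw [abs_div, abs_mul, abs_of_pos hh]
    simp only [Nat.abs_ofNat]
    linarith
  · have h1 := ht0 t ht
    have h2 := hNk 4 le_rfl t ht
    have h3 : |h * a * t| ≤ 2 := by
      rw [abs_mul, abs_mul, abs_of_pos hh]
      calc h * |a| * |t| ≤ h * 1 * (1 + x) := by gcongr
        _ ≤ 2 := by linarith
    calc |langerAmp h a N t| ≤ 1 + |h * a * t| + |N * h ^ 2 * t ^ 4| := by
          refine (abs_sub _ _).trans (add_le_add ((abs_add_le _ _).trans ?_) le_rfl)
          rw [abs_one]
      _ ≤ _ := by linarith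
  · have h2 := hNk 3 (by norm_num) t ht
    have h3 : |h * a| ≤ 1 := by
      rw [abs_mul, abs_of_pos hh]
      nlinarith [abs_nonneg a]
    calc |langerAmp1 h a N t| ≤ |h * a| + |4 * (N * h ^ 2 * t ^ 3)| := abs_sub _ _
      _ ≤ _ := by
        rw [abs_mul 4]
        simp only [Nat.abs_ofNat]
        linarith
  · have h2 := hNk 2 (by norm_num) t ht
    rw [langerAmp2, abs_mul, abs_neg]
    simp only [Nat.abs_ofNat]
    linarith
  · have h2 := hNk 1 (by norm_num) t ht
    rw [pow_one] at h2
    rw [abs_mul, abs_neg]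
    simp only [Nat.abs_ofNat]
    linarith
  · have h2 := hNk 0 (by norm_num) t ht
    rw [pow_zero, mul_one] at h2
    rw [abs_mul, abs_neg]
    simp only [Nat.abs_ofNat]
    linarith

/-- Consistency of the Langer ansatz with the recursion, up to an explicit error. -/
theorem langer_consistency (R : ℝ) (hR : 0 ≤ R) : ∃ C : ℝ, 0 ≤ C ∧
    ∀ f f' : ℝ → ℝ, IsAirySolution f f' → ∀ h r b k a N x : ℝ, 0 < h → h ≤ 1 → |r| ≤ R →
    |b| ≤ R → |k| ≤ R → |a| ≤ 1 → 0 ≤ N → 0 ≤ x → h * x ≤ 1 → N * h ^ 2 * (1 + x) ^ 4 ≤ 200 →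
    ∃ err : ℝ,
      |err| ≤ h ^ 6 * (C * h * (1 + x)
          * (|f (langerPhase h r b k x)| + |f' (langerPhase h r b k x)|)
        + 2 * x * (|langerAmp1 h a N x| * |f (langerPhase h r b k x)|
          + |langerAmp h a N x * langerPhase1 h r x| * |f' (langerPhase h r b k x)|)) ∧
      |langerU f h r b k a N (x + h ^ 2) - langerU f h r b k a N x
        - h ^ 2 * (langerAmp1 h a N x * f (langerPhase h r b k x)
          + langerAmp h a N x * langerPhase1 h r x * f' (langerPhase h r b k x))|
        ≤ C * h ^ 4 * (1 + x) * (|f (langerPhase h r b k x)| + |f' (langerPhase h r b k x)|) ∧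
      ∀ q : ℝ, langerU f h r b k a N (x - h ^ 2) - 2 * langerU f h r b k a N x
          + (1 - q) * langerU f h r b k a N (x + h ^ 2)
          - (-h ^ 3 + r * h ^ 4 + (b - 8 * r ^ 2 / 15) * h ^ 5) * langerU f h r b k a N x
        = h ^ 4 * ((langerAmp2 h N x + langerAmp h a N x * (langerPhase1 h r x ^ 2
              * langerPhase h r b k x - x - h * x ^ 2 - r - (b - 8 * r ^ 2 / 15) * h)
              - h * langerAmp1 h a N x) * f (langerPhase h r b k x)
            + (2 * langerAmp1 h a N x * langerPhase1 h r x + langerAmp h a N x * (2 * h / 5)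
              - h * langerAmp h a N x * langerPhase1 h r x) * f' (langerPhase h r b k x))
          - (q - h ^ 3 * (1 + h * x + h ^ 2 * x ^ 2)) * langerU f h r b k a N (x + h ^ 2)
          + err := by
  set A := 5000 * (1 + R) with hA
  set e := Real.exp (4 * (A * (1 + A))) with he
  have hA1 : 1 ≤ A := by rw [hA]; linarith
  have hA0 : 0 ≤ A := by linarith
  have he0 : 0 < e := Real.exp_pos _
  refine ⟨220 * A ^ 7 * e + 15 * A ^ 4 * e, by positivity, ?_⟩
  intro f f' hf h r b k a N x hh hh1 hr hb hk ha hN hx hhx hNx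
  have hexp := langer_expansion hf (langer_isPhaseAmplitude h r b k a N) hA1
    (X := 1 + x) (x := x) (δ := h ^ 2) (by linarith) (sq_nonneg h) (by nlinarith)
    (langer_bound hh hh1 hr hb hk ha hN hx hhx hNx)
  set F := f (langerPhase h r b k x) with hF
  set F' := f' (langerPhase h r b k x) with hF'
  set p := langerPhase h r b k x
  set p1 := langerPhase1 h r x
  set g := langerAmp h a N x with hg
  set g1 := langerAmp1 h a N x
  set g2 := langerAmp2 h N x
  set S := |F| + |F'| with hS
  have hS0 : 0 ≤ S := by positivity
  have hUx : langerU f h r b k a N x = g * F := rfl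
  set Up := langerU f h r b k a N (x + h ^ 2) with hUp
  set Um := langerU f h r b k a N (x - h ^ 2) with hUm
  obtain ⟨hR4, hR2⟩ := hexp
  change |Up + Um - 2 * (g * F) - (h ^ 2) ^ 2 * ((g2 + g * p1 ^ 2 * p) * F
    + (2 * g1 * p1 + g * (2 * h / 5)) * F')| ≤ _ at hR4
  change |Up - g * F - h ^ 2 * (g1 * F + g * p1 * F')| ≤ _ at hR2
  set R4 := Up + Um - 2 * (g * F) - (h ^ 2) ^ 2 * ((g2 + g * p1 ^ 2 * p) * F
    + (2 * g1 * p1 + g * (2 * h / 5)) * F') with hR4d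
  set R2 := Up - g * F - h ^ 2 * (g1 * F + g * p1 * F') with hR2d
  have hhX : h * (1 + x) ≤ 2 := by linarith
  have hx1 : 0 ≤ h * x := by positivity
  rw [hUx]
  rw [← he] at hR4 hR2
  clear_value R4 R2 Up Um S F F' p p1 g g1 g2 e A
  -- The potential `h ^ 3 * (1 + h * x + h ^ 2 * x ^ 2)` acts on the shifted value `Up`. Only its
  -- leading product with the first derivative stays in the main term; the rest joins the two
  -- difference remainders.
  refine ⟨R4 - h ^ 5 * (h * x + h ^ 2 * x ^ 2) * (g1 * F + g * p1 * F')
    - h ^ 3 * (1 + h * x + h ^ 2 * x ^ 2) * R2, ?_, ?_, ?_⟩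
  · have hw : h * x + h ^ 2 * x ^ 2 ≤ 2 * (h * x) := by nlinarith
    have hU1 : |g1 * F + g * p1 * F'| ≤ |g1| * |F| + |g * p1| * |F'| := by
      refine (abs_add_le _ _).trans ?_
      rw [abs_mul, abs_mul (g * p1)]
    have hw0 : 0 ≤ h * x + h ^ 2 * x ^ 2 := by positivity
    calc |R4 - h ^ 5 * (h * x + h ^ 2 * x ^ 2) * (g1 * F + g * p1 * F')
          - h ^ 3 * (1 + h * x + h ^ 2 * x ^ 2) * R2|
        ≤ |R4| + h ^ 5 * (h * x + h ^ 2 * x ^ 2) * |g1 * F + g * p1 * F'|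
          + h ^ 3 * (1 + h * x + h ^ 2 * x ^ 2) * |R2| := by
          refine (abs_sub _ _).trans (add_le_add ((abs_sub _ _).trans ?_) ?_)
          · rw [abs_mul (h ^ 5 * _), abs_of_nonneg (show 0 ≤ h ^ 5 * (h * x + h ^ 2 * x ^ 2)
              by positivity)]
          · rw [abs_mul, abs_of_nonneg (show 0 ≤ h ^ 3 * (1 + h * x + h ^ 2 * x ^ 2)
              by positivity)]
      _ ≤ 110 * A ^ 7 * e * (1 + x) ^ 2 * (h ^ 2) ^ 4 * S
          + h ^ 5 * (2 * (h * x)) * (|g1| * |F| + |g * p1| * |F'|)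
          + h ^ 3 * 3 * (5 * A ^ 4 * e * (1 + x) * (h ^ 2) ^ 2 * S) := by
          gcongr
          nlinarith
      _ = 110 * A ^ 7 * e * (h * (1 + x)) * (h ^ 7 * (1 + x) * S)
          + h ^ 6 * (2 * x * (|g1| * |F| + |g * p1| * |F'|))
          + 15 * A ^ 4 * e * (h ^ 7 * (1 + x) * S) := by ring
      _ ≤ 110 * A ^ 7 * e * 2 * (h ^ 7 * (1 + x) * S)
          + h ^ 6 * (2 * x * (|g1| * |F| + |g * p1| * |F'|))
          + 15 * A ^ 4 * e * (h ^ 7 * (1 + x) * S) := by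
          gcongr
      _ = _ := by ring
  · refine hR2d ▸ hR2.trans ?_
    have : 5 * A ^ 4 * e ≤ 220 * A ^ 7 * e + 15 * A ^ 4 * e := by
      have : 0 ≤ 220 * A ^ 7 * e := by positivity
      have : 0 ≤ 10 * A ^ 4 * e := by positivity
      linarith
    calc _ = (5 * A ^ 4 * e) * (h ^ 4 * (1 + x) * S) := by ring
      _ ≤ (220 * A ^ 7 * e + 15 * A ^ 4 * e) * (h ^ 4 * (1 + x) * S) := by gcongr
      _ = _ := by ring
  · intro q
    rw [hR4d, hR2d]
    ring

/-- The second order coefficient of the Langer ansatz. -/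
theorem langer_phase_identity (h r b k x : ℝ) :
    langerPhase1 h r x ^ 2 * langerPhase h r b k x - x - h * x ^ 2 - r - (b - 8 * r ^ 2 / 15) * h
    = h ^ 2 * (k + 2 * (x ^ 2 / 5 - 4 * r * x / 15 + b) * (2 * x / 5 - 4 * r / 15)
      + (2 * x / 5 - 4 * r / 15) ^ 2 * (x + r)
      + h * (x ^ 2 / 5 - 4 * r * x / 15 + b) * (2 * x / 5 - 4 * r / 15) ^ 2
      + 2 * h * k * (2 * x / 5 - 4 * r / 15) + h ^ 2 * k * (2 * x / 5 - 4 * r / 15) ^ 2) := by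
  -- The coefficients `1 / 5` and `-4 * r / 15` of the phase and the shift `8 * r ^ 2 / 15` of the
  -- eigenvalue are those that cancel all terms of orders 1 and `h`.
  unfold langerPhase langerPhase1
  ring

/-- What matters is the cubic growth: for `h * x ≤ 1` its total coefficient is below `1 / 2`, less
than the full `x ^ 3` that the potential provides. -/
theorem langer_phase_bound {R h r b k x : ℝ} (hR : 1 ≤ R) (hh : 0 < h) (hh1 : h ≤ 1)
    (hr : |r| ≤ R) (hb : |b| ≤ R) (hk : |k| ≤ R) (hx : 0 ≤ x) (hhx : h * x ≤ 1) :
    |(k + 2 * (x ^ 2 / 5 - 4 * r * x / 15 + b) * (2 * x / 5 - 4 * r / 15)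
      + (2 * x / 5 - 4 * r / 15) ^ 2 * (x + r)
      + h * (x ^ 2 / 5 - 4 * r * x / 15 + b) * (2 * x / 5 - 4 * r / 15) ^ 2
      + 2 * h * k * (2 * x / 5 - 4 * r / 15) + h ^ 2 * k * (2 * x / 5 - 4 * r / 15) ^ 2)
      - (8 / 25 * x ^ 3 + 4 / 125 * (h * x) * x ^ 3)| ≤ 100 * R ^ 3 * (1 + x) ^ 2 := by
  set X := 1 + x with hX
  have hX1 : 1 ≤ X := by linarith
  have hX0 : 0 ≤ X := by linarith
  have hR0 : 0 ≤ R := by linarith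
  have hxX : |x| ≤ X := by rw [abs_of_nonneg hx]; linarith
  have hhX : h * X ≤ 2 := by linarith
  set u := -4 * r * x / 15 + b with hu
  set v := -4 * r / 15 with hv
  have hvb : |v| ≤ R := by
    rw [hv, abs_div, abs_mul, abs_neg]
    simp only [Nat.abs_ofNat]
    linarith
  have hub : |u| ≤ 2 * R * X := by
    refine (abs_add_le _ _).trans ?_
    rw [abs_div, abs_mul, abs_mul, abs_neg]
    simp only [Nat.abs_ofNat]
    have : |r| * |x| ≤ R * X := by gcongr
    nlinarith
  have hhb : |h| ≤ h := by rw [abs_of_pos hh]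
  have e : (k + 2 * (x ^ 2 / 5 - 4 * r * x / 15 + b) * (2 * x / 5 - 4 * r / 15)
      + (2 * x / 5 - 4 * r / 15) ^ 2 * (x + r)
      + h * (x ^ 2 / 5 - 4 * r * x / 15 + b) * (2 * x / 5 - 4 * r / 15) ^ 2
      + 2 * h * k * (2 * x / 5 - 4 * r / 15) + h ^ 2 * k * (2 * x / 5 - 4 * r / 15) ^ 2)
      - (8 / 25 * x ^ 3 + 4 / 125 * (h * x) * x ^ 3)
      = k + 2 / 5 * x ^ 2 * v + 4 / 5 * x * u + 2 * u * v + 4 / 25 * x ^ 2 * r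
        + (4 / 5 * x * v + v ^ 2) * (x + r) + h * (1 / 5 * x ^ 2 * (4 / 5 * x * v + v ^ 2))
        + h * (u * (2 / 5 * x + v) ^ 2) + 2 * h * k * (2 / 5 * x + v)
        + h ^ 2 * k * (2 / 5 * x + v) ^ 2 := by
    rw [hu, hv]; ring
  rw [e]
  have hw : |2 / 5 * x + v| ≤ X + R := by
    refine (abs_add_le _ _).trans ?_
    rw [abs_mul, abs_of_nonneg (show (0 : ℝ) ≤ 2 / 5 by norm_num)]
    linarith
  have hw2 : |4 / 5 * x * v + v ^ 2| ≤ X * R + R ^ 2 := by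
    refine (abs_add_le _ _).trans ?_
    rw [abs_mul, abs_mul, abs_of_nonneg (show (0 : ℝ) ≤ 4 / 5 by norm_num), abs_pow]
    have : 4 / 5 * |x| ≤ X := by linarith
    gcongr
  have hxr : |x + r| ≤ X + R := (abs_add_le _ _).trans (by linarith)
  calc _ ≤ |k| + |2 / 5 * x ^ 2 * v| + |4 / 5 * x * u| + |2 * u * v| + |4 / 25 * x ^ 2 * r|
        + |(4 / 5 * x * v + v ^ 2) * (x + r)| + |h * (1 / 5 * x ^ 2 * (4 / 5 * x * v + v ^ 2))|
        + |h * (u * (2 / 5 * x + v) ^ 2)| + |2 * h * k * (2 / 5 * x + v)|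
        + |h ^ 2 * k * (2 / 5 * x + v) ^ 2| := by
        refine (abs_add_le _ _).trans (add_le_add ?_ le_rfl)
        refine (abs_add_le _ _).trans (add_le_add ?_ le_rfl)
        refine (abs_add_le _ _).trans (add_le_add ?_ le_rfl)
        refine (abs_add_le _ _).trans (add_le_add ?_ le_rfl)
        refine (abs_add_le _ _).trans (add_le_add ?_ le_rfl)
        refine (abs_add_le _ _).trans (add_le_add ?_ le_rfl)
        refine (abs_add_le _ _).trans (add_le_add ?_ le_rfl)
        refine (abs_add_le _ _).trans (add_le_add ?_ le_rfl)
        exact abs_add_le _ _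
    _ ≤ R + 2 / 5 * X ^ 2 * R + 4 / 5 * X * (2 * R * X) + 2 * (2 * R * X) * R
        + 4 / 25 * X ^ 2 * R + (X * R + R ^ 2) * (X + R)
        + h * (1 / 5 * X ^ 2 * (X * R + R ^ 2)) + h * ((2 * R * X) * (X + R) ^ 2)
        + 2 * h * R * (X + R) + h ^ 2 * R * (X + R) ^ 2 := by
        simp only [abs_mul, abs_pow, Nat.abs_ofNat, abs_of_nonneg (show (0 : ℝ) ≤ 2 / 5 by norm_num),
          abs_of_nonneg (show (0 : ℝ) ≤ 4 / 5 by norm_num),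
          abs_of_nonneg (show (0 : ℝ) ≤ 4 / 25 by norm_num),
          abs_of_nonneg (show (0 : ℝ) ≤ 1 / 5 by norm_num)] at hw2 hw hxr ⊢
        gcongr
    _ ≤ R + 2 / 5 * X ^ 2 * R + 4 / 5 * X * (2 * R * X) + 2 * (2 * R * X) * R
        + 4 / 25 * X ^ 2 * R + (X * R + R * R) * (X + R)
        + 2 * (1 / 5 * X * (X * R + R * R)) + 2 * ((2 * R) * (X + R) ^ 2)
        + 2 * 1 * R * (X + R) + 1 * R * (X + R) ^ 2 := by
        have e1 : h * (1 / 5 * X ^ 2 * (X * R + R ^ 2))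
            = (h * X) * (1 / 5 * X * (X * R + R * R)) := by ring
        have e2 : h * ((2 * R * X) * (X + R) ^ 2) = (h * X) * ((2 * R) * (X + R) ^ 2) := by ring
        have hh2 : h ^ 2 ≤ 1 := pow_le_one₀ hh.le hh1
        rw [e1, e2, show R ^ 2 = R * R by ring]
        gcongr
    _ ≤ _ := by
        have p1 : R ≤ R ^ 3 * X ^ 2 := by
          have h1 : (1 : ℝ) ≤ R ^ 2 := one_le_pow₀ hR
          have h2 : (1 : ℝ) ≤ X ^ 2 := one_le_pow₀ hX1
          calc R = R * 1 * 1 := by ring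
            _ ≤ R * R ^ 2 * X ^ 2 := by gcongr
            _ = _ := by ring
        have hm : ∀ i j : ℕ, i ≤ 3 → j ≤ 2 → R ^ i * X ^ j ≤ R ^ 3 * X ^ 2 := fun i j hi hj => by
          have := pow_le_pow_right₀ hR hi
          have := pow_le_pow_right₀ hX1 hj
          gcongr
        have m1 := hm 1 2 (by norm_num) (by norm_num)
        have m2 := hm 2 1 (by norm_num) (by norm_num)
        have m3 := hm 3 0 (by norm_num) (by norm_num)
        have m4 := hm 1 1 (by norm_num) (by norm_num)
        have m5 := hm 2 0 (by norm_num) (by norm_num)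
        ring_nf at m1 m2 m3 m4 m5 p1 ⊢
        linarith

/-! ### The supersolution. -/

/-- The geometric series beyond second order leaves at least the cubic term. The `-7` pays for the
`h ^ 3` in the denominator, uniformly up to `h * x = 1`, where the series itself diverges. -/
theorem potential_lower_bound {h x : ℝ} (hh : 0 < h) (hh1 : h ≤ 1) (hx : 0 ≤ x)
    (hhx : h * x ≤ 1) :
    h ^ 6 * (x ^ 3 - 7) ≤ h ^ 3 / (1 - h * x + h ^ 3) - h ^ 3 * (1 + h * x + h ^ 2 * x ^ 2) := by
  have hd : 0 < 1 - h * x + h ^ 3 := by have := pow_pos hh 3; linarith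
  set t := h * x with ht
  have ht0 : 0 ≤ t := by positivity
  set w := h ^ 3 with hw
  have hw0 : 0 < w := pow_pos hh 3
  have hw1 : w ≤ 1 := pow_le_one₀ hh.le hh1
  have e1 : h ^ 6 * (x ^ 3 - 7) = w * (t ^ 3 - 7 * w) := by rw [hw, ht]; ring
  have e2 : h ^ 2 * x ^ 2 = t ^ 2 := by rw [ht]; ring
  rw [e1, e2, le_sub_iff_add_le, ← mul_add, div_eq_mul_inv]
  refine mul_le_mul_of_nonneg_left ?_ hw0.le
  rw [← one_div, le_div_iff₀ hd]
  have k1 : t ^ 3 ≤ t ^ 2 := pow_le_pow_of_le_one ht0 hhx (by norm_num)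
  have k2 : 0 ≤ w * (5.2 * t ^ 2 - (8 * t - 6 + t ^ 2 + t ^ 3)) :=
    mul_nonneg hw0.le (by nlinarith [sq_nonneg (t - 5 / 4)])
  nlinarith [sq_nonneg (t ^ 2 - 2.6 * w), sq_nonneg w]

theorem mul_sq_sub_cube_le {c x : ℝ} (hc : 0 ≤ c) (hx : 0 ≤ x) :
    c * (1 + x) ^ 2 - x ^ 3 / 2 ≤ 2 * c + 32 * c ^ 3 := by
  have h1 : c * (1 + x) ^ 2 ≤ 2 * c + 2 * c * x ^ 2 := by nlinarith [mul_nonneg hc (sq_nonneg (1 - x))]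
  have h2 : 2 * c * x ^ 2 - x ^ 3 / 2 ≤ 32 * c ^ 3 := by
    rcases le_total x (4 * c) with h | h
    · have e1 : x ^ 2 ≤ (4 * c) ^ 2 := pow_le_pow_left₀ hx h 2
      have : 0 ≤ x ^ 3 := by positivity
      nlinarith
    · have e1 : 0 ≤ x ^ 2 * (x - 4 * c) := by
        have := sub_nonneg.mpr h; positivity
      have : 0 ≤ c ^ 3 := by positivity
      nlinarith
  linarith

theorem abs_sum_le_of_abs_sub_le {U V W B : ℝ} (h : |U - V - W| ≤ B) : |U - V| ≤ |W| + B := by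
  calc |U - V| = |W + (U - V - W)| := by ring_nf
    _ ≤ |W| + |U - V - W| := abs_add_le _ _
    _ ≤ |W| + B := by linarith

/-- The increment `δ` of the ansatz over one step, weighted with the cubic potential. -/
theorem langer_increment_bound {h x a₁ b₁ F F' C₀ δ : ℝ} (hh : 0 < h) (hh1 : h ≤ 1 / 2)
    (hx : 0 ≤ x) (hhx : h * x ≤ 1) (hF : 0 ≤ F) (hC₀ : 0 ≤ C₀) (ha₁ : |a₁| ≤ 1) (hb₁ : |b₁| ≤ 3)
    (hδ : |δ| ≤ |h ^ 2 * (a₁ * F + b₁ * F')| + C₀ * h ^ 4 * (1 + x) * (F + |F'|)) :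
    x ^ 3 * |δ| ≤ x * (F + 3 * |F'|) + C₀ * h * (1 + x) * (F + |F'|) ∧
    |δ| ≤ h * (F + 3 * |F'|) + C₀ * h * (1 + x) * (F + |F'|) := by
  have h1 : |h ^ 2 * (a₁ * F + b₁ * F')| ≤ h ^ 2 * (F + 3 * |F'|) := by
    rw [abs_mul, abs_of_nonneg (sq_nonneg h)]
    gcongr
    refine (abs_add_le _ _).trans ?_
    rw [abs_mul, abs_mul, abs_of_nonneg hF]
    have := abs_nonneg F'
    nlinarith
  have h2 := hδ.trans (add_le_add h1 le_rfl)
  have hS : 0 ≤ F + |F'| := by positivity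
  have e0 : 0 ≤ h * x := by positivity
  constructor
  · calc x ^ 3 * |δ| ≤ x ^ 3 * (h ^ 2 * (F + 3 * |F'|) + C₀ * h ^ 4 * (1 + x) * (F + |F'|)) := by
          gcongr
      _ = (h * x) ^ 2 * (x * (F + 3 * |F'|)) + (h * x) ^ 3 * (C₀ * h * (1 + x) * (F + |F'|)) := by
          ring
      _ ≤ 1 * (x * (F + 3 * |F'|)) + 1 * (C₀ * h * (1 + x) * (F + |F'|)) := by
          gcongr
          · exact pow_le_one₀ e0 hhx
          · exact pow_le_one₀ e0 hhx
      _ = _ := by ring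
  · calc |δ| ≤ h ^ 2 * (F + 3 * |F'|) + C₀ * h ^ 4 * (1 + x) * (F + |F'|) := h2
      _ = h * (h * (F + 3 * |F'|)) + h ^ 3 * (C₀ * h * (1 + x) * (F + |F'|)) := by ring
      _ ≤ 1 * (h * (F + 3 * |F'|)) + 1 * (C₀ * h * (1 + x) * (F + |F'|)) := by
          gcongr
          · linarith
          · exact pow_le_one₀ hh.le (by linarith)
      _ = _ := by ring

/-- Sign analysis of the coefficient of `h ^ 6`. Where `F' > 0` and `x ≤ 1`, the term `-2 * M * F'`
from the detuned amplitude beats every other multiple of `F'`. Elsewhere `|F'|` is at most a linear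
factor times `F`, everything is quadratic in `x` times `F`, and the surplus `-x ^ 3 / 2` of the
potential absorbs it. -/
theorem langer_supersolution_aux {h x a g b₁ v F F' C₀ c₂ R₀ R M Br ε δ : ℝ} (hh : 0 < h)
    (hh1 : h ≤ 1 / 2) (hx : 0 ≤ x) (hhx : h * x ≤ 1) (hF : 0 ≤ F) (hC₀ : 0 ≤ C₀) (hc₂ : 0 ≤ c₂)
    (ha0 : 0 ≤ a) (ha1 : a ≤ 3 / 10) (hg1 : 1 ≤ g) (hg2 : g ≤ 2) (hb₁ : |b₁| ≤ 3)
    (hR₀ : 0 ≤ R₀) (hR : 1 ≤ R) (hRR : R₀ ≤ R) (hM : 100 + 10 * R₀ ≤ M)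
    (hhC : h * (1 + 40 * C₀) ≤ 1) (hv : |v| ≤ x + R₀)
    (hBr : |Br - (8 / 25 * x ^ 3 + 4 / 125 * (h * x) * x ^ 3)| ≤ 100 * R ^ 3 * (1 + x) ^ 2)
    (hε : |ε| ≤ C₀ * h * (1 + x) * (F + |F'|) + 2 * x * (|h * a| * F + |b₁| * |F'|))
    (hδ : |δ| ≤ |h ^ 2 * (h * a * F + b₁ * F')| + C₀ * h ^ 4 * (1 + x) * (F + |F'|))
    (hcase : (0 < F' ∧ x ≤ 1) ∨ |F'| ≤ c₂ * (1 + x) * F) {D : ℝ}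
    (hD : D = 400 * R ^ 3 + (2 * M + 3 + 2 * R) * (1 + c₂) + 60 * (1 + c₂) + 30 * C₀ * (1 + c₂)) :
    (g * Br - a) * F + (-2 * M - 3 / 5 * a * x + v * (2 * a - g)) * F'
      - (x ^ 3 - 7) * (g * F + δ) + ε ≤ (2 * D + 32 * D ^ 3) * (g * F) := by
  have hha : |h * a| ≤ 1 := by
    rw [abs_of_nonneg (by positivity)]
    exact mul_le_one₀ (by linarith) ha0 (by linarith)
  obtain ⟨hd1, hd2⟩ := langer_increment_bound hh hh1 hx hhx hF hC₀ hha hb₁ hδ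
  have hS : 0 ≤ F + |F'| := by positivity
  have hF' := abs_nonneg F'
  have hX0 : 0 ≤ 1 + x := by linarith
  have hx3 : 0 ≤ x ^ 3 := by positivity
  have hBr' : Br ≤ 1 / 2 * x ^ 3 + 100 * R ^ 3 * (1 + x) ^ 2 := by
    have := (abs_le.mp hBr).2
    have := mul_le_mul_of_nonneg_right hhx hx3
    linarith
  have hε' : ε ≤ C₀ * h * (1 + x) * (F + |F'|) + 2 * x * (F + 3 * |F'|) := by
    refine (le_abs_self _).trans (hε.trans ?_)
    gcongr
    · exact mul_le_of_le_one_left hF hha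
  have hδ' : -(x ^ 3 - 7) * δ ≤ (x + 7 * h) * (F + 3 * |F'|) + 8 * (C₀ * h * (1 + x) * (F + |F'|)) := by
    have e1 : -(x ^ 3) * δ ≤ x ^ 3 * |δ| := by
      have := mul_le_mul_of_nonneg_left (neg_le_abs δ) hx3
      linarith
    have e2 := le_abs_self δ
    linarith
  have hBrF : (g * Br) * F - x ^ 3 * (g * F) ≤ (-(x ^ 3) / 2 + 200 * R ^ 3 * (1 + x) ^ 2) * F := by
    have e1 : (g * Br) * F - x ^ 3 * (g * F) = g * (Br - x ^ 3) * F := by ring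
    rw [e1]
    refine mul_le_mul_of_nonneg_right ?_ hF
    have e2 : g * (Br - x ^ 3) ≤ g * (-(x ^ 3) / 2 + 100 * R ^ 3 * (1 + x) ^ 2) :=
      mul_le_mul_of_nonneg_left (by linarith) (by linarith)
    have e3 : 0 ≤ 100 * R ^ 3 * (1 + x) ^ 2 := by positivity
    have e4 := mul_nonneg (sub_nonneg.mpr hg1) hx3
    have e5 := mul_nonneg (sub_nonneg.mpr hg2) e3
    linarith
  have hsum : (g * Br - a) * F + (-2 * M - 3 / 5 * a * x + v * (2 * a - g)) * F'
      - (x ^ 3 - 7) * (g * F + δ) + ε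
      ≤ (-(x ^ 3) / 2 + 200 * R ^ 3 * (1 + x) ^ 2) * F + 14 * F
        + (-2 * M - 3 / 5 * a * x + v * (2 * a - g)) * F'
        + (3 * x + 7 * h) * (F + 3 * |F'|) + 9 * (C₀ * h * (1 + x) * (F + |F'|)) := by
    have e1 : 0 ≤ a * F := by positivity
    have e2 := mul_le_mul_of_nonneg_right hg2 hF
    linarith
  have hR3 : 0 ≤ R ^ 3 := by positivity
  have hM0 : 0 ≤ M := by linarith
  have hD0 : 0 ≤ D := by rw [hD]; positivity
  have hDg : (2 * D + 32 * D ^ 3) * F ≤ (2 * D + 32 * D ^ 3) * (g * F) := by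
    exact mul_le_mul_of_nonneg_left (le_mul_of_one_le_left hF hg1) (by positivity)
  refine hsum.trans (le_trans ?_ hDg)
  have hvg : |v * (2 * a - g)| ≤ 2 * (x + R₀) := by
    rw [abs_mul]
    have : |2 * a - g| ≤ 2 := by rw [abs_le]; constructor <;> linarith
    have := mul_le_mul hv this (abs_nonneg _) (by linarith)
    linarith
  have hvg' := abs_le.mp hvg
  have hC₀h : C₀ * h ≤ 1 / 40 := by linarith
  have hC₀h0 : 0 ≤ C₀ * h := by positivity
  rcases hcase with ⟨hFpos, hx1⟩ | hFF
  · rw [abs_of_pos hFpos]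
    have hax : 0 ≤ a * x := by positivity
    have hX2 : (1 + x) ^ 2 ≤ 2 ^ 2 := pow_le_pow_left₀ hX0 (by linarith) 2
    have k1 : (-(x ^ 3) / 2 + 200 * R ^ 3 * (1 + x) ^ 2) * F ≤ 800 * R ^ 3 * F := by
      refine mul_le_mul_of_nonneg_right ?_ hF
      have := mul_le_mul_of_nonneg_left hX2 (show 0 ≤ 200 * R ^ 3 by positivity)
      linarith
    have k2 : (-2 * M - 3 / 5 * a * x + v * (2 * a - g)) * F' ≤ (-2 * M + 2 + 2 * R₀) * F' := by
      refine mul_le_mul_of_nonneg_right ?_ hFpos.le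
      linarith
    have k3 : (3 * x + 7 * h) * (F + 3 * F') ≤ 7 * (F + 3 * F') :=
      mul_le_mul_of_nonneg_right (by linarith) (by linarith)
    have k4 : C₀ * h * (1 + x) * (F + F') ≤ 1 / 40 * 2 * (F + F') := by
      gcongr; linarith
    -- This is where `M` has to be large: 22 bounds the multiples of `F'` from the increment and the
    -- error.
    have k5 : (-2 * M + 2 + 2 * R₀ + 22) * F' ≤ 0 :=
      mul_nonpos_of_nonpos_of_nonneg (by linarith) hFpos.le
    have k6 : (800 * R ^ 3 + 120) * F ≤ (2 * D + 32 * D ^ 3) * F := by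
      refine mul_le_mul_of_nonneg_right ?_ hF
      have : 0 ≤ (2 * M + 3 + 2 * R) * (1 + c₂) := by
        have : 0 ≤ 2 * M + 3 + 2 * R := by linarith
        positivity
      have : 0 ≤ 30 * C₀ * (1 + c₂) := by positivity
      have : 0 ≤ 32 * D ^ 3 := by positivity
      linarith
    linarith
  · have hXX : (1 + x) * F ≤ (1 + x) ^ 2 * F := by
      exact mul_le_mul_of_nonneg_right (le_self_pow₀ (by linarith) two_ne_zero) hF
    have hX1F : F ≤ (1 + x) * F := le_mul_of_one_le_left hF (by linarith)
    have hF'b : |F'| ≤ c₂ * ((1 + x) * F) := by linarith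
    have hSb : F + |F'| ≤ (1 + c₂) * ((1 + x) * F) := by linarith
    have hSb3 : F + 3 * |F'| ≤ 3 * ((1 + c₂) * ((1 + x) * F)) := by linarith
    have hXF : 0 ≤ (1 + x) * F := by positivity
    have k2 : (-2 * M - 3 / 5 * a * x + v * (2 * a - g)) * F'
        ≤ ((2 * M + 3 + 2 * R) * (1 + x)) * ((1 + c₂) * ((1 + x) * F)) := by
      refine (le_abs_self _).trans ?_
      rw [abs_mul]
      have hax : 3 / 5 * a * x ≤ x := mul_le_of_le_one_left hx (by linarith)
      have hax0 : 0 ≤ 3 / 5 * a * x := by positivity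
      refine mul_le_mul ?_ (by linarith) hF' (by
        have : 0 ≤ 2 * M + 3 + 2 * R := by linarith
        positivity)
      have hp : 0 ≤ (2 * M + 2 * R) * x := mul_nonneg (by linarith) hx
      rw [abs_le]
      constructor <;> linarith
    have k3 : (3 * x + 7 * h) * (F + 3 * |F'|)
        ≤ (4 * (1 + x)) * (3 * ((1 + c₂) * ((1 + x) * F))) := by
      refine mul_le_mul (by linarith) hSb3 (by positivity) (by positivity)
    have k4 : C₀ * h * (1 + x) * (F + |F'|) ≤ (1 / 40 * (1 + x)) * ((1 + c₂) * ((1 + x) * F)) := by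
      refine mul_le_mul ?_ hSb hS (by positivity)
      gcongr
    have k5 : D * (1 + x) ^ 2 * F - x ^ 3 / 2 * F ≤ (2 * D + 32 * D ^ 3) * F := by
      have := mul_le_mul_of_nonneg_right (mul_sq_sub_cube_le hD0 hx) hF
      linarith
    have k6 : 200 * R ^ 3 * (1 + x) ^ 2 * F + 14 * F
        + ((2 * M + 3 + 2 * R) * (1 + x)) * ((1 + c₂) * ((1 + x) * F))
        + (4 * (1 + x)) * (3 * ((1 + c₂) * ((1 + x) * F)))
        + 9 * ((1 / 40 * (1 + x)) * ((1 + c₂) * ((1 + x) * F))) ≤ D * (1 + x) ^ 2 * F := by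
      set Y := (1 + x) ^ 2 * F with hY
      have hFY : F ≤ Y := hX1F.trans hXX
      have e1 : D * (1 + x) ^ 2 * F = D * Y := by ring
      have e2 : ((2 * M + 3 + 2 * R) * (1 + x)) * ((1 + c₂) * ((1 + x) * F))
        = (2 * M + 3 + 2 * R) * (1 + c₂) * Y := by rw [hY]; ring
      have e3 : (4 * (1 + x)) * (3 * ((1 + c₂) * ((1 + x) * F))) = 12 * (1 + c₂) * Y := by
        rw [hY]; ring
      have e4 : 9 * ((1 / 40 * (1 + x)) * ((1 + c₂) * ((1 + x) * F))) = 9 / 40 * (1 + c₂) * Y := by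
        rw [hY]; ring
      have e5 : 200 * R ^ 3 * (1 + x) ^ 2 * F = 200 * R ^ 3 * Y := by rw [hY]; ring
      have hY0 : 0 ≤ Y := hF.trans hFY
      have p1 : 0 ≤ c₂ * Y := by positivity
      have p2 : 0 ≤ R ^ 3 * Y := by positivity
      have p3 : 0 ≤ C₀ * (1 + c₂) * Y := by positivity
      rw [e1, e2, e3, e4, e5, hD]
      linarith
    linarith

/-- The Langer ansatz gives a supersolution of the scaled recursion. -/
theorem langer_supersolution {f f' : ℝ → ℝ} (hf : IsAirySolution f f') {z c₁ : ℝ} (hc₁ : 0 ≤ c₁)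
    (hpos : ∀ y, z ≤ y → 0 ≤ f y) (hdec : ∀ y, z ≤ y → f' y ≤ 0 → |f' y| ≤ c₁ * (1 + |y|) * f y)
    (hinc : ∀ y, z + 1 / 2 ≤ y → f' y ≤ c₁ * f y) {R₀ R M : ℝ} (hR₀ : 0 ≤ R₀) (hR : 1 ≤ R)
    (hRR : R₀ ≤ R) (hM : 100 + 10 * R₀ ≤ M) :
    ∃ C h₀ : ℝ, 0 < h₀ ∧ ∀ h r b k x : ℝ, 0 < h → h ≤ h₀ → |r| ≤ R₀ → |b| ≤ R₀ → |k| ≤ R →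
      0 ≤ x → h * x ≤ 1 → z ≤ langerPhase h r b k x → z ≤ langerPhase h r b k (x + h ^ 2) →
      (1 ≤ x → z + 1 / 2 ≤ langerPhase h r b k x) →
      langerU f h r b k (3 / 10 - h * M) 0 (x - h ^ 2)
          - 2 * langerU f h r b k (3 / 10 - h * M) 0 x
          + (1 - h ^ 3 / (1 - h * x + h ^ 3)) * langerU f h r b k (3 / 10 - h * M) 0 (x + h ^ 2)
        ≤ (-h ^ 3 + r * h ^ 4 + (b - 8 * r ^ 2 / 15) * h ^ 5 + C * h ^ 6)
          * langerU f h r b k (3 / 10 - h * M) 0 x := by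
  obtain ⟨C₀, hC₀, hcons⟩ := langer_consistency R (by linarith)
  have hM0 : 0 < M := by linarith
  set c₂ := c₁ * (1 + 5000 * (1 + R)) with hc₂
  have hc₂0 : 0 ≤ c₂ := by positivity
  set D := 400 * R ^ 3 + (2 * M + 3 + 2 * R) * (1 + c₂) + 60 * (1 + c₂) + 30 * C₀ * (1 + c₂) with hD
  have hD0 : 0 ≤ D := by positivity
  refine ⟨2 * D + 32 * D ^ 3, min (1 / (20 * M)) (min (1 / (1 + R)) (1 / (1 + 40 * C₀))),
    by positivity, ?_⟩
  intro h r b k x hh hh₀ hr hb hk hx hhx hz hz' hz1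
  have hhM : h * M ≤ 1 / 20 := by
    have := hh₀.trans (min_le_left _ _)
    rw [le_div_iff₀ (by positivity)] at this
    linarith
  have hhR : h * (1 + R) ≤ 1 := by
    have := hh₀.trans ((min_le_right _ _).trans (min_le_left _ _))
    rwa [le_div_iff₀ (by positivity)] at this
  have hhC : h * (1 + 40 * C₀) ≤ 1 := by
    have := hh₀.trans ((min_le_right _ _).trans (min_le_right _ _))
    rwa [le_div_iff₀ (by positivity)] at this
  have hh1 : h ≤ 1 / 2 := by
    have := mul_le_mul_of_nonneg_left hR hh.le
    linarith
  have hhR₀ : h * R₀ ≤ 1 / 200 := by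
    have := mul_le_mul_of_nonneg_left hM hh.le
    linarith
  have hhM0 : 0 ≤ h * M := by positivity
  set a := 3 / 10 - h * M with ha
  have ha0 : 0 ≤ a := by linarith
  have ha1 : a ≤ 3 / 10 := by rw [ha]; linarith
  obtain ⟨err, herr, hUp, hrec⟩ := hcons f f' hf h r b k a 0 x hh (by linarith) (hr.trans hRR)
    (hb.trans hRR) hk (by rw [abs_of_nonneg ha0]; linarith) le_rfl hx hhx (by simp)
  have hrec' := hrec (h ^ 3 / (1 - h * x + h ^ 3))
  have hbr := langer_phase_bound hR hh (by linarith) (hr.trans hRR) (hb.trans hRR) hk hx hhx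
  have hpot := potential_lower_bound hh (by linarith) hx hhx
  have hphase := langer_bound (a := a) hh (by linarith) (hr.trans hRR) (hb.trans hRR) hk
    (by rw [abs_of_nonneg ha0]; linarith) le_rfl hx hhx (by simp)
  have hyb := hphase.phase x (by rw [sub_self, abs_zero]; positivity)
  rw [langer_phase_identity] at hrec'
  have hg1 : 1 ≤ langerAmp h a 0 x := by
    have : 0 ≤ h * a * x := by positivity
    simp only [langerAmp]; linarith
  have hg2 : langerAmp h a 0 x ≤ 2 := by
    have := mul_le_mul_of_nonneg_right hhx ha0
    simp only [langerAmp]; linarith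
  have hgp : 0 ≤ langerAmp h a 0 (x + h ^ 2) := by
    have : 0 ≤ h * a * (x + h ^ 2) := by positivity
    simp only [langerAmp]; linarith
  have hUp0 : 0 ≤ langerU f h r b k a 0 (x + h ^ 2) := mul_nonneg hgp (hpos _ hz')
  have hA1 : langerAmp1 h a 0 x = h * a := by simp [langerAmp1]
  have hA2 : langerAmp2 h 0 x = 0 := by simp [langerAmp2]
  have hA0 : langerAmp h a 0 x = 1 + h * a * x := by simp [langerAmp]
  have hp1 : langerPhase1 h r x = 1 + h * (2 * x / 5 - 4 * r / 15) := rfl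
  have hUx : langerU f h r b k a 0 x = langerAmp h a 0 x * f (langerPhase h r b k x) := rfl
  rw [hA1, hA2, hUx] at hrec'
  rw [hA1] at herr
  rw [hUx, hA1] at hUp
  rw [hUx]
  have hF0 := hpos _ hz
  have hdec' := hdec _ hz
  have hinc' := fun h1 => hinc _ (hz1 h1)
  have hp1b : |langerPhase1 h r x| ≤ 3 / 2 := by
    have h1 := abs_le.mp hr
    have h2 := mul_le_mul_of_nonneg_left h1.2 hh.le
    have h3 := mul_le_mul_of_nonneg_left h1.1 hh.le
    have h4 : 0 ≤ h * x := by positivity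
    rw [hp1, abs_le]
    constructor <;> linarith
  set y := langerPhase h r b k x
  set F := f y with hF
  set F' := f' y with hF'
  set g := langerAmp h a 0 x
  set p1 := langerPhase1 h r x
  set Up := langerU f h r b k a 0 (x + h ^ 2)
  set Um := langerU f h r b k a 0 (x - h ^ 2)
  set q := h ^ 3 / (1 - h * x + h ^ 3)
  set Br := (k + 2 * (x ^ 2 / 5 - 4 * r * x / 15 + b) * (2 * x / 5 - 4 * r / 15)
      + (2 * x / 5 - 4 * r / 15) ^ 2 * (x + r)
      + h * (x ^ 2 / 5 - 4 * r * x / 15 + b) * (2 * x / 5 - 4 * r / 15) ^ 2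
      + 2 * h * k * (2 * x / 5 - 4 * r / 15) + h ^ 2 * k * (2 * x / 5 - 4 * r / 15) ^ 2)
  set v := 2 * x / 5 - 4 * r / 15 with hv
  set S := |F| + |F'| with hS
  -- The value `3 / 10` cancels order `h`, as `2 * (3 / 10) + 2 / 5 - 1 = 0`. The detuning `-h * M`
  -- then contributes `-2 * M` at order `h ^ 2`.
  have hQ : 2 * (h * a) * p1 + g * (2 * h / 5) - h * g * p1
      = h ^ 2 * (-2 * M - 3 / 5 * a * x + v * (2 * a - g)) := by
    rw [hA0, hp1, ha]; ring
  have hvb : |v| ≤ x + R₀ := by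
    have h1 := abs_le.mp hr
    rw [hv, abs_le]; constructor <;> linarith
  have hgp1 : |g * p1| ≤ 3 := by
    rw [abs_mul, abs_of_nonneg (by linarith : 0 ≤ g)]
    have := mul_le_mul hg2 hp1b (abs_nonneg _) (by norm_num)
    linarith
  have hFa : |F| = F := abs_of_nonneg hF0
  have hha : |h * a| ≤ h := by
    rw [abs_of_nonneg (by positivity)]
    exact mul_le_of_le_one_right hh.le (by linarith)
  rw [hFa] at hS
  clear_value y g p1 Up Um q Br v
  have hδ := abs_sum_le_of_abs_sub_le hUp
  rw [hS] at hδ herr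
  rw [hFa] at herr
  have h6 : 0 < h ^ 6 := pow_pos hh 6
  have hε : |err / h ^ 6| ≤ C₀ * h * (1 + x) * (F + |F'|)
      + 2 * x * (|h * a| * F + |g * p1| * |F'|) := by
    rw [abs_div, abs_of_pos h6, div_le_iff₀ h6]
    linarith
  -- The ratio `f' / f` is unbounded only just right of the zero `z`. For `1 ≤ x` the phase is
  -- already at `z + 1 / 2` or beyond.
  have hcase : (0 < F' ∧ x ≤ 1) ∨ |F'| ≤ c₂ * (1 + x) * F := by
    have hc₁₂ : c₁ ≤ c₂ := by
      rw [hc₂]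
      exact le_mul_of_one_le_right hc₁ (by linarith)
    rcases le_or_gt F' 0 with h1 | h1
    · right
      refine (hdec' h1).trans ?_
      have e : 1 + |y| ≤ (1 + 5000 * (1 + R)) * (1 + x) := by linarith
      rw [hc₂, mul_assoc c₁ (1 + 5000 * (1 + R))]
      exact mul_le_mul_of_nonneg_right (mul_le_mul_of_nonneg_left e hc₁) hF0
    · rcases le_or_gt x 1 with h2 | h2
      · exact Or.inl ⟨h1, h2⟩
      · right
        rw [abs_of_pos h1]
        refine (hinc' h2.le).trans ?_
        gcongr
        exact hc₁₂.trans (le_mul_of_one_le_right hc₂0 (by linarith))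
  have key := langer_supersolution_aux hh hh1 hx hhx hF0 hC₀ hc₂0 ha0 ha1 hg1 hg2 hgp1 hR₀ hR hRR
    hM hhC hvb hbr hε hδ hcase hD
  have key' := mul_le_mul_of_nonneg_left key h6.le
  have e1 : h ^ 6 * (err / h ^ 6) = err := by field_simp
  have e2 := mul_le_mul_of_nonneg_right hpot hUp0
  rw [hQ] at hrec'
  have e3 : g * F + (Up - g * F) = Up := by ring
  rw [e3] at key'
  clear hε key hcase hδ hUp herr hbr hcons hdec' hinc' hrec
  have e4 : h ^ 6 * ((g * Br - a) * F + (-2 * M - 3 / 5 * a * x + v * (2 * a - g)) * F'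
      - (x ^ 3 - 7) * Up + err / h ^ 6) = h ^ 4 * ((0 + g * (h ^ 2 * Br) - h * (h * a)) * F
      + h ^ 2 * (-2 * M - 3 / 5 * a * x + v * (2 * a - g)) * F') - h ^ 6 * (x ^ 3 - 7) * Up
      + h ^ 6 * (err / h ^ 6) := by ring
  rw [e4, e1] at key'
  linarith

/-! ### The truncated subsolution. -/

theorem potential_two_sided_bound {h x : ℝ} (hh : 0 < h) (hh1 : h ≤ 1 / 4) (hx : 0 ≤ x)
    (hhx : h * x ≤ 1 / 2) :
    |h ^ 3 / (1 - h * x + h ^ 3) - h ^ 3 * (1 + h * x + h ^ 2 * x ^ 2)| ≤ h ^ 6 * (2 * x ^ 3 + 5) := by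
  set t := h * x with ht
  have ht0 : 0 ≤ t := by positivity
  set w := h ^ 3 with hw
  have hw0 : 0 < w := pow_pos hh 3
  have hw1 : w ≤ 1 / 64 := (pow_le_pow_left₀ hh.le hh1 3).trans (by norm_num)
  have hd : 1 / 2 ≤ 1 - t + w := by linarith
  have e1 : h ^ 6 * (2 * x ^ 3 + 5) = w * (2 * t ^ 3 + 5 * w) := by rw [hw, ht]; ring
  have e2 : h ^ 2 * x ^ 2 = t ^ 2 := by rw [ht]; ring
  have e3 : w / (1 - t + w) - w * (1 + t + t ^ 2)
      = w * ((t ^ 3 - w * (1 + t + t ^ 2)) / (1 - t + w)) := by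
    field_simp
    ring
  rw [e1, e2, e3, abs_mul, abs_of_pos hw0]
  refine mul_le_mul_of_nonneg_left ?_ hw0.le
  rw [abs_div, abs_of_pos (by linarith : 0 < 1 - t + w), div_le_iff₀ (by linarith)]
  have ht3 : 0 ≤ t ^ 3 := by positivity
  have h1 : t + t ^ 2 ≤ 1 := by nlinarith
  have h2 : |t ^ 3 - w * (1 + t + t ^ 2)| ≤ t ^ 3 + 2 * w := by
    have h3 : w * (t + t ^ 2) ≤ w * 1 := mul_le_mul_of_nonneg_left h1 hw0.le
    have h4 : 0 ≤ w * (t + t ^ 2) := by positivity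
    rw [abs_le]; constructor <;> linarith
  refine h2.trans ?_
  have := mul_le_mul_of_nonneg_left hd (show 0 ≤ 2 * t ^ 3 + 5 * w by positivity)
  linarith

-- Now the cubic remainder of the potential has the wrong sign. The term `-10 * h ^ 2 * x ^ 4` of
-- the amplitude compensates for it: its derivative contributes `-80 * x ^ 3 * p₁ * F'`, which is
-- positive where the solution decreases. Up to the fixed point `X₀` everything is a bounded
-- multiple of `F`; beyond it `F' ≤ -F` and this term dominates. Where `F' > 0` near the boundary,
-- `2 * M * F'` decides.
set_option maxHeartbeats 1000000 in
theorem langer_subsolution_aux {h x a g g₁ b₁ v p₁ F F' C₀ c₂ R₀ R M X₀ Br ε δ e : ℝ} (hh : 0 < h)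
    (hh1 : h ≤ 1 / 2) (hx : 0 ≤ x) (hhx : h * x ≤ 1 / 100) (hhx2 : h * x ^ 2 ≤ 1) (hF : 0 ≤ F)
    (hC₀ : 0 ≤ C₀) (hc₂ : 0 ≤ c₂) (ha0 : 0 ≤ a) (ha1 : a ≤ 1 / 2) (hg0 : 0 ≤ g) (hg2 : g ≤ 2)
    (hg12 : x ≤ X₀ → 1 / 2 ≤ g) (hg₁ : |g₁| ≤ 1) (hb₁ : |b₁| ≤ 3) (hp0 : 9 / 10 ≤ p₁)
    (hp1 : p₁ ≤ 11 / 10) (hR₀ : 0 ≤ R₀) (hR : 1 ≤ R) (hRR : R₀ ≤ R) (hM : 100 + 10 * R₀ ≤ M)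
    (hhC : h * (1 + 40 * C₀) ≤ 1) (hv : |v| ≤ x + R₀)
    (hBr : |Br - (8 / 25 * x ^ 3 + 4 / 125 * (h * x) * x ^ 3)| ≤ 100 * R ^ 3 * (1 + x) ^ 2)
    (hε : |ε| ≤ C₀ * h * (1 + x) * (F + |F'|) + 2 * x * (|g₁| * F + |b₁| * |F'|))
    (hδ : |δ| ≤ |h ^ 2 * (g₁ * F + b₁ * F')| + C₀ * h ^ 4 * (1 + x) * (F + |F'|))
    (he : |e| ≤ 2 * x ^ 3 + 5) (hX₀ : X₀ = 2 * M + 2 * R + 200 + 800 * R ^ 3)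
    (hcase : (0 < F' ∧ x ≤ 1) ∨ (x ≤ X₀ ∧ |F'| ≤ c₂ * (1 + x) * F) ∨ (X₀ ≤ x ∧ F' ≤ -F)) {D : ℝ}
    (hD : D = (2 * M + 2 * R + 110) * c₂ + 200 * R ^ 3 + 135 + 16 * (1 + c₂)) :
    -(2 * D * (1 + X₀) ^ 4) * (g * F) ≤
      (-120 * x ^ 2 + g * Br - a + 40 * h * x ^ 3) * F
        + (2 * M - 3 / 5 * a * x + 6 * h * x ^ 4 + v * (2 * a - g) - 80 * x ^ 3 * p₁) * F'
        - e * (g * F + δ) + ε := by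
  obtain ⟨hd1, hd2⟩ := langer_increment_bound hh hh1 hx (by linarith) hF hC₀ hg₁ hb₁ hδ
  have hM0 : 0 ≤ M := by linarith
  have hS : 0 ≤ F + |F'| := by positivity
  have hF' := abs_nonneg F'
  have hX0 : 0 ≤ 1 + x := by linarith
  have hx2 : 0 ≤ x ^ 2 := by positivity
  have hx3 : 0 ≤ x ^ 3 := by positivity
  have hR3 : 0 ≤ R ^ 3 := by positivity
  have hhx0 : 0 ≤ h * x := by positivity
  have hBr' : -(100 * R ^ 3 * (1 + x) ^ 2) ≤ Br := by
    have := (abs_le.mp hBr).1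
    have : 0 ≤ (h * x) * x ^ 3 := by positivity
    linarith
  have hε' : -(C₀ * h * (1 + x) * (F + |F'|) + 2 * x * (F + 3 * |F'|)) ≤ ε := by
    refine le_trans (neg_le_neg (hε.trans ?_)) (neg_abs_le ε)
    gcongr
    exact mul_le_of_le_one_left hF hg₁
  have hgF : 0 ≤ g * F := by positivity
  have hgF2 : g * F ≤ 2 * F := mul_le_mul_of_nonneg_right hg2 hF
  have heδ : -(2 * x ^ 3 * (2 * F) + 10 * F + (2 * x + 5 * h) * (F + 3 * |F'|)
      + 7 * (C₀ * h * (1 + x) * (F + |F'|))) ≤ -e * (g * F + δ) := by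
    have e1 : |e * (g * F + δ)| ≤ (2 * x ^ 3 + 5) * (g * F + |δ|) := by
      rw [abs_mul]
      have : |g * F + δ| ≤ g * F + |δ| := by
        refine (abs_add_le _ _).trans ?_
        rw [abs_of_nonneg hgF]
      exact mul_le_mul he this (abs_nonneg _) (by positivity)
    have e2 := neg_le_neg (e1.trans' (le_abs_self _))
    have e3 := mul_le_mul_of_nonneg_left hgF2 (show 0 ≤ 2 * x ^ 3 + 5 by positivity)
    linarith
  have hBrF : -(200 * R ^ 3 * (1 + x) ^ 2 * F) ≤ (g * Br) * F := by
    have e0 : 0 ≤ 100 * R ^ 3 * (1 + x) ^ 2 := by positivity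
    have e1 := mul_le_mul_of_nonneg_left hBr' hg0
    have e2 := mul_le_mul_of_nonneg_right hg2 e0
    have e3 : -(200 * R ^ 3 * (1 + x) ^ 2) ≤ g * Br := by linarith
    have := mul_le_mul_of_nonneg_right e3 hF
    linarith
  set Q := 2 * M - 3 / 5 * a * x + 6 * h * x ^ 4 + v * (2 * a - g) - 80 * x ^ 3 * p₁ with hQ
  have hsum : -(120 * x ^ 2 * F) - 200 * R ^ 3 * (1 + x) ^ 2 * F - 11 * F + Q * F' - 4 * x ^ 3 * F
      - (4 * x + 5 * h) * (F + 3 * |F'|) - 8 * (C₀ * h * (1 + x) * (F + |F'|)) ≤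
      (-120 * x ^ 2 + g * Br - a + 40 * h * x ^ 3) * F + Q * F' - e * (g * F + δ) + ε := by
    have e1 : a * F ≤ 1 * F := mul_le_mul_of_nonneg_right (by linarith) hF
    have e2 : 0 ≤ 40 * h * x ^ 3 * F := by positivity
    linarith
  refine le_trans ?_ hsum
  have hvg : |v * (2 * a - g)| ≤ 2 * (x + R₀) := by
    rw [abs_mul]
    have : |2 * a - g| ≤ 2 := by rw [abs_le]; constructor <;> linarith
    have := mul_le_mul hv this (abs_nonneg _) (by linarith)
    linarith
  obtain ⟨hvg1, hvg2⟩ := abs_le.mp hvg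
  have hC₀h : C₀ * h ≤ 1 / 40 := by linarith
  have hC₀h0 : 0 ≤ C₀ * h := by positivity
  have hax0 : 0 ≤ a * x := by positivity
  have hax1 : 3 / 5 * a * x ≤ x := mul_le_of_le_one_left hx (by linarith)
  have hx4 : 0 ≤ h * x ^ 4 := by positivity
  have hX₀0 : 0 ≤ X₀ := by rw [hX₀]; positivity
  have hD0 : 0 ≤ D := by rw [hD]; positivity
  have hxp0 : 72 * x ^ 3 ≤ 80 * x ^ 3 * p₁ := by
    have := mul_le_mul_of_nonneg_left hp0 hx3; linarith
  have hxp1 : 80 * x ^ 3 * p₁ ≤ 88 * x ^ 3 := by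
    have := mul_le_mul_of_nonneg_left hp1 hx3; linarith
  have hfin : ∀ {W : ℝ}, x ≤ X₀ → -(D * (1 + X₀) ^ 4) * F ≤ W →
      -(2 * D * (1 + X₀) ^ 4) * (g * F) ≤ W := by
    intro W h1 h2
    have h3 := mul_le_mul_of_nonneg_right (hg12 h1) hF
    have h4 := mul_le_mul_of_nonneg_left h3 (show 0 ≤ D * (1 + X₀) ^ 4 by positivity)
    linarith
  rcases hcase with ⟨hFpos, hx1⟩ | ⟨hxX, hFF⟩ | ⟨hxX, hFF⟩
  · refine hfin (by rw [hX₀]; linarith) ?_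
    rw [abs_of_pos hFpos]
    have hX2 : (1 + x) ^ 2 ≤ 2 ^ 2 := pow_le_pow_left₀ hX0 (by linarith) 2
    have hx31 : x ^ 3 ≤ 1 := pow_le_one₀ hx hx1
    have hx21 : x ^ 2 ≤ 1 := pow_le_one₀ hx hx1
    have k1 : (120 * x ^ 2 + 200 * R ^ 3 * (1 + x) ^ 2 + 11 + 4 * x ^ 3) * F
        ≤ (135 + 800 * R ^ 3) * F := by
      refine mul_le_mul_of_nonneg_right ?_ hF
      have := mul_le_mul_of_nonneg_left hX2 (show 0 ≤ 200 * R ^ 3 by positivity)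
      linarith
    have k2 : 30 * F' ≤ Q * F' := by
      refine mul_le_mul_of_nonneg_right ?_ hFpos.le
      rw [hQ]; linarith
    have k3 : (4 * x + 5 * h) * (F + 3 * F') ≤ 8 * (F + 3 * F') :=
      mul_le_mul_of_nonneg_right (by linarith) (by linarith)
    have k4 : C₀ * h * (1 + x) * (F + F') ≤ 1 / 40 * 2 * (F + F') := by
      gcongr; linarith
    have k6 : (145 + 800 * R ^ 3) * F ≤ D * (1 + X₀) ^ 4 * F := by
      refine mul_le_mul_of_nonneg_right ?_ hF
      have h1 : (2 : ℝ) ^ 4 ≤ (1 + X₀) ^ 4 := by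
        refine pow_le_pow_left₀ (by norm_num) ?_ 4
        rw [hX₀]; linarith
      have h2 : 200 * R ^ 3 + 135 ≤ D := by
        rw [hD]
        have : 0 ≤ (2 * M + 2 * R + 110) * c₂ := by positivity
        linarith
      have := mul_le_mul h2 h1 (by norm_num) hD0
      linarith
    linarith
  · refine hfin hxX ?_
    have hX1 : 1 ≤ 1 + x := by linarith
    have hXF : 0 ≤ (1 + x) * F := by positivity
    have hm : ∀ m : ℕ, m ≤ 4 → (1 + x) ^ m * F ≤ (1 + x) ^ 4 * F := fun m hm =>
      mul_le_mul_of_nonneg_right (pow_le_pow_right₀ hX1 hm) hF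
    have m0 := hm 0 (by norm_num)
    have m2 := hm 2 (by norm_num)
    have hxX1 : x ≤ 1 + x := by linarith
    have k1 : 120 * x ^ 2 * F + 4 * x ^ 3 * F ≤ 124 * ((1 + x) ^ 4 * F) := by
      have e1 : x ^ 2 ≤ (1 + x) ^ 4 :=
        (pow_le_pow_left₀ hx hxX1 2).trans (pow_le_pow_right₀ hX1 (by norm_num))
      have e2 : x ^ 3 ≤ (1 + x) ^ 4 :=
        (pow_le_pow_left₀ hx hxX1 3).trans (pow_le_pow_right₀ hX1 (by norm_num))
      have := mul_le_mul_of_nonneg_right e1 hF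
      have := mul_le_mul_of_nonneg_right e2 hF
      linarith
    have hSb : F + |F'| ≤ (1 + c₂) * ((1 + x) * F) := by
      have : F ≤ (1 + x) * F := le_mul_of_one_le_left hF hX1
      linarith
    have hSb3 : F + 3 * |F'| ≤ 3 * ((1 + c₂) * ((1 + x) * F)) := by linarith
    have hQb : |Q| ≤ (2 * M + 2 * R + 110) * (1 + x) ^ 3 := by
      have q1 : 6 * h * x ^ 4 ≤ 6 * x ^ 2 := by
        have := mul_le_mul_of_nonneg_right hhx2 hx2
        linarith
      have q2 : 0 ≤ (2 * M + 2 * R) * (3 * x + 3 * x ^ 2 + x ^ 3) := by positivity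
      rw [abs_le]
      constructor
      · rw [hQ]; linarith
      · rw [hQ]; linarith
    have k2 : -(((2 * M + 2 * R + 110) * (1 + x) ^ 3) * (c₂ * (1 + x) * F)) ≤ Q * F' := by
      refine le_trans (neg_le_neg ?_) (neg_abs_le _)
      rw [abs_mul]
      exact mul_le_mul hQb hFF hF' (by positivity)
    have k3 : (4 * x + 5 * h) * (F + 3 * |F'|)
        ≤ (5 * (1 + x)) * (3 * ((1 + c₂) * ((1 + x) * F))) := by
      refine mul_le_mul (by linarith) hSb3 (by positivity) (by positivity)
    have k4 : C₀ * h * (1 + x) * (F + |F'|) ≤ (1 / 40 * (1 + x)) * ((1 + c₂) * ((1 + x) * F)) := by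
      refine mul_le_mul ?_ hSb hS (by positivity)
      gcongr
    have k5 : D * ((1 + x) ^ 4 * F) ≤ D * (1 + X₀) ^ 4 * F := by
      rw [← mul_assoc]
      gcongr
    have m2' := mul_le_mul_of_nonneg_left m2 (show 0 ≤ 1 + c₂ by positivity)
    have m2'' := mul_le_mul_of_nonneg_left m2 hR3
    have e3 : (5 * (1 + x)) * (3 * ((1 + c₂) * ((1 + x) * F)))
      = 15 * ((1 + c₂) * ((1 + x) ^ 2 * F)) := by ring
    have e4 : (1 / 40 * (1 + x)) * ((1 + c₂) * ((1 + x) * F))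
      = 1 / 40 * ((1 + c₂) * ((1 + x) ^ 2 * F)) := by ring
    have e2 : ((2 * M + 2 * R + 110) * (1 + x) ^ 3) * (c₂ * (1 + x) * F)
      = (2 * M + 2 * R + 110) * c₂ * ((1 + x) ^ 4 * F) := by ring
    have e5 : 200 * R ^ 3 * (1 + x) ^ 2 * F = 200 * (R ^ 3 * ((1 + x) ^ 2 * F)) := by ring
    rw [e2] at k2
    rw [e3] at k3
    rw [e4] at k4
    rw [e5]
    set Y := (1 + x) ^ 4 * F
    have hY0 : 0 ≤ (1 + c₂) * Y := by positivity
    rw [pow_zero, one_mul] at m0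
    have eD : D * Y = (2 * M + 2 * R + 110) * c₂ * Y + 200 * (R ^ 3 * Y) + 135 * Y
      + 16 * ((1 + c₂) * Y) := by rw [hD]; ring
    linarith
  -- Beyond `X₀` the left side is nonpositive, and the right side turns out to be nonnegative.
  · refine le_trans (mul_nonpos_of_nonpos_of_nonneg (by
      rw [neg_nonpos]; positivity) hgF) ?_
    set G := |F'| with hG
    have hFn : F' = -G := by rw [hG, abs_of_nonpos (by linarith)]; ring
    have hFG : F ≤ G := by linarith
    have hx1 : 1 ≤ x := by
      have : 1 ≤ X₀ := by rw [hX₀]; linarith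
      linarith
    have hx12 : 1 ≤ x ^ 2 := one_le_pow₀ hx1
    have hxx2 : x ≤ x ^ 2 := le_self_pow₀ hx1 two_ne_zero
    have k1 : (120 * x ^ 2 + 200 * R ^ 3 * (1 + x) ^ 2 + 11 + 4 * x ^ 3) * F
        ≤ (120 * x ^ 2 + 200 * R ^ 3 * (1 + x) ^ 2 + 11 + 4 * x ^ 3) * G :=
      mul_le_mul_of_nonneg_left hFG (by positivity)
    have hX2 : (1 + x) ^ 2 ≤ 4 * x ^ 2 := by
      have := pow_le_pow_left₀ hX0 (show 1 + x ≤ 2 * x by linarith) 2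
      linarith
    have hX2R := mul_le_mul_of_nonneg_left hX2 hR3
    have k3 : (4 * x + 5 * h) * (F + 3 * G) ≤ (4 * x + 5 * h) * (4 * G) :=
      mul_le_mul_of_nonneg_left (by linarith) (by positivity)
    have k4 : C₀ * h * (1 + x) * (F + G) ≤ 1 / 40 * (1 + x) * (2 * G) := by
      gcongr
      linarith
    have hbig : X₀ * x ^ 2 ≤ x ^ 3 := by
      have := mul_le_mul_of_nonneg_right hxX hx2
      linarith
    have k5 : 0 ≤ (-Q - (120 * x ^ 2 + 200 * R ^ 3 * (1 + x) ^ 2 + 11 + 4 * x ^ 3)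
        - (4 * x + 5 * h) * 4 - 8 * (1 / 40 * (1 + x) * 2)) * G := by
      refine mul_nonneg ?_ hF'
      have e1 : h * x ^ 4 ≤ 1 / 100 * x ^ 3 := by
        have := mul_le_mul_of_nonneg_right hhx hx3
        linarith
      have e2 : X₀ * x ^ 2 = 2 * M * x ^ 2 + 2 * R * x ^ 2 + 200 * x ^ 2 + 800 * (R ^ 3 * x ^ 2) := by
        rw [hX₀]; ring
      have e3 : M * 1 ≤ M * x ^ 2 := mul_le_mul_of_nonneg_left hx12 hM0
      have e4 : R * 1 ≤ R * x ^ 2 := mul_le_mul_of_nonneg_left hx12 (by linarith)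
      rw [hQ]
      linarith
    rw [hFn]
    linarith

set_option maxHeartbeats 1000000 in
/-- The Langer ansatz gives a truncated subsolution of the scaled recursion. -/
theorem langer_subsolution {f f' : ℝ → ℝ} (hf : IsAirySolution f f') {z c₁ : ℝ} (hc₁ : 0 ≤ c₁)
    (hpos : ∀ y, z ≤ y → 0 ≤ f y) (hdec : ∀ y, z ≤ y → f' y ≤ 0 → |f' y| ≤ c₁ * (1 + |y|) * f y)
    (hinc : ∀ y, z + 1 / 2 ≤ y → f' y ≤ c₁ * f y) (hfast : ∀ y, 2 ≤ y → f' y ≤ -f y)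
    {R₀ R M : ℝ} (hR₀ : 0 ≤ R₀) (hR : 1 ≤ R) (hRR : R₀ ≤ R) (hM : 100 + 10 * R₀ ≤ M) :
    ∃ C h₀ : ℝ, 0 < h₀ ∧ ∀ h r b k x : ℝ, 0 < h → h ≤ h₀ → |r| ≤ R₀ → |b| ≤ R₀ → |k| ≤ R →
      0 ≤ x → h * x ^ 2 ≤ 1 → 0 ≤ langerAmp h (3 / 10 + h * M) 10 x →
      z ≤ langerPhase h r b k x → (1 ≤ x → z + 1 / 2 ≤ langerPhase h r b k x) →
      (-h ^ 3 + r * h ^ 4 + (b - 8 * r ^ 2 / 15) * h ^ 5 - C * h ^ 6)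
          * langerU f h r b k (3 / 10 + h * M) 10 x ≤
        langerU f h r b k (3 / 10 + h * M) 10 (x - h ^ 2)
          - 2 * langerU f h r b k (3 / 10 + h * M) 10 x
          + (1 - h ^ 3 / (1 - h * x + h ^ 3)) * langerU f h r b k (3 / 10 + h * M) 10 (x + h ^ 2)
         := by
  obtain ⟨C₀, hC₀, hcons⟩ := langer_consistency R (by linarith)
  have hM0 : 0 < M := by linarith
  set c₂ := c₁ * (1 + 5000 * (1 + R)) with hc₂
  have hc₂0 : 0 ≤ c₂ := by positivity
  set X₀ := 2 * M + 2 * R + 200 + 800 * R ^ 3 with hX₀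
  have hX₀0 : 0 < X₀ := by positivity
  set D := (2 * M + 2 * R + 110) * c₂ + 200 * R ^ 3 + 135 + 16 * (1 + c₂) with hD
  refine ⟨2 * D * (1 + X₀) ^ 4, min (min (1 / 40000) (1 / (20 * M)))
    (min (1 / (100 * (1 + R))) (min (1 / (1 + 40 * C₀)) (1 / (20 * (1 + X₀) ^ 4)))),
    by positivity, ?_⟩
  intro h r b k x hh hh₀ hr hb hk hx hhx2 hg0 hz hz1
  have hh₁ : h ≤ 1 / 40000 := hh₀.trans ((min_le_left _ _).trans (min_le_left _ _))
  have hhM : h * M ≤ 1 / 20 := by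
    have := hh₀.trans ((min_le_left _ _).trans (min_le_right _ _))
    rw [le_div_iff₀ (by positivity)] at this
    linarith
  have hhR : h * (1 + R) ≤ 1 / 100 := by
    have := hh₀.trans ((min_le_right _ _).trans (min_le_left _ _))
    rw [le_div_iff₀ (by positivity)] at this
    linarith
  have hhC : h * (1 + 40 * C₀) ≤ 1 := by
    have := hh₀.trans ((min_le_right _ _).trans ((min_le_right _ _).trans (min_le_left _ _)))
    rwa [le_div_iff₀ (by positivity)] at this
  have hhX : h * (20 * (1 + X₀) ^ 4) ≤ 1 := by
    have := hh₀.trans ((min_le_right _ _).trans ((min_le_right _ _).trans (min_le_right _ _)))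
    rwa [le_div_iff₀ (by positivity)] at this
  have hh1 : h ≤ 1 / 2 := by linarith
  have hhx0 : 0 ≤ h * x := by positivity
  -- From `(h * x) ^ 2 = h * (h * x ^ 2) ≤ h ≤ 1 / 40000`.
  have hhx : h * x ≤ 1 / 200 := by
    refine abs_le_of_sq_le_sq' ?_ (by norm_num) |>.2
    have := mul_le_mul_of_nonneg_left hhx2 hh.le
    calc (h * x) ^ 2 = h * (h * x ^ 2) := by ring
      _ ≤ h * 1 := this
      _ ≤ _ := by linarith
  have hhR₀ : h * R₀ ≤ 1 / 100 := by
    have := mul_le_mul_of_nonneg_left hRR hh.le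
    linarith
  have hhM0 : 0 ≤ h * M := by positivity
  have hx4 : 10 * (h ^ 2 * x ^ 4) ≤ 10 := by
    have := pow_le_one₀ (n := 2) (show 0 ≤ h * x ^ 2 by positivity) hhx2
    calc 10 * (h ^ 2 * x ^ 4) = 10 * (h * x ^ 2) ^ 2 := by ring
      _ ≤ 10 := by linarith
  have hNx : 10 * h ^ 2 * (1 + x) ^ 4 ≤ 200 := by
    have h1 : h * (1 + x) ^ 2 ≤ 4 := by
      have : 0 ≤ h * (1 - x) ^ 2 := by positivity
      linarith
    have h2 := pow_le_pow_left₀ (show 0 ≤ h * (1 + x) ^ 2 by positivity) h1 2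
    calc 10 * h ^ 2 * (1 + x) ^ 4 = 10 * (h * (1 + x) ^ 2) ^ 2 := by ring
      _ ≤ 200 := by linarith
  set a := 3 / 10 + h * M with ha
  have ha0 : 0 ≤ a := by linarith
  have ha1 : a ≤ 1 / 2 := by rw [ha]; linarith
  have haa : |a| ≤ 1 := by rw [abs_of_nonneg ha0]; linarith
  obtain ⟨err, herr, hUp, hrec⟩ := hcons f f' hf h r b k a 10 x hh (by linarith) (hr.trans hRR)
    (hb.trans hRR) hk haa (by norm_num) hx (by linarith) hNx
  have hrec' := hrec (h ^ 3 / (1 - h * x + h ^ 3))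
  have hbr := langer_phase_bound hR hh (by linarith) (hr.trans hRR) (hb.trans hRR) hk hx
    (by linarith)
  have hpot := potential_two_sided_bound hh (by linarith) hx (by linarith)
  have hphase := langer_bound (a := a) hh (by linarith) (hr.trans hRR) (hb.trans hRR) hk
    haa (by norm_num) hx (by linarith) hNx
  have hyb := hphase.phase x (by rw [sub_self, abs_zero]; positivity)
  rw [langer_phase_identity] at hrec'
  have hax : h * x * a ≤ 1 / 200 * 1 := mul_le_mul hhx (by linarith) ha0 (by norm_num)
  have hg2 : langerAmp h a 10 x ≤ 2 := by
    have : 0 ≤ h ^ 2 * x ^ 4 := by positivity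
    simp only [langerAmp]; linarith
  have hg12 : x ≤ X₀ → 1 / 2 ≤ langerAmp h a 10 x := by
    intro hxX
    have h1 : x ^ 4 ≤ (1 + X₀) ^ 4 := pow_le_pow_left₀ hx (by linarith) 4
    have h2 : h ^ 2 * x ^ 4 ≤ h * (1 + X₀) ^ 4 := by
      refine mul_le_mul ?_ h1 (by positivity) hh.le
      rw [pow_two]
      exact mul_le_of_le_one_left hh.le (by linarith)
    have h3 : 0 ≤ h * a * x := by positivity
    simp only [langerAmp]; linarith
  have hA1 : langerAmp1 h a 10 x = h * a - 40 * h ^ 2 * x ^ 3 := by simp only [langerAmp1]; ring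
  have hA2 : langerAmp2 h 10 x = -120 * h ^ 2 * x ^ 2 := by simp only [langerAmp2]; ring
  have hA0 : langerAmp h a 10 x = 1 + h * a * x - 10 * h ^ 2 * x ^ 4 := rfl
  have hp1 : langerPhase1 h r x = 1 + h * (2 * x / 5 - 4 * r / 15) := rfl
  have hUx : langerU f h r b k a 10 x = langerAmp h a 10 x * f (langerPhase h r b k x) := rfl
  rw [hA1, hA2, hUx] at hrec'
  rw [hA1] at herr
  rw [hUx, hA1] at hUp
  rw [hUx]
  have hF0 := hpos _ hz
  have hdec' := hdec _ hz
  have hinc' := fun h1 => hinc _ (hz1 h1)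
  have hp1b : 9 / 10 ≤ langerPhase1 h r x ∧ langerPhase1 h r x ≤ 11 / 10 := by
    have h1 := abs_le.mp hr
    have h2 := mul_le_mul_of_nonneg_left h1.2 hh.le
    have h3 := mul_le_mul_of_nonneg_left h1.1 hh.le
    rw [hp1]
    constructor <;> linarith
  have hfast' : X₀ ≤ x → f' (langerPhase h r b k x) ≤ -f (langerPhase h r b k x) := by
    intro hxX
    refine hfast _ ?_
    have h1 := abs_le.mp hr
    have h2 := abs_le.mp hb
    have h3 := abs_le.mp hk
    have h4 : -R ≤ k * h ^ 2 := by
      have e1 := mul_le_mul_of_nonneg_right h3.1 (sq_nonneg h)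
      have e2 : R * h ^ 2 ≤ R * 1 :=
        mul_le_mul_of_nonneg_left (pow_le_one₀ hh.le (by linarith)) (by linarith)
      linarith
    have h5 : -(R₀ * x) ≤ -(r * x) := by
      have := mul_le_mul_of_nonneg_right h1.2 hx
      linarith
    have h6 : -(h * (R₀ * x)) ≤ -(h * (r * x)) := by
      have := mul_le_mul_of_nonneg_left h5 hh.le
      linarith
    have h7 : h * R₀ * x ≤ 1 / 100 * x := mul_le_mul_of_nonneg_right hhR₀ hx
    have h8 := mul_le_mul_of_nonneg_left h2.1 hh.le
    have h9 : 0 ≤ h * x ^ 2 := by positivity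
    have h10 : 0 ≤ R ^ 3 := by positivity
    simp only [langerPhase]
    linarith
  set y := langerPhase h r b k x
  set F := f y with hF
  set F' := f' y with hF'
  set g := langerAmp h a 10 x
  set p1 := langerPhase1 h r x
  set Up := langerU f h r b k a 10 (x + h ^ 2)
  set Um := langerU f h r b k a 10 (x - h ^ 2)
  set q := h ^ 3 / (1 - h * x + h ^ 3)
  set Br := (k + 2 * (x ^ 2 / 5 - 4 * r * x / 15 + b) * (2 * x / 5 - 4 * r / 15)
      + (2 * x / 5 - 4 * r / 15) ^ 2 * (x + r)
      + h * (x ^ 2 / 5 - 4 * r * x / 15 + b) * (2 * x / 5 - 4 * r / 15) ^ 2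
      + 2 * h * k * (2 * x / 5 - 4 * r / 15) + h ^ 2 * k * (2 * x / 5 - 4 * r / 15) ^ 2)
  set v := 2 * x / 5 - 4 * r / 15 with hv
  set S := |F| + |F'| with hS
  have hQ : 2 * (h * a - 40 * h ^ 2 * x ^ 3) * p1 + g * (2 * h / 5) - h * g * p1
      = h ^ 2 * (2 * M - 3 / 5 * a * x + 6 * h * x ^ 4 + v * (2 * a - g) - 80 * x ^ 3 * p1) := by
    rw [hA0, hp1, ha]; ring
  have hvb : |v| ≤ x + R₀ := by
    have h1 := abs_le.mp hr
    rw [hv, abs_le]; constructor <;> linarith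
  have hgp1 : |g * p1| ≤ 3 := by
    rw [abs_of_nonneg (mul_nonneg hg0 (by linarith))]
    have := mul_le_mul hg2 hp1b.2 (by linarith) (by norm_num)
    linarith
  have hFa : |F| = F := abs_of_nonneg hF0
  have hg₁ : |h * a - 40 * h ^ 2 * x ^ 3| ≤ 1 := by
    have e1 : h ^ 2 * x ^ 3 ≤ 1 / 200 := by
      calc h ^ 2 * x ^ 3 = (h * x ^ 2) * (h * x) := by ring
        _ ≤ 1 * (1 / 200) := mul_le_mul hhx2 hhx hhx0 (by norm_num)
        _ = _ := by ring
    have e2 : 0 ≤ h ^ 2 * x ^ 3 := by positivity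
    have e3 : 0 ≤ h * a := by positivity
    have e4 : h * a ≤ 1 / 2 := (mul_le_of_le_one_right hh.le (by linarith)).trans hh1
    rw [abs_le]; constructor <;> linarith
  rw [hFa] at hS
  clear_value y g p1 Up Um q Br v
  have hδ := abs_sum_le_of_abs_sub_le hUp
  rw [hS] at hδ herr
  rw [hFa] at herr
  have h6 : 0 < h ^ 6 := pow_pos hh 6
  have hε : |err / h ^ 6| ≤ C₀ * h * (1 + x) * (F + |F'|)
      + 2 * x * (|h * a - 40 * h ^ 2 * x ^ 3| * F + |g * p1| * |F'|) := by
    rw [abs_div, abs_of_pos h6, div_le_iff₀ h6]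
    linarith
  have he : |(q - h ^ 3 * (1 + h * x + h ^ 2 * x ^ 2)) / h ^ 6| ≤ 2 * x ^ 3 + 5 := by
    rw [abs_div, abs_of_pos h6, div_le_iff₀ h6]
    linarith
  have hcase : (0 < F' ∧ x ≤ 1) ∨ (x ≤ X₀ ∧ |F'| ≤ c₂ * (1 + x) * F) ∨ (X₀ ≤ x ∧ F' ≤ -F) := by
    have hc₁₂ : c₁ ≤ c₂ := by
      rw [hc₂]
      exact le_mul_of_one_le_right hc₁ (by linarith)
    rcases le_total X₀ x with h0 | h0
    · exact Or.inr (Or.inr ⟨h0, hfast' h0⟩)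
    rcases le_or_gt F' 0 with h1 | h1
    · right; left
      refine ⟨h0, (hdec' h1).trans ?_⟩
      have e : 1 + |y| ≤ (1 + 5000 * (1 + R)) * (1 + x) := by linarith
      rw [hc₂, mul_assoc c₁ (1 + 5000 * (1 + R))]
      exact mul_le_mul_of_nonneg_right (mul_le_mul_of_nonneg_left e hc₁) hF0
    · rcases le_or_gt x 1 with h2 | h2
      · exact Or.inl ⟨h1, h2⟩
      · right; left
        rw [abs_of_pos h1]
        refine ⟨h0, (hinc' h2.le).trans ?_⟩
        gcongr
        exact hc₁₂.trans (le_mul_of_one_le_right hc₂0 (by linarith))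
  have key := langer_subsolution_aux hh hh1 hx (by linarith) hhx2 hF0 hC₀ hc₂0 ha0 ha1 hg0 hg2
    hg12 hg₁ hgp1 hp1b.1 hp1b.2 hR₀ hR hRR hM hhC hvb hbr hε hδ he hX₀ hcase hD
  have key' := mul_le_mul_of_nonneg_left key h6.le
  have e1 : h ^ 6 * (err / h ^ 6) = err := by field_simp
  have e2 : h ^ 6 * ((q - h ^ 3 * (1 + h * x + h ^ 2 * x ^ 2)) / h ^ 6)
    = q - h ^ 3 * (1 + h * x + h ^ 2 * x ^ 2) := by field_simp
  rw [hQ] at hrec'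
  have e3 : g * F + (Up - g * F) = Up := by ring
  rw [e3] at key'
  clear hε key hcase hδ hUp herr hbr hcons hdec' hinc' hrec he
  have e4 : h ^ 6 * ((-120 * x ^ 2 + g * Br - a + 40 * h * x ^ 3) * F
      + (2 * M - 3 / 5 * a * x + 6 * h * x ^ 4 + v * (2 * a - g) - 80 * x ^ 3 * p1) * F'
      - (q - h ^ 3 * (1 + h * x + h ^ 2 * x ^ 2)) / h ^ 6 * Up + err / h ^ 6)
      = h ^ 4 * ((-120 * h ^ 2 * x ^ 2 + g * (h ^ 2 * Br) - h * (h * a - 40 * h ^ 2 * x ^ 3)) * F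
      + h ^ 2 * (2 * M - 3 / 5 * a * x + 6 * h * x ^ 4 + v * (2 * a - g) - 80 * x ^ 3 * p1) * F')
      - h ^ 6 * ((q - h ^ 3 * (1 + h * x + h ^ 2 * x ^ 2)) / h ^ 6) * Up
      + h ^ 6 * (err / h ^ 6) := by ring
  rw [e4, e1, e2] at key'
  linarith

/-! ### Recessive solutions of the Airy equation. -/

theorem le_of_hasDerivAt_nonneg {F F' : ℝ → ℝ} {s t : ℝ} (hst : s ≤ t)
    (h : ∀ u, HasDerivAt F (F' u) u) (h0 : ∀ u, s < u → u < t → 0 ≤ F' u) : F s ≤ F t := by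
  have : MonotoneOn F (Set.Icc s t) :=
    monotoneOn_of_deriv_nonneg (convex_Icc _ _)
      (fun u _ => (h u).continuousAt.continuousWithinAt)
      (fun u _ => (h u).differentiableAt.differentiableWithinAt) fun u hu => by
        rw [interior_Icc] at hu
        rw [(h u).deriv]; exact h0 u hu.1 hu.2
  exact this (Set.left_mem_Icc.mpr hst) (Set.right_mem_Icc.mpr hst) hst

namespace IsAirySolution

variable {f f' : ℝ → ℝ}

theorem eq_zero_of_eq_zero (hf : IsAirySolution f f') {y : ℝ} (h0 : f y = 0) (h1 : f' y = 0)
    (x : ℝ) : f x = 0 := by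
  have := hf.energy_le (y := y) (ξ := x) (R := max |y| |x|) (fun t ht => by
    rcases Set.mem_uIcc.mp ht with h | h
    · exact abs_le_max_abs_abs h.1 h.2
    · rw [max_comm]; exact abs_le_max_abs_abs h.1 h.2)
  rw [h0, h1] at this
  nlinarith [sq_nonneg (f x), sq_nonneg (f' x)]

theorem hasDerivAt_mul_self (hf : IsAirySolution f f') (t : ℝ) :
    HasDerivAt (fun t => f t * f' t) (f' t ^ 2 + t * f t ^ 2) t := by
  refine ((hf.deriv_fst t).fun_mul (hf.deriv_snd t)).congr_deriv ?_
  ring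

/-- A solution that stays bounded to the right cannot move away from zero. -/
theorem deriv_eq_zero_of_bounded (hf : IsAirySolution f f') {B : ℝ}
    (hB : ∀ y, 0 ≤ y → |f y| ≤ B) {y : ℝ} (hy : 0 ≤ y) (h : 0 ≤ f y * f' y) : f' y = 0 := by
  by_contra hne
  have hm : 0 < f' y ^ 2 := by positivity
  -- Once `f * f'` is nonnegative it remains so, hence `f' ^ 2` does not decrease and `f ^ 2` grows
  -- at least quadratically.
  have k1 : ∀ t, y ≤ t → 0 ≤ f t * f' t := fun t ht =>
    h.trans (le_of_hasDerivAt_nonneg ht hf.hasDerivAt_mul_self fun u hu _ => by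
      have : 0 ≤ u := by linarith
      positivity)
  have k2 : ∀ t, y ≤ t → f' y ^ 2 ≤ f' t ^ 2 := fun t ht => by
    refine le_of_hasDerivAt_nonneg (F := fun t => f' t ^ 2) (F' := fun t => 2 * t * (f t * f' t))
      ht (fun u => ((hf.deriv_snd u).fun_pow 2).congr_deriv (by push_cast; ring)) fun u hu _ => ?_
    have := k1 u hu.le
    have : 0 ≤ u := by linarith
    positivity
  have k3 : ∀ t, y ≤ t → f' y ^ 2 * (t - y) ≤ f t * f' t := fun t ht => by
    have := le_of_hasDerivAt_nonneg (F := fun t => f t * f' t - f' y ^ 2 * (t - y))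
      (F' := fun t => f' t ^ 2 + t * f t ^ 2 - f' y ^ 2 * 1) ht
      (fun u => (hf.hasDerivAt_mul_self u).fun_sub
        (((hasDerivAt_id u).sub_const y).const_mul (f' y ^ 2))) fun u hu _ => by
          have h1 := k2 u hu.le
          have h2 : 0 ≤ u * f u ^ 2 := by
            have : 0 ≤ u := by linarith
            positivity
          linarith
    simp only [sub_self, mul_zero, sub_zero] at this
    linarith
  have k4 : ∀ t, y ≤ t → f' y ^ 2 * (t - y) ^ 2 ≤ f t ^ 2 := fun t ht => by
    have := le_of_hasDerivAt_nonneg (F := fun t => f t ^ 2 - f' y ^ 2 * (t - y) ^ 2)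
      (F' := fun t => 2 * (f t * f' t) - f' y ^ 2 * (2 * (t - y))) ht
      (fun u => (((hf.deriv_fst u).fun_pow 2).fun_sub
        ((((hasDerivAt_id u).sub_const y).fun_pow 2).const_mul (f' y ^ 2))).congr_deriv (by
          simp; ring)) fun u hu _ => by
          have := k3 u hu.le
          linarith
    simp only [sub_self, ne_eq, OfNat.ofNat_ne_zero, not_false_eq_true, zero_pow, mul_zero,
      sub_zero] at this
    nlinarith [sq_nonneg (f y)]
  have hB0 : 0 ≤ B := (abs_nonneg _).trans (hB y hy)
  set T := (B + 1) / |f' y| with hT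
  have ha : 0 < |f' y| := abs_pos.mpr hne
  have hT0 : 0 ≤ T := by positivity
  have h5 := k4 (y + T) (by linarith)
  have h6 : f' y ^ 2 * (y + T - y) ^ 2 = (B + 1) ^ 2 := by
    rw [← sq_abs (f' y), hT]; field_simp; ring
  have h7 := hB (y + T) (by linarith)
  rw [h6, ← sq_abs (f _)] at h5
  nlinarith [abs_nonneg (f (y + T))]

end IsAirySolution

/-- A solution of the Airy equation that is bounded to the right and positive at `1`. -/
structure IsRecessiveAiry (f f' : ℝ → ℝ) : Prop extends IsAirySolution f f' where
  bounded : ∃ B, ∀ y, 0 ≤ y → |f y| ≤ B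
  pos_one : 0 < f 1

namespace IsRecessiveAiry

variable {f f' : ℝ → ℝ}

/-- Otherwise boundedness makes `f'` vanish from `y` on, the equation makes `f` vanish, and
uniqueness contradicts `0 < f 1`. -/
theorem mul_deriv_neg (hf : IsRecessiveAiry f f') {y : ℝ} (hy : 0 ≤ y) : f y * f' y < 0 := by
  obtain ⟨B, hB⟩ := hf.bounded
  by_contra hcon
  push Not at hcon
  have hall : ∀ t, y ≤ t → f' t = 0 := fun t ht => by
    refine hf.deriv_eq_zero_of_bounded hB (hy.trans ht) (hcon.trans ?_)
    exact le_of_hasDerivAt_nonneg ht hf.hasDerivAt_mul_self fun u hu _ => by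
      have : 0 ≤ u := by linarith
      positivity
  have h1 : (y + 1) * f (y + 1) = 0 := by
    have h2 : HasDerivAt f' 0 (y + 1) := by
      refine (hasDerivAt_const (y + 1) (0 : ℝ)).congr_of_eventuallyEq ?_
      filter_upwards [lt_mem_nhds (show y < y + 1 by linarith)] with t ht
      exact hall t ht.le
    exact (hf.deriv_snd (y + 1)).unique h2
  have h3 : f (y + 1) = 0 := (mul_eq_zero.mp h1).resolve_left (by linarith)
  have := hf.eq_zero_of_eq_zero h3 (hall _ (by linarith)) 1
  linarith [hf.pos_one]

theorem continuous (hf : IsRecessiveAiry f f') : Continuous f :=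
  continuous_iff_continuousAt.mpr fun x => (hf.deriv_fst x).continuousAt

theorem continuous_deriv (hf : IsRecessiveAiry f f') : Continuous f' :=
  continuous_iff_continuousAt.mpr fun x => (hf.deriv_snd x).continuousAt

theorem pos_of_nonneg (hf : IsRecessiveAiry f f') {y : ℝ} (hy : 0 ≤ y) : 0 < f y := by
  by_contra hcon
  push Not at hcon
  have hivt := (isPreconnected_Ici (a := (0 : ℝ))).intermediate_value (f := f) (a := y) (b := 1)
    hy (by simp) hf.continuous.continuousOn
  obtain ⟨t, ht, ht0⟩ := hivt ⟨hcon, hf.pos_one.le⟩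
  have := hf.mul_deriv_neg ht
  rw [ht0, zero_mul] at this
  exact lt_irrefl _ this

theorem deriv_neg (hf : IsRecessiveAiry f f') {y : ℝ} (hy : 0 ≤ y) : f' y < 0 :=
  (pos_iff_neg_of_mul_neg (hf.mul_deriv_neg hy)).mp (hf.pos_of_nonneg hy)

/-- The derivative cannot have a fixed positive growth rate. -/
theorem false_of_le_second_deriv (hf : IsRecessiveAiry f f') {y c : ℝ} (hy : 0 ≤ y) (hc : 0 < c)
    (h : ∀ t, y ≤ t → c ≤ t * f t) : False := by
  set T := (1 - f' y) / c with hT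
  have hn := hf.deriv_neg hy
  have hT0 : 0 ≤ T := div_nonneg (by linarith) hc.le
  have := le_of_hasDerivAt_nonneg (F := fun t => f' t - c * t) (F' := fun t => t * f t - c * 1)
    (show y ≤ y + T by linarith)
    (fun u => (hf.deriv_snd u).fun_sub ((hasDerivAt_id u).const_mul c)) fun u hu _ => by
      have := h u hu.le
      linarith
  have h2 := hf.deriv_neg (y := y + T) (by linarith)
  have h3 : c * T = 1 - f' y := by rw [hT]; field_simp
  linarith

/-- Beyond 1 the function `(f' + f) * exp (-t)` increases. If `f' + f` were positive at `y` it would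
stay above that value, so `f'' = t * f` would be bounded below by a positive constant, which `f' <
0` forbids. -/
theorem deriv_le_neg (hf : IsRecessiveAiry f f') {y : ℝ} (hy : 1 ≤ y) : f' y ≤ -f y := by
  by_contra hcon
  push Not at hcon
  have hg : ∀ t, y ≤ t → f' y + f y ≤ f' t + f t := fun t ht => by
    have := le_of_hasDerivAt_nonneg (F := fun t => (f' t + f t) * Real.exp (-t))
      (F' := fun t => ((t - 1) * f t) * Real.exp (-t)) ht (fun u => by
        refine (((hf.deriv_snd u).fun_add (hf.deriv_fst u)).fun_mul
          (hasDerivAt_neg u).exp).congr_deriv ?_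
        ring) fun u hu _ => by
          have := hf.pos_of_nonneg (y := u) (by linarith)
          have := Real.exp_pos (-u)
          have : 0 ≤ u - 1 := by linarith
          positivity
    have h1 : f' y + f y ≤ (f' t + f t) * (Real.exp (-t) / Real.exp (-y)) := by
      rw [← mul_div_assoc, le_div_iff₀ (Real.exp_pos _)]; exact this
    rw [← Real.exp_sub] at h1
    have h2 : Real.exp (-t - -y) ≤ 1 := Real.exp_le_one_iff.mpr (by linarith)
    have h3 : 0 < f' t + f t := by
      by_contra h4
      push Not at h4
      have := mul_nonpos_of_nonpos_of_nonneg h4 (Real.exp_pos (-t - -y)).le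
      linarith
    exact h1.trans (mul_le_of_le_one_right h3.le h2)
  refine hf.false_of_le_second_deriv (y := y) (c := f' y + f y) (by linarith) (by linarith)
    fun t ht => ?_
  have h1 := hg t ht
  have h2 := hf.deriv_neg (y := t) (by linarith)
  have h3 := hf.pos_of_nonneg (y := t) (by linarith)
  nlinarith

/-- The integrating factor `exp (-(t + 1) ^ 2 / 2)` shows that `f' + (t + 1) * f`, once negative,
stays below that value; then `f` would reach 0 in finite time. -/
theorem neg_deriv_le (hf : IsRecessiveAiry f f') {y : ℝ} (hy : 0 ≤ y) : -f' y ≤ (y + 1) * f y := by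
  by_contra hcon
  push Not at hcon
  set c := f' y + (y + 1) * f y with hc
  have hc0 : c < 0 := by linarith
  have hg : ∀ t, y ≤ t → f' t + (t + 1) * f t ≤ c := fun t ht => by
    have := le_of_hasDerivAt_nonneg
      (F := fun t => -(f' t + (t + 1) * f t) * Real.exp (-((t + 1) ^ 2 / 2)))
      (F' := fun t => ((t + 1) * t * f t) * Real.exp (-((t + 1) ^ 2 / 2))) ht (fun u => by
        refine ((((hf.deriv_snd u).fun_add
          (((hasDerivAt_id u).add_const 1).fun_mul (hf.deriv_fst u))).fun_neg).fun_mul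
          (((((hasDerivAt_id u).add_const 1).fun_pow 2).div_const 2).fun_neg).exp).congr_deriv ?_
        simp; ring) fun u hu _ => by
          have := hf.pos_of_nonneg (y := u) (by linarith)
          have := Real.exp_pos (-((u + 1) ^ 2 / 2))
          have : 0 ≤ u := by linarith
          positivity
    have h1 : -c ≤ -(f' t + (t + 1) * f t)
        * (Real.exp (-((t + 1) ^ 2 / 2)) / Real.exp (-((y + 1) ^ 2 / 2))) := by
      rw [← mul_div_assoc, le_div_iff₀ (Real.exp_pos _)]; exact this
    rw [← Real.exp_sub] at h1
    have h2 : Real.exp (-((t + 1) ^ 2 / 2) - -((y + 1) ^ 2 / 2)) ≤ 1 :=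
      Real.exp_le_one_iff.mpr (by nlinarith)
    have h3 : 0 < -(f' t + (t + 1) * f t) := by
      by_contra h4
      push Not at h4
      have := mul_nonpos_of_nonpos_of_nonneg h4
        (Real.exp_pos (-((t + 1) ^ 2 / 2) - -((y + 1) ^ 2 / 2))).le
      linarith
    linarith [mul_le_of_le_one_right h3.le h2]
  set T := f y / -c with hT
  have hfy := hf.pos_of_nonneg hy
  have hT0 : 0 ≤ T := div_nonneg hfy.le (by linarith)
  have h1 := le_of_hasDerivAt_nonneg (F := fun t => c * t - f t) (F' := fun t => c * 1 - f' t)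
    (show y ≤ y + T by linarith)
    (fun u => ((hasDerivAt_id u).const_mul c).fun_sub (hf.deriv_fst u)) fun u hu _ => by
      have h2 := hg u hu.le
      have h3 := hf.pos_of_nonneg (y := u) (by linarith)
      have : 0 ≤ (u + 1) * f u := mul_nonneg (by linarith) h3.le
      linarith
  have h2 := hf.pos_of_nonneg (y := y + T) (by linarith)
  have h3 : -c * T = f y := by rw [hT]; exact mul_div_cancel₀ _ (by linarith)
  linarith

theorem hasDerivAt_energy (hf : IsRecessiveAiry f f') (y : ℝ) :
    HasDerivAt (fun y => f' y ^ 2 - y * f y ^ 2) (-(f y ^ 2)) y := by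
  refine (((hf.deriv_snd y).fun_pow 2).fun_sub
    ((hasDerivAt_id y).fun_mul ((hf.deriv_fst y).fun_pow 2))).congr_deriv ?_
  simp; ring

theorem energy_antitone (hf : IsRecessiveAiry f f') {s t : ℝ} (hst : s ≤ t) :
    f' t ^ 2 - t * f t ^ 2 ≤ f' s ^ 2 - s * f s ^ 2 := by
  have := le_of_hasDerivAt_nonneg (F := fun y => -(f' y ^ 2 - y * f y ^ 2))
    (F' := fun y => - -(f y ^ 2)) hst (fun u => (hf.hasDerivAt_energy u).fun_neg)
    fun u _ _ => by rw [neg_neg]; positivity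
  linarith

/-- The energy has derivative `-f ^ 2`. If it were ever nonpositive on the right half-line it would
later be below some `-ε`, so `t * f ^ 2 ≥ ε`, and with `f ≤ B` the second derivative would stay
above `ε / B`. -/
theorem energy_pos (hf : IsRecessiveAiry f f') (y : ℝ) : 0 < f' y ^ 2 - y * f y ^ 2 := by
  suffices h : ∀ y, 0 ≤ y → 0 < f' y ^ 2 - y * f y ^ 2 by
    rcases le_total 0 y with hy | hy
    · exact h y hy
    · exact (h 0 le_rfl).trans_le (hf.energy_antitone hy)
  intro y hy
  obtain ⟨B, hB⟩ := hf.bounded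
  by_contra hcon
  push Not at hcon
  have h1 : f' (y + 1) ^ 2 - (y + 1) * f (y + 1) ^ 2 < 0 := by
    have hanti : StrictAntiOn (fun y => f' y ^ 2 - y * f y ^ 2) (Set.Icc y (y + 1)) :=
      strictAntiOn_of_deriv_neg (convex_Icc _ _)
        (fun u _ => (hf.hasDerivAt_energy u).continuousAt.continuousWithinAt) fun u hu => by
          rw [interior_Icc] at hu
          rw [(hf.hasDerivAt_energy u).deriv]
          have := hf.pos_of_nonneg (y := u) (by linarith [hu.1])
          have : 0 < f u ^ 2 := by positivity
          linarith
    exact (hanti (by simp) (by simp) (by linarith : y < y + 1)).trans_le hcon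
  set ε := -(f' (y + 1) ^ 2 - (y + 1) * f (y + 1) ^ 2) with hε
  have hB0 : 0 < B := (hf.pos_one).trans_le ((le_abs_self _).trans (hB 1 zero_le_one))
  refine hf.false_of_le_second_deriv (y := y + 1) (c := ε / B) (by linarith)
    (div_pos (by linarith) hB0) fun t ht => ?_
  have h2 := hf.energy_antitone ht
  have h3 := hf.pos_of_nonneg (y := t) (by linarith)
  have h4 := (le_abs_self _).trans (hB t (by linarith))
  rw [div_le_iff₀ hB0]
  have h5 : ε ≤ t * f t ^ 2 := by
    have := sq_nonneg (f' t)
    linarith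
  have h6 : t * f t * f t ≤ t * f t * B :=
    mul_le_mul_of_nonneg_left h4 (mul_nonneg (by linarith) h3.le)
  linarith

end IsRecessiveAiry

theorem sub_le_mul_of_deriv_le {F F' : ℝ → ℝ} {s t m : ℝ} (hst : s ≤ t)
    (h : ∀ u, HasDerivAt F (F' u) u) (h0 : ∀ u, s < u → u < t → F' u ≤ m) :
    F t - F s ≤ m * (t - s) := by
  have := le_of_hasDerivAt_nonneg (F := fun u => m * u - F u) (F' := fun u => m * 1 - F' u) hst
    (fun u => ((hasDerivAt_id u).const_mul m).fun_sub (h u)) fun u h1 h2 => by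
      have := h0 u h1 h2
      linarith
  linarith

theorem mul_le_sub_of_le_deriv {F F' : ℝ → ℝ} {s t m : ℝ} (hst : s ≤ t)
    (h : ∀ u, HasDerivAt F (F' u) u) (h0 : ∀ u, s < u → u < t → m ≤ F' u) :
    m * (t - s) ≤ F t - F s := by
  have := le_of_hasDerivAt_nonneg (F := fun u => F u - m * u) (F' := fun u => F' u - m * 1) hst
    (fun u => (h u).fun_sub ((hasDerivAt_id u).const_mul m)) fun u h1 h2 => by
      have := h0 u h1 h2
      linarith
  linarith

theorem IsRecessiveAiry.exists_largest_zero {f f' : ℝ → ℝ} (hf : IsRecessiveAiry f f') {α : ℝ}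
    (hα : f α ≤ 0) : ∃ z, α ≤ z ∧ z < 0 ∧ f z = 0 ∧ ∀ y, z < y → 0 < f y := by
  have hα0 : α < 0 := by
    by_contra h
    linarith [hf.pos_of_nonneg (not_lt.mp h)]
  have hzero : ∀ y, y ≤ 0 → f y ≤ 0 → ∃ t ∈ Set.Icc y 0, f t = 0 := fun y hy hfy =>
    intermediate_value_Icc hy hf.continuous.continuousOn ⟨hfy, (hf.pos_of_nonneg le_rfl).le⟩
  have hcomp : IsCompact (Set.Icc α 0 ∩ f ⁻¹' {0}) :=
    isCompact_Icc.inter_right (isClosed_singleton.preimage hf.continuous)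
  obtain ⟨t, ht, ht0⟩ := hzero α hα0.le hα
  obtain ⟨z, ⟨hz, hfz⟩, hmax⟩ := hcomp.exists_isGreatest ⟨t, ht, ht0⟩
  have hfz' : f z = 0 := hfz
  refine ⟨z, hz.1, lt_of_le_of_ne hz.2 ?_, hfz', fun y hy => ?_⟩
  · rintro rfl
    linarith [hf.pos_of_nonneg le_rfl]
  · by_contra hcon
    push Not at hcon
    have hy0 : y ≤ 0 := by
      by_contra h
      linarith [hf.pos_of_nonneg (not_le.mp h).le]
    obtain ⟨s, hs, hs0⟩ := hzero y hy0 hcon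
    have := hmax ⟨⟨by linarith [hz.1, hs.1], hs.2⟩, hs0⟩
    linarith [hs.1]

/-- A recessive solution of the Airy equation together with its largest zero. -/
structure IsAiryWithZero (f f' : ℝ → ℝ) (z : ℝ) : Prop extends IsRecessiveAiry f f' where
  zero_neg : z < 0
  map_zero : f z = 0
  pos : ∀ y, z < y → 0 < f y

namespace IsAiryWithZero

variable {f f' : ℝ → ℝ} {z : ℝ}

theorem nonneg (hf : IsAiryWithZero f f' z) {y : ℝ} (hy : z ≤ y) : 0 ≤ f y := by
  rcases hy.eq_or_lt with rfl | h
  · exact hf.map_zero.ge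
  · exact (hf.pos y h).le

theorem deriv_antitone (hf : IsAiryWithZero f f' z) {s t : ℝ} (hs : z ≤ s) (hst : s ≤ t)
    (ht : t ≤ 0) : f' t ≤ f' s := by
  have := le_of_hasDerivAt_nonneg (F := fun u => -f' u) (F' := fun u => -(u * f u)) hst
    (fun u => (hf.deriv_snd u).fun_neg) fun u h1 h2 => by
      have := hf.nonneg (y := u) (by linarith)
      nlinarith
  linarith

theorem deriv_zero_pos (hf : IsAiryWithZero f f' z) : 0 < f' z := by
  by_contra hcon
  push Not at hcon
  have := sub_le_mul_of_deriv_le hf.zero_neg.le hf.deriv_fst (m := 0) fun u h1 h2 =>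
    (hf.deriv_antitone le_rfl h1.le h2.le).trans hcon
  linarith [hf.map_zero, hf.pos 0 hf.zero_neg]

/-- Left of the origin `f` is concave. Once `f'` is nonpositive, both `f` and `f'` decrease up to 0,
so the estimate at 0 carries over. -/
theorem abs_deriv_le (hf : IsAiryWithZero f f' z) (y : ℝ) (hy : z ≤ y) (h : f' y ≤ 0) :
    |f' y| ≤ 2 * (1 + |y|) * f y := by
  rw [abs_of_nonpos h]
  have hn := hf.nonneg hy
  rcases le_total 0 y with hy0 | hy0
  · rw [abs_of_nonneg hy0]
    have := hf.neg_deriv_le hy0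
    nlinarith
  · have h1 := hf.deriv_antitone hy hy0 le_rfl
    have h2 := hf.neg_deriv_le le_rfl
    have h3 := sub_le_mul_of_deriv_le hy0 hf.deriv_fst (m := 0) fun u h1 h2 =>
      (hf.deriv_antitone hy h1.le h2.le).trans h
    have h4 : f y ≤ (1 + |y|) * f y := le_mul_of_one_le_left hn (by linarith [abs_nonneg y])
    linarith

theorem deriv_mul_sub_le (hf : IsAiryWithZero f f' z) {y : ℝ} (hy : z ≤ y) (hy0 : y ≤ 0) :
    f' y * (y - z) ≤ f y := by
  have := mul_le_sub_of_le_deriv hy hf.deriv_fst (m := f' y) fun u h1 h2 =>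
    hf.deriv_antitone h1.le h2.le hy0
  linarith [hf.map_zero]

theorem deriv_le_of_half_le (hf : IsAiryWithZero f f' z) (y : ℝ) (hy : z + 1 / 2 ≤ y) :
    f' y ≤ 2 * f y := by
  have hn := hf.nonneg (y := y) (by linarith)
  rcases le_or_gt (f' y) 0 with h | h
  · linarith
  · have hy0 : y ≤ 0 := by
      by_contra hc
      linarith [hf.deriv_neg (not_le.mp hc).le]
    have := hf.deriv_mul_sub_le (y := y) (by linarith) hy0
    nlinarith

/-- By concavity and `f z = 0` the chord slope `f (z + s) / s` does not increase. It compares the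
first two entries of the test vector when `ρ < 1`. -/
theorem mul_le_mul_of_le (hf : IsAiryWithZero f f' z) {s t : ℝ} (hs : 0 ≤ s) (hst : s ≤ t)
    (ht : z + t ≤ 0) : s * f (z + t) ≤ t * f (z + s) := by
  have h1 := hf.deriv_mul_sub_le (y := z + s) (by linarith) (by linarith)
  have h2 := sub_le_mul_of_deriv_le (F := f) (F' := f') (s := z + s) (t := z + t)
    (m := f' (z + s)) (by linarith) hf.deriv_fst
    fun u h1 h2 => hf.deriv_antitone (by linarith) h1.le (by linarith)
  have h3 := mul_le_mul_of_nonneg_left h2 hs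
  have h4 := mul_le_mul_of_nonneg_left h1 (sub_nonneg.mpr hst)
  nlinarith

theorem hasDerivAt_log_deriv (hf : IsAiryWithZero f f' z) {y : ℝ} (hy : z < y) :
    HasDerivAt (fun y => -(f' y / f y)) ((f' y ^ 2 - y * f y ^ 2) / f y ^ 2) y := by
  refine (((hf.deriv_snd y).fun_div (hf.deriv_fst y) (hf.pos y hy).ne').fun_neg).congr_deriv ?_
  rw [← neg_div]; congr 1; ring

/-- The derivative of `-(f' / f)` is the positive energy divided by `f ^ 2`. Hence the root of `f' /
f = -η / 2` beyond `z` is unique and monotone in η. -/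
theorem log_deriv_strictAnti (hf : IsAiryWithZero f f' z) {s t : ℝ} (hs : z < s) (hst : s < t) :
    f' t / f t < f' s / f s := by
  have : StrictMonoOn (fun y => -(f' y / f y)) (Set.Icc s t) :=
    strictMonoOn_of_deriv_pos (convex_Icc _ _)
      (fun u hu => (hf.hasDerivAt_log_deriv (hs.trans_le hu.1)).continuousAt.continuousWithinAt)
      fun u hu => by
        rw [interior_Icc] at hu
        have h1 := hs.trans hu.1
        rw [(hf.hasDerivAt_log_deriv h1).deriv]
        have := hf.pos u h1
        have := hf.energy_pos u
        positivity
  have h := this (Set.left_mem_Icc.mpr hst.le) (Set.right_mem_Icc.mpr hst.le) hst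
  simp only at h
  linarith

/-- Just right of `z` the function `f' + v * f` is positive. At `v ^ 2` it is nonpositive, because
positive energy there says `(v * f) ^ 2 < f' ^ 2`, while `f' < 0`. -/
theorem exists_deriv_eq (hf : IsAiryWithZero f f' z) (v : ℝ) :
    ∃ y, z < y ∧ f' y = -v * f y := by
  have hc : Continuous fun y => f' y + v * f y :=
    hf.continuous_deriv.add (continuous_const.mul hf.continuous)
  have h1 : ∀ᶠ y in 𝓝[>] z, 0 < f' y + v * f y := by
    refine (hc.tendsto z).mono_left nhdsWithin_le_nhds |>.eventually (lt_mem_nhds ?_)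
    rw [hf.map_zero, mul_zero, add_zero]; exact hf.deriv_zero_pos
  have h2 : ∀ᶠ y in 𝓝[>] z, y < 0 := nhdsWithin_le_nhds (gt_mem_nhds hf.zero_neg)
  obtain ⟨a, ⟨ha, ha0⟩, haz⟩ := ((h1.and h2).and self_mem_nhdsWithin).exists
  have hz : z < a := haz
  have hv : f' (v ^ 2) + v * f (v ^ 2) ≤ 0 := by
    have h3 := hf.energy_pos (v ^ 2)
    have h4 := hf.deriv_neg (sq_nonneg v)
    have h5 := hf.pos_of_nonneg (sq_nonneg v)
    have h6 : v * f (v ^ 2) ≤ |f' (v ^ 2)| := by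
      refine (le_abs_self _).trans (sq_le_sq.mp ?_)
      rw [mul_pow]; linarith
    rw [abs_of_neg h4] at h6
    linarith
  obtain ⟨y, hy, hy0⟩ := intermediate_value_Icc' (ha0.le.trans (sq_nonneg v)) hc.continuousOn
    ⟨hv, ha.le⟩
  refine ⟨y, hz.trans_le hy.1, ?_⟩
  simp only at hy0
  linarith

theorem le_of_deriv_eq (hf : IsAiryWithZero f f' z) {v w s t : ℝ} (hs : z < s) (ht : z < t)
    (hvw : v ≤ w) (h1 : f' s = -v * f s) (h2 : f' t = -w * f t) : s ≤ t := by
  by_contra hcon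
  push Not at hcon
  have := hf.log_deriv_strictAnti ht hcon
  rw [h1, h2, mul_div_cancel_right₀ _ (hf.pos s hs).ne',
    mul_div_cancel_right₀ _ (hf.pos t ht).ne'] at this
  linarith

theorem isGreatest_of_deriv_eq (hf : IsAiryWithZero f f' z) {η r : ℝ} (hr : z < r)
    (h : f' r = -(η / 2) * f r) :
    IsGreatest {s : ℝ | f (s + η ^ 2 / 4) ≠ 0 ∧ f' (s + η ^ 2 / 4) / f (s + η ^ 2 / 4) = -η / 2}
      (r - η ^ 2 / 4) := by
  constructor
  · simp only [Set.mem_setOf_eq, sub_add_cancel]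
    refine ⟨(hf.pos r hr).ne', ?_⟩
    rw [h, mul_div_cancel_right₀ _ (hf.pos r hr).ne']; ring
  · rintro s ⟨hs0, hs⟩
    by_contra hcon
    push Not at hcon
    have h1 : r < s + η ^ 2 / 4 := by linarith
    have := hf.log_deriv_strictAnti hr h1
    rw [hs, h, mul_div_cancel_right₀ _ (hf.pos r hr).ne'] at this
    linarith

/-- At such a root the energy equals `(η ^ 2 / 4 - r) * f r ^ 2`. The sign of `r₁ = r - η ^ 2 / 4`
is what the boundary analysis near load one relies on. -/
theorem sub_neg_of_deriv_eq (hf : IsAiryWithZero f f' z) {η r : ℝ} (hr : z < r)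
    (h : f' r = -(η / 2) * f r) : r - η ^ 2 / 4 < 0 := by
  have h1 := hf.energy_pos r
  rw [h] at h1
  have h2 := hf.pos r hr
  have h3 : 0 < (η ^ 2 / 4 - r) * f r ^ 2 := by nlinarith
  have := pos_of_mul_pos_left h3 (sq_nonneg _)
  linarith

/-- By monotonicity the roots for `|η| ≤ B` lie between those for `-B` and `B`, in a compact
interval to the right of `z`. The bound `c` comes from the energy at the right end. -/
theorem exists_uniform_bounds (hf : IsAiryWithZero f f' z) (B : ℝ) :
    ∃ c R w m M, 0 < c ∧ z < w ∧ 0 < m ∧ ∀ η r, |η| ≤ B → z < r → f' r = -(η / 2) * f r →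
      r - η ^ 2 / 4 ≤ -c ∧ |r| ≤ R ∧ w ≤ r ∧ m ≤ f r ∧ f r ≤ M := by
  obtain ⟨a, haz, ha⟩ := hf.exists_deriv_eq (-B / 2)
  obtain ⟨b, hbz, hb⟩ := hf.exists_deriv_eq (B / 2)
  have hmem : ∀ η r, |η| ≤ B → z < r → f' r = -(η / 2) * f r → r ∈ Set.Icc a b := by
    intro η r hη hr h
    have := abs_le.mp hη
    exact ⟨hf.le_of_deriv_eq haz hr (by linarith) ha h,
      hf.le_of_deriv_eq hr hbz (by linarith) h hb⟩
  rcases le_or_gt a b with hab | hab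
  · obtain ⟨p, hp, hpmin⟩ := isCompact_Icc.exists_isMinOn (Set.nonempty_Icc.mpr hab)
      hf.continuous.continuousOn
    obtain ⟨q, hq, hqmax⟩ := isCompact_Icc.exists_isMaxOn (Set.nonempty_Icc.mpr hab)
      hf.continuous.continuousOn
    have hp0 := hf.pos p (haz.trans_le hp.1)
    have hq0 := hf.pos q (haz.trans_le hq.1)
    have hE := hf.energy_pos b
    refine ⟨(f' b ^ 2 - b * f b ^ 2) / f q ^ 2, max |a| |b|, a, f p, f q, by positivity, haz, hp0,
      fun η r hη hr h => ?_⟩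
    have hm := hmem η r hη hr h
    have hrp := hf.pos r hr
    refine ⟨?_, abs_le_max_abs_abs hm.1 hm.2, hm.1, hpmin hm, hqmax hm⟩
    have h1 := hf.energy_antitone hm.2
    have h2 : f' r ^ 2 - r * f r ^ 2 = (η ^ 2 / 4 - r) * f r ^ 2 := by rw [h]; ring
    have h3 : f r ≤ f q := hqmax hm
    have h4 : f r ^ 2 ≤ f q ^ 2 := pow_le_pow_left₀ hrp.le h3 2
    have h5 := hf.sub_neg_of_deriv_eq hr h
    have h6 : (η ^ 2 / 4 - r) * f r ^ 2 ≤ (η ^ 2 / 4 - r) * f q ^ 2 :=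
      mul_le_mul_of_nonneg_left h4 (by linarith)
    have h7 : (f' b ^ 2 - b * f b ^ 2) / f q ^ 2 ≤ η ^ 2 / 4 - r := by
      rw [div_le_iff₀ (by positivity)]; linarith
    linarith
  -- In this case no η satisfies the hypotheses, and the constants are arbitrary.
  · refine ⟨1, 0, 0, 1, 0, one_pos, hf.zero_neg, one_pos, fun η r hη hr h => ?_⟩
    have := hmem η r hη hr h
    exact absurd (this.1.trans this.2) (not_le.mpr hab)

end IsAiryWithZero

/-! ### From the ansatz to bounds on the decay rate; load below one. -/

theorem langerPhase_zero (h r b k : ℝ) : langerPhase h r b k 0 = r + k * h ^ 2 + h * b := by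
  rw [langerPhase]; ring

theorem langerPhase_zero_add_half_le {h r b k R₀ x : ℝ} (hh : 0 ≤ h) (hhR : h * R₀ ≤ 1)
    (hr : |r| ≤ R₀) (hx : 0 ≤ x) : langerPhase h r b k 0 + x / 2 ≤ langerPhase h r b k x := by
  have h1 : h * r ≤ 1 :=
    (mul_le_mul_of_nonneg_left ((le_abs_self r).trans hr) hh).trans hhR
  have h2 : 0 ≤ h * x ^ 2 := by positivity
  have h3 : h * r * x ≤ 1 * x := mul_le_mul_of_nonneg_right h1 hx
  rw [langerPhase_zero, langerPhase]
  linarith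

theorem one_div_eq_of_cube {K : ℕ} {h : ℝ} (hh : 0 < h) (hK : (K : ℝ) * h ^ 3 = 1) (j : ℕ)
    (hj : j ≤ K) :
    1 / ((K : ℝ) + 1 - j) = h ^ 3 / (1 - h * (j * h ^ 2) + h ^ 3) := by
  have hj' : (j : ℝ) ≤ K := by exact_mod_cast hj
  have h3 : 0 < h ^ 3 := by positivity
  have e : 1 - h * (j * h ^ 2) + h ^ 3 = ((K : ℝ) + 1 - j) * h ^ 3 := by
    linear_combination (-1 : ℝ) * hK
  rw [e, div_mul_eq_div_div_swap, div_self h3.ne']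

namespace IsAiryWithZero

variable {f f' : ℝ → ℝ} {z : ℝ}

/-- The ansatz is sampled at `x = j * h ^ 2` for all `j ≤ K`. Only the inequality at the full queue
depends on the regime of the load, so it is left as a hypothesis. -/
theorem decayRate_le (hf : IsAiryWithZero f f' z) {R₀ R M : ℝ} (hR₀ : 0 ≤ R₀) (hR : 1 ≤ R)
    (hRR : R₀ ≤ R) (hM : 100 + 10 * R₀ ≤ M) :
    ∃ C h₀ : ℝ, 0 < h₀ ∧ ∀ (K : ℕ) (ρ θ h r b k : ℝ), 0 < ρ → IsDecayRate K ρ θ → 0 < h → h ≤ h₀ →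
      (K : ℝ) * h ^ 3 = 1 → |r| ≤ R₀ → |b| ≤ R₀ → |k| ≤ R → z ≤ langerPhase h r b k 0 →
      √ρ * langerU f h r b k (3 / 10 - h * M) 0 (h ^ 2)
        ≤ langerU f h r b k (3 / 10 - h * M) 0 0 →
      θ ≤ -(1 - √ρ) ^ 2
        + √ρ * (-h ^ 3 + r * h ^ 4 + (b - 8 * r ^ 2 / 15) * h ^ 5 + C * h ^ 6) := by
  obtain ⟨C, h₀, hh₀, hC⟩ := langer_supersolution hf.toIsAirySolution (z := z) (c₁ := 2)
    (by norm_num) (fun y hy => hf.nonneg hy) hf.abs_deriv_le hf.deriv_le_of_half_le hR₀ hR hRR hM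
  have hM0 : 0 < M := by linarith
  refine ⟨C, min h₀ (1 / (1 + R₀ + 2 * M)), by positivity, ?_⟩
  intro K ρ θ h r b k hρ hθ hh hhh hK hr hb hk hz hbd
  have hh1 : h * (1 + R₀ + 2 * M) ≤ 1 := by
    rw [← le_div_iff₀ (by positivity)]; exact hhh.trans (min_le_right _ _)
  have hhR : h * R₀ ≤ 1 := by nlinarith
  have hhM : h * M ≤ 1 / 2 := by nlinarith
  have hK0 : 0 < K := by
    rcases Nat.eq_zero_or_pos K with rfl | h0
    · simp at hK
    · exact h0
  have hph : ∀ x, 0 ≤ x → z + x / 2 ≤ langerPhase h r b k x := fun x hx => by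
    linarith [langerPhase_zero_add_half_le (b := b) (k := k) hh.le hhR hr hx]
  have hhx : ∀ j : ℕ, j ≤ K → h * ((j : ℝ) * h ^ 2) ≤ 1 := fun j hj => by
    have hj' : (j : ℝ) ≤ K := by exact_mod_cast hj
    rw [← hK]
    nlinarith [pow_pos hh 3]
  refine hθ.le_of_scaled_supersolution hK0 hρ
    (fun j => langerU f h r b k (3 / 10 - h * M) 0 ((j : ℝ) * h ^ 2)) (fun j h1 h2 => ?_)
    (by simpa using hbd) fun j h1 h2 => ?_
  · have hj : (1 : ℝ) ≤ j := by exact_mod_cast h1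
    have hx : 0 < (j : ℝ) * h ^ 2 := by positivity
    refine mul_pos ?_ (hf.pos _ ?_)
    · have := hhx j h2
      have h3 : h * M * (h * ((j : ℝ) * h ^ 2)) ≤ 1 / 2 * 1 :=
        mul_le_mul hhM this (by positivity) (by norm_num)
      have h4 : 0 ≤ h * ((j : ℝ) * h ^ 2) := by positivity
      rw [langerAmp]
      linarith
    · linarith [hph _ hx.le]
  · have hx : 0 ≤ (j : ℝ) * h ^ 2 := by positivity
    have := hC h r b k _ hh (hhh.trans (min_le_left _ _)) hr hb hk hx (hhx j h2)
      (by linarith [hph _ hx])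
      (by linarith [hph ((j : ℝ) * h ^ 2 + h ^ 2) (by positivity), sq_nonneg h])
      (fun h3 => by linarith [hph _ hx])
    rw [one_div_eq_of_cube hh hK j h2]
    have e1 : ((j - 1 : ℕ) : ℝ) * h ^ 2 = (j : ℝ) * h ^ 2 - h ^ 2 := by
      rw [Nat.cast_sub h1]; push_cast; ring
    have e2 : ((j + 1 : ℕ) : ℝ) * h ^ 2 = (j : ℝ) * h ^ 2 + h ^ 2 := by push_cast; ring
    rw [e1, e2]
    exact this

/-- The vector is cut at the first index where the amplitude is nonpositive; the solution itself is
positive there. -/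
theorem le_decayRate (hf : IsAiryWithZero f f' z) {R₀ R M : ℝ} (hR₀ : 0 ≤ R₀) (hR : 1 ≤ R)
    (hRR : R₀ ≤ R) (hM : 100 + 10 * R₀ ≤ M) :
    ∃ C h₀ : ℝ, 0 < h₀ ∧ ∀ (K : ℕ) (ρ θ h r b k : ℝ), 0 < ρ → IsDecayRate K ρ θ → 0 < h → h ≤ h₀ →
      (K : ℝ) * h ^ 3 = 1 → |r| ≤ R₀ → |b| ≤ R₀ → |k| ≤ R → z ≤ langerPhase h r b k 0 →
      langerU f h r b k (3 / 10 + h * M) 10 0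
        ≤ √ρ * langerU f h r b k (3 / 10 + h * M) 10 (h ^ 2) →
      -(1 - √ρ) ^ 2 + √ρ * (-h ^ 3 + r * h ^ 4 + (b - 8 * r ^ 2 / 15) * h ^ 5 - C * h ^ 6)
        ≤ θ := by
  obtain ⟨C, h₀, hh₀, hC⟩ := langer_subsolution hf.toIsAirySolution (z := z) (c₁ := 2)
    (by norm_num) (fun y hy => hf.nonneg hy) hf.abs_deriv_le hf.deriv_le_of_half_le
    (fun y hy => hf.deriv_le_neg (by linarith)) hR₀ hR hRR hM
  have hM0 : 0 < M := by linarith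
  refine ⟨C, min h₀ (1 / (2 + R₀ + 2 * M)), by positivity, ?_⟩
  intro K ρ θ h r b k hρ hθ hh hhh hK hr hb hk hz hbd
  have hh1 : h * (2 + R₀ + 2 * M) ≤ 1 := by
    rw [← le_div_iff₀ (by positivity)]; exact hhh.trans (min_le_right _ _)
  have hhM0 : 0 < h * M := by positivity
  have hhR0 : 0 ≤ h * R₀ := by positivity
  have hhR : h * R₀ ≤ 1 := by linarith
  have hhM : h * M ≤ 1 / 2 := by linarith
  have hhalf : h ≤ 1 / 2 := by linarith
  have hph : ∀ x, 0 ≤ x → z + x / 2 ≤ langerPhase h r b k x := fun x hx => by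
    linarith [langerPhase_zero_add_half_le (b := b) (k := k) hh.le hhR hr hx]
  set A : ℕ → ℝ := fun j => langerAmp h (3 / 10 + h * M) 10 ((j : ℝ) * h ^ 2) with hA
  -- With `s = h * x ^ 2 > 1` the amplitude would be at most `1 + s - 10 * s ^ 2 < 0`.
  have hsmall : ∀ x, 0 ≤ x → 0 < langerAmp h (3 / 10 + h * M) 10 x → h * x ^ 2 ≤ 1 := by
    intro x hx hamp
    by_contra hcon
    push Not at hcon
    have hx1 : 1 ≤ x := by
      by_contra h1
      push Not at h1
      nlinarith
    rw [langerAmp] at hamp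
    have h1 : h * (3 / 10 + h * M) * x ≤ h * x ^ 2 * 1 := by
      have : h * x * (3 / 10 + h * M) ≤ h * x * x :=
        mul_le_mul_of_nonneg_left (by linarith) (by positivity)
      linarith
    have h2 : h * x ^ 2 ≤ (h * x ^ 2) ^ 2 := by nlinarith
    nlinarith
  have hA1 : 0 < A 1 := by
    simp only [hA, langerAmp, Nat.cast_one, one_mul]
    have h1 : h ^ 2 * (h ^ 2) ^ 4 ≤ (1 / 2) ^ 2 * ((1 / 2) ^ 2) ^ 4 := by gcongr
    have h2 : 0 ≤ h * (3 / 10 + h * M) * h ^ 2 := by positivity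
    norm_num at h1
    linarith
  have hAK : A K ≤ 0 := by
    by_contra hcon
    push Not at hcon
    have h1 := hsmall _ (by positivity) hcon
    have h2 : h * ((K : ℝ) * h ^ 2) ^ 2 * h = 1 := by
      have : h * ((K : ℝ) * h ^ 2) ^ 2 * h = (K * h ^ 3) ^ 2 := by ring
      rw [this, hK, one_pow]
    have h3 := mul_le_mul_of_nonneg_right h1 hh.le
    linarith
  have hK1 : 1 ≤ K := by
    by_contra h0
    have : K = 0 := by omega
    subst this
    simp at hK
  have hex : ∃ j, 1 ≤ j ∧ A j ≤ 0 := ⟨K, hK1, hAK⟩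
  classical
  set L := Nat.find hex with hL
  obtain ⟨hL1, hLA⟩ := Nat.find_spec hex
  have hLK : L ≤ K := Nat.find_min' hex ⟨hK1, hAK⟩
  have hL2 : 2 ≤ L := by
    by_contra h2
    have h3 : L = 1 := by omega
    rw [← hL, h3] at hLA
    linarith
  have hAp : ∀ j, 1 ≤ j → j ≤ L - 1 → 0 < A j := fun j h1 h2 => by
    by_contra hcon
    exact Nat.find_min hex (m := j) (by omega) ⟨h1, not_lt.mp hcon⟩
  have hfp : ∀ j : ℕ, 1 ≤ j → 0 < f (langerPhase h r b k ((j : ℝ) * h ^ 2)) := fun j h1 => by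
    have hj : (1 : ℝ) ≤ j := by exact_mod_cast h1
    have hx : 0 < (j : ℝ) * h ^ 2 := by positivity
    exact hf.pos _ (by linarith [hph _ hx.le])
  refine hθ.ge_of_scaled_subsolution hρ
    (fun j => langerU f h r b k (3 / 10 + h * M) 10 ((j : ℝ) * h ^ 2)) (L - 1) (by omega)
    (by omega) (fun j h1 h2 => mul_pos (hAp j h1 h2) (hfp j h1)) ?_ (by simpa using hbd)
    fun j h1 h2 => ?_
  · have e : L - 1 + 1 = L := by omega
    rw [e]
    exact mul_nonpos_of_nonpos_of_nonneg hLA (hfp L hL1).le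
  · have hx : 0 ≤ (j : ℝ) * h ^ 2 := by positivity
    have hAj := hAp j h1 h2
    have := hC h r b k _ hh (hhh.trans (min_le_left _ _)) hr hb hk hx (hsmall _ hx hAj) hAj.le
      (by linarith [hph _ hx]) (fun h3 => by linarith [hph _ hx])
    rw [one_div_eq_of_cube hh hK j (by omega)]
    have e1 : ((j - 1 : ℕ) : ℝ) * h ^ 2 = (j : ℝ) * h ^ 2 - h ^ 2 := by
      rw [Nat.cast_sub h1]; push_cast; ring
    have e2 : ((j + 1 : ℕ) : ℝ) * h ^ 2 = (j : ℝ) * h ^ 2 + h ^ 2 := by push_cast; ring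
    rw [e1, e2]
    exact this

/-- The expansion of the decay rate for a fixed load below one. -/
theorem decayRate_expansion_of_lt_one (hf : IsAiryWithZero f f' z) {ρ : ℝ} (hρ : 0 < ρ)
    (hρ1 : ρ < 1) : ∃ C h₀ : ℝ, 0 < h₀ ∧ ∀ (K : ℕ) (θ h : ℝ), IsDecayRate K ρ θ → 0 < h → h ≤ h₀ →
      (K : ℝ) * h ^ 3 = 1 →
      |θ - (-(1 - √ρ) ^ 2 + √ρ * (-h ^ 3 + z * h ^ 4 + (-8 * z ^ 2 / 15) * h ^ 5))|
        ≤ C * h ^ 6 := by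
  set s := √ρ with hs
  have hs0 : 0 < s := Real.sqrt_pos.mpr hρ
  have hs1 : s < 1 := by
    rw [hs, Real.sqrt_lt' one_pos]; linarith
  clear_value s
  -- The phase shift `κ * h ^ 2` makes the first two values roughly proportional to `κ` and `κ + 1`,
  -- so the boundary inequality needs `s * (κ + 1) < κ`.
  set κ := 2 / (1 - s) with hκ
  have hκ0 : 0 < κ := div_pos two_pos (by linarith)
  have hκs : s * (κ + 1) < κ := by
    have : κ * (1 - s) = 2 := div_mul_cancel₀ _ (by linarith)
    nlinarith
  set R := |z| + κ + 1 with hR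
  have hz0 := abs_nonneg z
  obtain ⟨C₁, h₁, hh₁, hup⟩ := hf.decayRate_le (R₀ := |z|) (R := R) (M := 100 + 10 * |z|) hz0
    (by linarith) (by linarith) le_rfl
  obtain ⟨C₂, h₂, hh₂, hlow⟩ := hf.le_decayRate (R₀ := |z|) (R := R) (M := 100 + 10 * |z|) hz0
    (by linarith) (by linarith) le_rfl
  have hev : ∀ᶠ h : ℝ in 𝓝[>] 0, s * (1 + h ^ 3) * (κ + 1 + h ^ 3 + |z| * h) < κ
      ∧ z + h ^ 2 * (κ + 1 + h ^ 3 + |z| * h) < 0 := by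
    refine nhdsWithin_le_nhds (Filter.Eventually.and ?_ ?_)
    · have : Continuous fun h : ℝ => s * (1 + h ^ 3) * (κ + 1 + h ^ 3 + |z| * h) := by fun_prop
      exact (this.tendsto 0).eventually (gt_mem_nhds (by simpa using hκs))
    · have : Continuous fun h : ℝ => z + h ^ 2 * (κ + 1 + h ^ 3 + |z| * h) := by fun_prop
      exact (this.tendsto 0).eventually (gt_mem_nhds (by simpa using hf.zero_neg))
  obtain ⟨h₃, hh₃, hev⟩ := mem_nhdsGT_iff_exists_Ioc_subset.mp hev
  have hh₃' : 0 < h₃ := hh₃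
  refine ⟨s * (|C₁| + |C₂|), min (min h₁ h₂) (min h₃ (1 / (2 + |z|))), by positivity,
    fun K θ h hθ hh hhh hK => ?_⟩
  have a1 : h ≤ h₁ := hhh.trans ((min_le_left _ _).trans (min_le_left _ _))
  have a2 : h ≤ h₂ := hhh.trans ((min_le_left _ _).trans (min_le_right _ _))
  have a3 : h ≤ h₃ := hhh.trans ((min_le_right _ _).trans (min_le_left _ _))
  have a4 : h * (2 + |z|) ≤ 1 := by
    rw [← le_div_iff₀ (by positivity)]
    exact hhh.trans ((min_le_right _ _).trans (min_le_right _ _))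
  have a5 : h * |z| ≤ 1 := by nlinarith
  have a6 : h ≤ 1 / 2 := by nlinarith
  obtain ⟨b1, b2⟩ := hev ⟨hh, a3⟩
  have hh2 : 0 < h ^ 2 := by positivity
  -- Without a phase shift the value at the boundary is `f z = 0`, so the subsolution inequality
  -- there only needs a nonnegative next value.
  have hlow' := hlow K ρ θ h z 0 0 hρ hθ hh a2 hK le_rfl (by simp)
    (by simp; linarith) (by rw [langerPhase_zero]; simp) (by
      rw [langerU, langerPhase_zero]
      simp only [zero_mul, add_zero, mul_zero, hf.map_zero, ← hs]
      refine mul_nonneg hs0.le (mul_nonneg ?_ (hf.nonneg ?_))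
      · have h1 : h ^ 2 * (h ^ 2) ^ 4 ≤ (1 / 2) ^ 2 * ((1 / 2) ^ 2) ^ 4 := by gcongr
        have h2 : 0 ≤ h * (3 / 10 + h * (100 + 10 * |z|)) * h ^ 2 := by positivity
        norm_num at h1
        rw [langerAmp]
        linarith
      · have := langerPhase_zero_add_half_le (b := 0) (k := 0) hh.le a5 le_rfl hh2.le
        rw [langerPhase_zero] at this
        linarith)
  have hup' := hup K ρ θ h z 0 κ hρ hθ hh a1 hK le_rfl (by simp)
    (by rw [abs_of_pos hκ0]; linarith) (by rw [langerPhase_zero]; nlinarith) (by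
      set δ := h ^ 3 / 5 - 4 * z * h / 15 with hδ
      have hh3 : 0 < h ^ 3 := by positivity
      have hzh : |z| * h = -(z * h) := by rw [abs_of_neg hf.zero_neg]; ring
      have hzh0 : 0 ≤ |z| * h := by positivity
      have hδ0 : 0 ≤ δ := by linarith
      have hδ1 : δ ≤ h ^ 3 + |z| * h := by linarith
      have e1 : langerPhase h z 0 κ (h ^ 2) = z + h ^ 2 * (κ + 1 + δ) := by
        rw [langerPhase, hδ]; ring
      have e2 : langerPhase h z 0 κ 0 = z + h ^ 2 * κ := by rw [langerPhase_zero]; ring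
      have ht : h ^ 2 * (κ + 1 + δ) ≤ h ^ 2 * (κ + 1 + h ^ 3 + |z| * h) :=
        mul_le_mul_of_nonneg_left (by linarith) hh2.le
      have hc := hf.mul_le_mul_of_le (s := h ^ 2 * κ) (t := h ^ 2 * (κ + 1 + δ)) (by positivity)
        (mul_le_mul_of_nonneg_left (by linarith) hh2.le) (by linarith)
      have hc' : κ * f (z + h ^ 2 * (κ + 1 + δ)) ≤ (κ + 1 + δ) * f (z + h ^ 2 * κ) := by
        rw [mul_assoc, mul_assoc] at hc
        exact le_of_mul_le_mul_left hc hh2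
      have hf1 : 0 ≤ f (z + h ^ 2 * (κ + 1 + δ)) := hf.nonneg (by
        have : 0 ≤ h ^ 2 * (κ + 1 + δ) := by positivity
        linarith)
      have hf2 : 0 ≤ f (z + h ^ 2 * κ) := hf.nonneg (by
        have : 0 ≤ h ^ 2 * κ := by positivity
        linarith)
      rw [langerU, langerU, e1, e2, ← hs]
      have hamp0 : langerAmp h (3 / 10 - h * (100 + 10 * |z|)) 0 0 = 1 := by simp [langerAmp]
      have hamp1 : langerAmp h (3 / 10 - h * (100 + 10 * |z|)) 0 (h ^ 2) ≤ 1 + h ^ 3 := by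
        have : 0 ≤ h ^ 3 * (h * (100 + 10 * |z|)) := by positivity
        rw [langerAmp]
        linarith
      rw [hamp0, one_mul]
      refine le_of_mul_le_mul_left ?_ hκ0
      calc κ * (s * (langerAmp h (3 / 10 - h * (100 + 10 * |z|)) 0 (h ^ 2)
              * f (z + h ^ 2 * (κ + 1 + δ))))
          ≤ κ * (s * ((1 + h ^ 3) * f (z + h ^ 2 * (κ + 1 + δ)))) := by gcongr
        _ = s * (1 + h ^ 3) * (κ * f (z + h ^ 2 * (κ + 1 + δ))) := by ring
        _ ≤ s * (1 + h ^ 3) * ((κ + 1 + δ) * f (z + h ^ 2 * κ)) := by gcongr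
        _ = s * (1 + h ^ 3) * (κ + 1 + δ) * f (z + h ^ 2 * κ) := by ring
        _ ≤ κ * f (z + h ^ 2 * κ) := by
          refine mul_le_mul_of_nonneg_right (le_trans ?_ b1.le) hf2
          exact mul_le_mul_of_nonneg_left (by linarith) (by positivity))
  rw [← hs] at hup' hlow'
  have hh6 : 0 ≤ s * h ^ 6 := by positivity
  have c1 : s * h ^ 6 * C₁ ≤ s * h ^ 6 * |C₁| := mul_le_mul_of_nonneg_left (le_abs_self _) hh6
  have c2 : s * h ^ 6 * C₂ ≤ s * h ^ 6 * |C₂| := mul_le_mul_of_nonneg_left (le_abs_self _) hh6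
  have c3 : 0 ≤ s * h ^ 6 * |C₁| := by positivity
  have c4 : 0 ≤ s * h ^ 6 * |C₂| := by positivity
  rw [abs_le]
  constructor
  · linarith
  · linarith

end IsAiryWithZero

/-! ### Load near one. -/

theorem Continuous.exists_bound_of_abs_le {n : ℕ} {G : (Fin n → ℝ) → ℝ} (hG : Continuous G)
    (A : ℝ) : ∃ Q, ∀ v, (∀ i, |v i| ≤ A) → |G v| ≤ Q := by
  obtain ⟨Q, hQ⟩ := (isCompact_closedBall (0 : Fin n → ℝ) |A|).exists_bound_of_continuousOn
    hG.continuousOn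
  refine ⟨Q, fun v hv => hQ v ?_⟩
  rw [mem_closedBall_zero_iff, pi_norm_le_iff_of_nonneg (abs_nonneg A)]
  exact fun i => (hv i).trans (le_abs_self A)

theorem exists_eq_mul_of_abs_le_mul {E A X : ℝ} (hX : 0 < X) (h : |E| ≤ A * X) :
    ∃ e, |e| ≤ A ∧ E = X * e := by
  refine ⟨E / X, ?_, (mul_div_cancel₀ E hX.ne').symm⟩
  rwa [abs_div, abs_of_pos hX, div_le_iff₀ hX]

theorem abs_sub_sub_mul_le {U U1 U2 : ℝ → ℝ} {x y B : ℝ} (h1 : ∀ t, HasDerivAt U (U1 t) t)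
    (h2 : ∀ t, HasDerivAt U1 (U2 t) t) (hB : ∀ t ∈ Set.uIcc x y, |U2 t| ≤ B) :
    |U y - U x - (y - x) * U1 x| ≤ B * (y - x) ^ 2 := by
  have hB0 : 0 ≤ B := (abs_nonneg _).trans (hB x Set.left_mem_uIcc)
  have k1 : ∀ u ∈ Set.uIcc x y, |U1 u - U1 x| ≤ B * |y - x| := fun u hu => by
    refine ((convex_uIcc x y).norm_image_sub_le_of_norm_hasDerivWithin_le
      (fun t _ => (h2 t).hasDerivWithinAt) hB Set.left_mem_uIcc hu).trans ?_
    exact mul_le_mul_of_nonneg_left (Set.abs_sub_left_of_mem_uIcc hu) hB0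
  have k0 := (convex_uIcc x y).norm_image_sub_le_of_norm_hasDerivWithin_le
    (f := fun t => U t - t * U1 x) (f' := fun t => U1 t - 1 * U1 x) (C := B * |y - x|)
    (fun t _ => ((h1 t).fun_sub ((hasDerivAt_id t).mul_const (U1 x))).hasDerivWithinAt)
    (fun t ht => by rw [one_mul]; exact k1 t ht) Set.left_mem_uIcc Set.right_mem_uIcc
  rw [Real.norm_eq_abs, Real.norm_eq_abs, mul_assoc, abs_mul_abs_self, ← pow_two] at k0
  convert k0 using 2
  ring

/-- The scaled remainder in the boundary condition at the full queue. -/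
noncomputable def langerBoundaryRemainder (v : Fin 10 → ℝ) : ℝ :=
  let h := v 0
  let η := v 1
  let r := v 2
  let F := v 3
  let δ := v 4
  let e1 := v 5
  let e2 := v 6
  let e3 := v 7
  let e5 := v 8
  let e7 := v 9
  let α := 3 / 10 + h * e7
  let F' := -(η / 2) * F
  let P := F + h * δ * F' + h ^ 2 * e3
  let P' := F' + h * δ * r * F + h ^ 2 * e2
  let w := e5 + η * h * α / 2 + h ^ 3 * α * e5
  4 * r / 15 * (δ * r * F + h * e2) - w * P - (η / 2 + h * α + h ^ 2 * w) * (1 - 4 * r * h / 15 + h ^ 3 / 5) * P'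
    - (1 + η * h ^ 2 / 2 + h ^ 4 * e5) * (1 + h ^ 3 * α) * e1 - η / 2 * e3
    - 3 / 10 * (δ * F' + h * e3) - e7 * P - e2 - h / 5 * P'

/-- Order `h ^ 2` cancels by `f' r = -(η / 2) * f r` and order `h ^ 3` by the choice of `b`. The
parameter `k` acts at order `h ^ 4`, through a term kept apart. Naming all errors as bounded
variables leaves a polynomial identity whose remainder is bounded by compactness. -/
theorem langerBoundaryRemainder_eq {h η r F δ e1 e2 e3 e5 e7 k b P P' : ℝ}
    (hδ : k * h ^ 2 + h * b = h * δ) (hb : b * (r - η ^ 2 / 4) = -(3 / 10 + 2 * r * η / 15))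
    (hP : P = F + h * δ * (-(η / 2) * F) + h ^ 2 * e3)
    (hP' : P' = -(η / 2) * F + h * δ * (r * F) + h ^ 2 * e2) :
    P - (1 + η * h ^ 2 / 2 + h ^ 4 * e5) * ((1 + h ^ 3 * (3 / 10 + h * e7))
        * (P + (h ^ 2 - 4 * r * h ^ 3 / 15 + h ^ 5 / 5) * P' + h ^ 4 * e1))
        + k * h ^ 4 * (r - η ^ 2 / 4) * F
      = h ^ 4 * langerBoundaryRemainder ![h, η, r, F, δ, e1, e2, e3, e5, e7] := by
  have e : k * h ^ 4 * (r - η ^ 2 / 4) * F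
      = h ^ 3 * δ * (r - η ^ 2 / 4) * F + h ^ 3 * (3 / 10 + 2 * r * η / 15) * F := by
    linear_combination h ^ 2 * (r - η ^ 2 / 4) * F * hδ - h ^ 3 * F * hb
  rw [e, hP, hP']
  simp [langerBoundaryRemainder]
  ring

theorem exists_langerBoundaryRemainder_bound (A : ℝ) :
    ∃ Q, ∀ h η r F δ e1 e2 e3 e5 e7 : ℝ, |h| ≤ A → |η| ≤ A → |r| ≤ A → |F| ≤ A → |δ| ≤ A →
      |e1| ≤ A → |e2| ≤ A → |e3| ≤ A → |e5| ≤ A → |e7| ≤ A →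
      |langerBoundaryRemainder ![h, η, r, F, δ, e1, e2, e3, e5, e7]| ≤ Q := by
  have hc : Continuous langerBoundaryRemainder := by
    unfold langerBoundaryRemainder
    fun_prop
  obtain ⟨Q, hQ⟩ := hc.exists_bound_of_abs_le A
  refine ⟨Q, fun h η r F δ e1 e2 e3 e5 e7 g0 g1 g2 g3 g4 g5 g6 g7 g8 g9 => hQ _ ?_⟩
  simp [Fin.forall_fin_succ, *]

/-- The scaled remainder of the expansion of the decay rate near load one. -/
noncomputable def criticalRemainder (v : Fin 6 → ℝ) : ℝ :=
  let h := v 0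
  let η := v 1
  let r := v 2
  let β := v 3
  let e5 := v 4
  let C := v 5
  C * (1 + η * h ^ 2 / 2 + h ^ 4 * e5) + η / 2 * (r + h * β)
    + h * e5 * (-1 + h * r + h ^ 2 * β)
    - η * e5 - h ^ 2 * e5 ^ 2

/-- The square contributes `-η ^ 2 * h ^ 4 / 4` and the factor `√ρ` turns `-h ^ 3` into an extra `-η
* h ^ 5 / 2`. This is how `r` becomes `r₁` and how the coefficient of `h ^ 5` is shifted. -/
theorem criticalRemainder_eq (h η r β e5 C : ℝ) :
    -(1 - (1 + η * h ^ 2 / 2 + h ^ 4 * e5)) ^ 2 + (1 + η * h ^ 2 / 2 + h ^ 4 * e5)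
        * (-h ^ 3 + r * h ^ 4 + β * h ^ 5 + C * h ^ 6)
        - (-h ^ 3 + (r - η ^ 2 / 4) * h ^ 4 + (β - η / 2) * h ^ 5)
      = h ^ 6 * criticalRemainder ![h, η, r, β, e5, C] := by
  simp [criticalRemainder]
  ring

theorem exists_criticalRemainder_bound (A : ℝ) :
    ∃ Q, ∀ h η r β e5 C : ℝ, |h| ≤ A → |η| ≤ A → |r| ≤ A → |β| ≤ A → |e5| ≤ A → |C| ≤ A →
      |criticalRemainder ![h, η, r, β, e5, C]| ≤ Q := by
  have hc : Continuous criticalRemainder := by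
    unfold criticalRemainder
    fun_prop
  obtain ⟨Q, hQ⟩ := hc.exists_bound_of_abs_le A
  refine ⟨Q, fun h η r β e5 C g0 g1 g2 g3 g4 g5 => hQ _ ?_⟩
  simp [Fin.forall_fin_succ, *]

/-- The error is exactly `-(s - 1) ^ 2 / 2`, where `s` is the root. -/
theorem exists_sqrt_one_add_eq {η h B : ℝ} (hη : |η| ≤ B) (hh : 0 < h) (h1 : 0 ≤ 1 + η * h ^ 2) :
    ∃ e, |e| ≤ B ^ 2 ∧ √(1 + η * h ^ 2) = 1 + η * h ^ 2 / 2 + h ^ 4 * e := by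
  set s := √(1 + η * h ^ 2) with hs
  have hs0 : 0 ≤ s := Real.sqrt_nonneg _
  have hss : s ^ 2 = 1 + η * h ^ 2 := Real.sq_sqrt h1
  have k1 : |s - 1| ≤ B * h ^ 2 := by
    have e : (s - 1) * (s + 1) = η * h ^ 2 := by linear_combination hss
    have : |s - 1| * (s + 1) = |η| * h ^ 2 := by
      rw [← abs_of_nonneg (by linarith : 0 ≤ s + 1), ← abs_mul, e, abs_mul,
        abs_of_pos (pow_pos hh 2)]
    have h2 : |η| * h ^ 2 ≤ B * h ^ 2 := mul_le_mul_of_nonneg_right hη (by positivity)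
    have h3 : 0 ≤ |s - 1| * s := by positivity
    linarith
  have k2 : (s - 1) ^ 2 ≤ B ^ 2 * h ^ 4 := by
    rw [← sq_abs]
    calc |s - 1| ^ 2 ≤ (B * h ^ 2) ^ 2 := pow_le_pow_left₀ (abs_nonneg _) k1 2
      _ = B ^ 2 * h ^ 4 := by ring
  obtain ⟨e, he, he'⟩ := exists_eq_mul_of_abs_le_mul (E := -((s - 1) ^ 2) / 2) (A := B ^ 2)
    (pow_pos hh 4) (by
      rw [abs_div, abs_neg, abs_of_nonneg (sq_nonneg (s - 1)), abs_two]
      linarith [sq_nonneg (s - 1)])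
  exact ⟨e, he, by linear_combination he' + hss / 2⟩

namespace IsAiryWithZero

variable {f f' : ℝ → ℝ} {z : ℝ}

theorem exists_bound (hf : IsAiryWithZero f f' z) (L : ℝ) :
    ∃ A, ∀ y, |y| ≤ L → |f y| ≤ A ∧ |f' y| ≤ A ∧ |y * f y| ≤ A ∧ |f y + y * f' y| ≤ A := by
  have h1 := hf.continuous
  have h2 := hf.continuous_deriv
  have hb : ∀ g : ℝ → ℝ, Continuous g → ∃ A, ∀ y, |y| ≤ L → |g y| ≤ A := fun g hg => by
    obtain ⟨A, hA⟩ := (isCompact_Icc (a := -L) (b := L)).exists_bound_of_continuousOn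
      hg.continuousOn
    exact ⟨A, fun y hy => hA y (abs_le.mp hy)⟩
  obtain ⟨A1, hA1⟩ := hb f h1
  obtain ⟨A2, hA2⟩ := hb f' h2
  obtain ⟨A3, hA3⟩ := hb (fun y => y * f y) (continuous_id.mul h1)
  obtain ⟨A4, hA4⟩ := hb (fun y => f y + y * f' y) (h1.add (continuous_id.mul h2))
  refine ⟨max (max A1 A2) (max A3 A4), fun y hy => ⟨?_, ?_, ?_, ?_⟩⟩
  · exact (hA1 y hy).trans ((le_max_left _ _).trans (le_max_left _ _))
  · exact (hA2 y hy).trans ((le_max_right _ _).trans (le_max_left _ _))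
  · exact (hA3 y hy).trans ((le_max_left _ _).trans (le_max_right _ _))
  · exact (hA4 y hy).trans ((le_max_right _ _).trans (le_max_right _ _))

/-- The boundary condition of the Langer approximation near load one, up to fourth order. -/
theorem exists_langer_boundary_bound (hf : IsAiryWithZero f f' z) (B R₀ M N : ℝ) (hR₀ : 1 ≤ R₀) :
    ∃ Q, ∀ κ, ∃ h₀ : ℝ, 0 < h₀ ∧ ∀ h η r b k a : ℝ, 0 < h → h ≤ h₀ → |η| ≤ B → |r| ≤ R₀ →
      |b| ≤ R₀ → |k| ≤ κ → |a| ≤ M → f' r = -(η / 2) * f r →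
      b * (r - η ^ 2 / 4) = -(3 / 10 + 2 * r * η / 15) →
      |langerU f h r b k (3 / 10 + h * a) N 0
          - √(1 + η * h ^ 2) * langerU f h r b k (3 / 10 + h * a) N (h ^ 2)
          + k * h ^ 4 * (r - η ^ 2 / 4) * f r| ≤ Q * h ^ 4 := by
  obtain ⟨A, hA⟩ := hf.exists_bound (2 * R₀ + 4)
  have hA0 : 0 ≤ A := (abs_nonneg _).trans (hA 0 (by simp; linarith)).1
  set D := 4 * A + A * (R₀ + 1) ^ 2 + R₀ + B ^ 2 + |B| + |M| + 10 * |N| + 2 + A with hD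
  have d1 : 0 ≤ A * (R₀ + 1) ^ 2 := by positivity
  have d2 : 0 ≤ B ^ 2 := by positivity
  have d3 := abs_nonneg B
  have d4 := abs_nonneg M
  have d5 := abs_nonneg N
  obtain ⟨Q, hQ⟩ := exists_langerBoundaryRemainder_bound D
  refine ⟨Q, fun κ => ⟨min (1 / 2) (min (1 / (R₀ + 1)) (min (1 / (1 + |κ|)) (1 / (1 + |B|)))),
    by positivity, ?_⟩⟩
  intro h η r b k a hh hhh hη hr hb hk ha hF hbr
  have a1 : h ≤ 1 / 2 := hhh.trans (min_le_left _ _)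
  have a2 : h * (R₀ + 1) ≤ 1 := by
    rw [← le_div_iff₀ (by positivity)]
    exact hhh.trans ((min_le_right _ _).trans (min_le_left _ _))
  have a3 : h * (1 + |κ|) ≤ 1 := by
    rw [← le_div_iff₀ (by positivity)]
    exact hhh.trans ((min_le_right _ _).trans ((min_le_right _ _).trans (min_le_left _ _)))
  have a4 : h * (1 + |B|) ≤ 1 := by
    rw [← le_div_iff₀ (by positivity)]
    exact hhh.trans ((min_le_right _ _).trans ((min_le_right _ _).trans (min_le_right _ _)))
  have hh2 : 0 < h ^ 2 := by positivity
  have hh4 : 0 < h ^ 4 := by positivity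
  have hh2' : h ^ 2 ≤ 1 / 4 := by nlinarith
  have hh3' : h ^ 3 ≤ 1 / 8 := by nlinarith
  have hpos1 : 0 ≤ 1 + η * h ^ 2 := by
    have h1 : |η| * h ^ 2 ≤ 1 := by
      have : |η| * h ≤ 1 := by
        have := mul_le_mul_of_nonneg_left (hη.trans (le_abs_self B)) hh.le
        linarith
      calc |η| * h ^ 2 = |η| * h * h := by ring
        _ ≤ 1 * 1 := mul_le_mul this (by linarith) hh.le zero_le_one
        _ = 1 := one_mul 1
    have h2 : |η * h ^ 2| ≤ 1 := by rwa [abs_mul, abs_of_pos hh2]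
    linarith [(abs_le.mp h2).1]
  obtain ⟨e5, he5, hs⟩ := exists_sqrt_one_add_eq hη hh hpos1
  set δ := k * h + b with hδ
  -- Here `k` enters the remainder only through `k * h`, which is bounded by 1 for small `h`. Hence
  -- `Q` does not depend on `κ`; only `h₀` does.
  have hkh : |k| * h ≤ 1 := by
    have := mul_le_mul_of_nonneg_left (hk.trans (le_abs_self κ)) hh.le
    linarith
  have hδ1 : |δ| ≤ R₀ + 1 := by
    have := abs_add_le (k * h) b
    rw [abs_mul, abs_of_pos hh] at this
    linarith
  set p := r + k * h ^ 2 + h * b with hp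
  have hpr : p - r = h * δ := by rw [hp, hδ]; ring
  have hpr1 : |p - r| ≤ 1 := by
    rw [hpr, abs_mul, abs_of_pos hh]
    exact (mul_le_mul_of_nonneg_left hδ1 hh.le).trans a2
  have hp1 : |p| ≤ R₀ + 1 := by
    have := abs_add_le (p - r) r
    rw [sub_add_cancel] at this
    linarith
  set t := h ^ 2 - 4 * r * h ^ 3 / 15 + h ^ 5 / 5 with ht
  have hrh : |r| * h ≤ 1 := by
    have := mul_le_mul_of_nonneg_right hr hh.le
    linarith
  have ht2 : |t| ≤ 2 * h ^ 2 := by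
    have e : t = h ^ 2 * (1 - 4 / 15 * (r * h) + h ^ 3 / 5) := by rw [ht]; ring
    have h1 : |r * h| ≤ 1 := by rwa [abs_mul, abs_of_pos hh]
    have h2 := abs_le.mp h1
    have h3 : |1 - 4 / 15 * (r * h) + h ^ 3 / 5| ≤ 2 := by
      have : 0 < h ^ 3 := by positivity
      rw [abs_le]
      constructor <;> linarith [h2.1, h2.2]
    rw [e, abs_mul, abs_of_pos hh2, mul_comm]
    exact mul_le_mul_of_nonneg_right h3 hh2.le
  have ht1 : |t| ≤ 1 := ht2.trans (by linarith)
  have hr' := abs_le.mp hr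
  have hp' := abs_le.mp hp1
  have ht' := abs_le.mp ht1
  have hmem : ∀ x y u : ℝ, |x| ≤ R₀ + 2 → |y| ≤ R₀ + 2 → u ∈ Set.uIcc x y → |u| ≤ 2 * R₀ + 4 :=
    fun x y u hx hy hu => by
      have hx' := abs_le.mp hx
      have hy' := abs_le.mp hy
      rw [abs_le]
      rcases Set.mem_uIcc.mp hu with h1 | h1
      · constructor <;> linarith [h1.1, h1.2]
      · constructor <;> linarith [h1.1, h1.2]
  have hpt : |p + t| ≤ R₀ + 2 := (abs_add_le p t).trans (by linarith)
  have hdsq : (p - r) ^ 2 ≤ (R₀ + 1) ^ 2 * h ^ 2 := by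
    rw [hpr, mul_pow, mul_comm, ← sq_abs δ]
    exact mul_le_mul_of_nonneg_right (pow_le_pow_left₀ (abs_nonneg _) hδ1 2) hh2.le
  have htsq : t ^ 2 ≤ 4 * h ^ 4 := by
    rw [← sq_abs]
    calc |t| ^ 2 ≤ (2 * h ^ 2) ^ 2 := pow_le_pow_left₀ (abs_nonneg _) ht2 2
      _ = 4 * h ^ 4 := by ring
  have E1 := abs_sub_sub_mul_le (x := p) (y := p + t) hf.deriv_fst hf.deriv_snd
    (fun u hu => (hA u (hmem _ _ u (by linarith) hpt hu)).2.2.1)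
  have E3 := abs_sub_sub_mul_le (x := r) (y := p) hf.deriv_fst hf.deriv_snd
    (fun u hu => (hA u (hmem _ _ u (by linarith) (by linarith) hu)).2.2.1)
  have E2 := abs_sub_sub_mul_le (x := r) (y := p) hf.deriv_snd
    (fun u => ((hasDerivAt_id u).fun_mul (hf.deriv_fst u)).congr_deriv (by simp))
    (fun u hu => (hA u (hmem _ _ u (by linarith) (by linarith) hu)).2.2.2)
  rw [add_sub_cancel_left] at E1
  obtain ⟨e1, he1, hE1⟩ := exists_eq_mul_of_abs_le_mul (A := 4 * A) hh4
    (E1.trans (by linarith [mul_le_mul_of_nonneg_left htsq hA0]))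
  obtain ⟨e2, he2, hE2⟩ := exists_eq_mul_of_abs_le_mul (A := A * (R₀ + 1) ^ 2) hh2
    (E2.trans (by linarith [mul_le_mul_of_nonneg_left hdsq hA0]))
  obtain ⟨e3, he3, hE3⟩ := exists_eq_mul_of_abs_le_mul (A := A * (R₀ + 1) ^ 2) hh2
    (E3.trans (by linarith [mul_le_mul_of_nonneg_left hdsq hA0]))
  have hfr := (hA r (by linarith)).1
  have he7 : |a - N * h ^ 6| ≤ |M| + |N| := by
    have h1 := abs_sub a (N * h ^ 6)
    have h2 : |N * h ^ 6| ≤ |N| * 1 := by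
      rw [abs_mul, abs_of_pos (pow_pos hh 6)]
      exact mul_le_mul_of_nonneg_left (pow_le_one₀ hh.le (by linarith)) (abs_nonneg N)
    linarith [le_abs_self M]
  have hQ' := hQ h η r (f r) δ e1 e2 e3 e5 (a - N * h ^ 6)
    (by rw [abs_of_pos hh]; linarith) (by linarith [le_abs_self B]) (by linarith) (by linarith)
    (by linarith) (by linarith) (by linarith) (by linarith) (by linarith) (by linarith)
  have key := langerBoundaryRemainder_eq (h := h) (η := η) (r := r) (F := f r) (δ := δ) (e1 := e1)
    (e2 := e2) (e3 := e3) (e5 := e5) (e7 := a - N * h ^ 6) (k := k) (b := b) (P := f p)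
    (P' := f' p) (by rw [hδ]; ring) hbr
    (by rw [hpr, hF] at hE3; linear_combination hE3)
    (by rw [hpr, hF] at hE2; linear_combination hE2)
  have hU0 : langerU f h r b k (3 / 10 + h * a) N 0 = f p := by
    rw [langerU, langerPhase_zero, ← hp]; simp [langerAmp]
  have hU1 : langerU f h r b k (3 / 10 + h * a) N (h ^ 2)
      = (1 + h ^ 3 * (3 / 10 + h * (a - N * h ^ 6))) * (f p + t * f' p + h ^ 4 * e1) := by
    have e : langerPhase h r b k (h ^ 2) = p + t := by rw [langerPhase, hp, ht]; ring
    rw [langerU, e, ← hE1, langerAmp]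
    ring
  rw [hU0, hU1, hs, key, abs_mul, abs_of_pos hh4, mul_comm]
  exact mul_le_mul_of_nonneg_right hQ' hh4.le

end IsAiryWithZero

namespace IsAiryWithZero

variable {f f' : ℝ → ℝ} {z : ℝ}

theorem critical_coefficient {η r₁ b : ℝ} (h0 : r₁ ≠ 0)
    (hb : b = -(3 / 10 + 2 * (r₁ + η ^ 2 / 4) * η / 15) / r₁) :
    b - 8 * (r₁ + η ^ 2 / 4) ^ 2 / 15 - η / 2
      = -((16 * r₁ ^ 3 + 8 * η ^ 2 * r₁ ^ 2 + (η ^ 4 + 19 * η) * r₁ + η ^ 3 + 9) / (30 * r₁)) := by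
  rw [hb]
  field_simp
  ring

set_option maxHeartbeats 1000000 in
/-- The expansion of the decay rate for loads near one. -/
theorem decayRate_expansion_near_one (hf : IsAiryWithZero f f' z) (B : ℝ) :
    ∃ C h₀ : ℝ, 0 < h₀ ∧ ∀ (K : ℕ) (θ h η r₁ : ℝ), |η| ≤ B → z < r₁ + η ^ 2 / 4 →
      f' (r₁ + η ^ 2 / 4) = -(η / 2) * f (r₁ + η ^ 2 / 4) →
      IsDecayRate K (1 + η * h ^ 2) θ → 0 < h → h ≤ h₀ → (K : ℝ) * h ^ 3 = 1 →
      |θ - (-h ^ 3 + r₁ * h ^ 4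
        - (16 * r₁ ^ 3 + 8 * η ^ 2 * r₁ ^ 2 + (η ^ 4 + 19 * η) * r₁ + η ^ 3 + 9) / (30 * r₁)
          * h ^ 5)| ≤ C * h ^ 6 := by
  obtain ⟨c, R₁, w, m, Mf, hc, hzw, hm, hun⟩ := hf.exists_uniform_bounds B
  set R₀ := |R₁| + (1 + |R₁| * |B|) / c + 1 with hR₀
  have q1 := abs_nonneg R₁
  have q2 : 0 ≤ (1 + |R₁| * |B|) / c := by positivity
  have hR₀1 : 1 ≤ R₀ := by linarith
  set M := 100 + 10 * R₀ with hM
  have hM0 : 0 < M := by linarith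
  obtain ⟨Q₁, hQ₁⟩ := hf.exists_langer_boundary_bound B R₀ M 0 hR₀1
  obtain ⟨Q₂, hQ₂⟩ := hf.exists_langer_boundary_bound B R₀ M 10 hR₀1
  -- Chosen after `Q₁` and `Q₂`. As `-r₁ ≥ c` and `f r ≥ m`, the term with `k = ±κ` outweighs both
  -- boundary remainders.
  set κ := (|Q₁| + |Q₂| + 1) / (c * m) with hκ
  have hκ0 : 0 < κ := by positivity
  have hκcm : κ * (c * m) = |Q₁| + |Q₂| + 1 := div_mul_cancel₀ _ (by positivity)
  obtain ⟨t₁, ht₁, hQ₁⟩ := hQ₁ κ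
  obtain ⟨t₂, ht₂, hQ₂⟩ := hQ₂ κ
  obtain ⟨C₁, h₁, hh₁, hup⟩ := hf.decayRate_le (R₀ := R₀) (R := κ + R₀) (M := M) (by linarith)
    (by linarith) (by linarith) hM.ge
  obtain ⟨C₂, h₂, hh₂, hlow⟩ := hf.le_decayRate (R₀ := R₀) (R := κ + R₀) (M := M) (by linarith)
    (by linarith) (by linarith) hM.ge
  set A := 1 + |B| + R₀ + (R₀ + 8 * R₀ ^ 2 / 15) + B ^ 2 + |C₁| + |C₂| with hA
  have p1 := abs_nonneg B
  have p2 : 0 ≤ 8 * R₀ ^ 2 / 15 := by positivity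
  have p3 := sq_nonneg B
  have p4 := abs_nonneg C₁
  have p5 := abs_nonneg C₂
  obtain ⟨Q, hQ⟩ := exists_criticalRemainder_bound A
  refine ⟨Q, min (min (min t₁ t₂) (min h₁ h₂))
    (min (1 / (1 + |B|)) (min (1 / (1 + κ)) ((w - z) / (R₀ + 1)))), ?_, ?_⟩
  · have : 0 < w - z := by linarith
    positivity
  intro K θ h η r₁ hη hzr hF hθ hh hhh hK
  have a1 : h ≤ t₁ := hhh.trans ((min_le_left _ _).trans ((min_le_left _ _).trans (min_le_left _ _)))
  have a2 : h ≤ t₂ :=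
    hhh.trans ((min_le_left _ _).trans ((min_le_left _ _).trans (min_le_right _ _)))
  have a3 : h ≤ h₁ :=
    hhh.trans ((min_le_left _ _).trans ((min_le_right _ _).trans (min_le_left _ _)))
  have a4 : h ≤ h₂ :=
    hhh.trans ((min_le_left _ _).trans ((min_le_right _ _).trans (min_le_right _ _)))
  have hhh' := hhh.trans (min_le_right _ _)
  have a5 : h * (1 + |B|) ≤ 1 := by
    rw [← le_div_iff₀ (by positivity)]; exact hhh'.trans (min_le_left _ _)
  have a6 : h * (1 + κ) ≤ 1 := by
    rw [← le_div_iff₀ (by positivity)]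
    exact hhh'.trans ((min_le_right _ _).trans (min_le_left _ _))
  have a7 : h * (R₀ + 1) ≤ w - z := by
    rw [← le_div_iff₀ (by positivity)]
    exact hhh'.trans ((min_le_right _ _).trans (min_le_right _ _))
  set r := r₁ + η ^ 2 / 4 with hr
  have hr₁ : r - η ^ 2 / 4 = r₁ := by rw [hr]; ring
  clear_value R₀ κ r
  obtain ⟨b1, b2, b3, b4, -⟩ := hun η r hη hzr hF
  rw [hr₁] at b1
  have hr₁0 : r₁ ≠ 0 := by linarith
  set b := -(3 / 10 + 2 * r * η / 15) / r₁ with hb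
  clear_value b
  have hrR : |r| ≤ |R₁| := b2.trans (le_abs_self _)
  have hηB : |η| ≤ |B| := hη.trans (le_abs_self _)
  have hbR : |b| ≤ (1 + |R₁| * |B|) / c := by
    have e1 : |r * η| ≤ |R₁| * |B| := by
      rw [abs_mul]; exact mul_le_mul hrR hηB (abs_nonneg _) q1
    have e2 : |-(3 / 10 + 2 * r * η / 15)| ≤ 1 + |R₁| * |B| := by
      have := abs_le.mp e1
      rw [abs_le]
      constructor <;> linarith [this.1, this.2]
    have e3 : c ≤ |r₁| := by rw [abs_of_neg (by linarith)]; linarith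
    rw [hb, abs_div]
    exact div_le_div₀ (by positivity) e2 hc e3
  have hrR₀ : |r| ≤ R₀ := by linarith
  have hbR₀ : |b| ≤ R₀ := by linarith
  have hbr : b * (r - η ^ 2 / 4) = -(3 / 10 + 2 * r * η / 15) := by
    rw [hr₁, hb, div_mul_cancel₀ _ hr₁0]
  have hh4 : 0 < h ^ 4 := by positivity
  have hh2 : 0 < h ^ 2 := by positivity
  have hh1 : h ≤ 1 := by nlinarith
  have hκh : κ * h ≤ 1 := by nlinarith
  have hpos : 0 < 1 + η * h ^ 2 := by
    have g1 : |η| * h < 1 := by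
      have := mul_le_mul_of_nonneg_left hηB hh.le
      linarith
    have g2 : |η| * h * h ≤ |η| * h * 1 := mul_le_mul_of_nonneg_left hh1 (by positivity)
    have g3 : -(η * h ^ 2) ≤ |η| * h ^ 2 := by
      rw [← neg_mul]; exact mul_le_mul_of_nonneg_right (neg_le_abs η) hh2.le
    linarith
  -- The uniform gap `w - z` absorbs the correction of order `h` to the phase at the boundary.
  have hph : ∀ k, |k| ≤ κ → z ≤ langerPhase h r b k 0 := fun k hk => by
    have g1 : |k * h| ≤ 1 := by
      rw [abs_mul, abs_of_pos hh]
      exact (mul_le_mul_of_nonneg_right hk hh.le).trans hκh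
    have g2 : -(R₀ + 1) ≤ k * h + b := by
      linarith [(abs_le.mp g1).1, (abs_le.mp hbR₀).1]
    have g3 := mul_le_mul_of_nonneg_left g2 hh.le
    rw [langerPhase_zero]
    linarith
  have hgain : (|Q₁| + |Q₂| + 1) * h ^ 4 ≤ κ * h ^ 4 * (-r₁) * f r := by
    have g1 : c * m ≤ -r₁ * f r := mul_le_mul (by linarith) b4 hm.le (by linarith)
    have g2 := mul_le_mul_of_nonneg_left g1 (show 0 ≤ κ * h ^ 4 by positivity)
    rw [← hκcm]
    linarith
  have hQQ₁ : Q₁ * h ^ 4 ≤ (|Q₁| + |Q₂| + 1) * h ^ 4 :=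
    mul_le_mul_of_nonneg_right (by linarith [le_abs_self Q₁, abs_nonneg Q₂]) hh4.le
  have hQQ₂ : Q₂ * h ^ 4 ≤ (|Q₁| + |Q₂| + 1) * h ^ 4 :=
    mul_le_mul_of_nonneg_right (by linarith [le_abs_self Q₂, abs_nonneg Q₁]) hh4.le
  have hκ1 : |κ| ≤ κ := (abs_of_pos hκ0).le
  have hκ2 : |-κ| ≤ κ := by rwa [abs_neg]
  have up := hup K _ θ h r b κ hpos hθ hh a3 hK hrR₀ hbR₀ (by linarith) (hph κ hκ1) (by
    have := hQ₁ h η r b κ (-M) hh a1 hη hrR₀ hbR₀ hκ1 (by rw [abs_neg, abs_of_pos hM0]) hF hbr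
    rw [hr₁, mul_neg, ← sub_eq_add_neg] at this
    linarith [(abs_le.mp this).1])
  have low := hlow K _ θ h r b (-κ) hpos hθ hh a4 hK hrR₀ hbR₀ (by linarith) (hph _ hκ2) (by
    have := hQ₂ h η r b (-κ) M hh a2 hη hrR₀ hbR₀ hκ2 (abs_of_pos hM0).le hF hbr
    rw [hr₁] at this
    linarith [(abs_le.mp this).2])
  obtain ⟨e5, he5, hs⟩ := exists_sqrt_one_add_eq hη hh hpos.le
  set β := b - 8 * r ^ 2 / 15 with hβ
  have hβA : |β| ≤ R₀ + 8 * R₀ ^ 2 / 15 := by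
    have g1 : |8 * r ^ 2 / 15| ≤ 8 * R₀ ^ 2 / 15 := by
      have := pow_le_pow_left₀ (abs_nonneg r) hrR₀ 2
      rw [sq_abs] at this
      rw [abs_of_nonneg (by positivity)]
      linarith
    exact (abs_sub _ _).trans (by linarith)
  have hcoef : β - η / 2
      = -((16 * r₁ ^ 3 + 8 * η ^ 2 * r₁ ^ 2 + (η ^ 4 + 19 * η) * r₁ + η ^ 3 + 9) / (30 * r₁)) := by
    rw [hβ]
    rw [hr] at hb ⊢
    exact critical_coefficient hr₁0 hb
  clear_value β
  rw [hs] at up low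
  have rem : ∀ C, |C| ≤ |C₁| + |C₂| →
      |h ^ 6 * criticalRemainder ![h, η, r, β, e5, C]| ≤ Q * h ^ 6 := fun C hC => by
    rw [abs_mul, abs_of_pos (pow_pos hh 6), mul_comm]
    refine mul_le_mul_of_nonneg_right (hQ _ _ _ _ _ _ ?_ ?_ ?_ ?_ ?_ ?_) (pow_pos hh 6).le
    · rw [abs_of_pos hh]; linarith
    all_goals linarith
  have r1 := (abs_le.mp (rem C₁ (by linarith))).2
  have r2 := (abs_le.mp (rem (-C₂) (by rw [abs_neg]; linarith))).1
  rw [← criticalRemainder_eq, hr₁, hcoef] at r1 r2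
  rw [abs_le]
  constructor
  · linarith
  · linarith

end IsAiryWithZero

/-! ### Load above one. -/

/-- One minus the ratio of consecutive entries of the approximate eigenvector for load above one,
where `α = 1 / (ρ - 1)` and `q = 1 / K`. -/
def overloadDrop (α q y : ℝ) : ℝ :=
  α * y * q ^ 2 + (α * y ^ 2 + α ^ 2 * y) * q ^ 3
    + (α * y ^ 3 - α ^ 3 * y ^ 2 - (2 * α ^ 4 + α ^ 3) * y) * q ^ 4

/-- The approximate decay rate for load above one. -/
def overloadRate (α q : ℝ) : ℝ :=
  -q - α * q ^ 2 - α ^ 2 * q ^ 3 + (2 * α ^ 4 + 2 * α ^ 3 + α ^ 2) * q ^ 4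

theorem overload_coeff_bounds {α : ℝ} (hα : 0 < α) : ∃ A, 0 < A ∧ ∀ n y : ℝ, 1 ≤ n → 0 ≤ y →
    y ≤ 2 * n → |α * y| ≤ A * n ∧ |α * y ^ 2 + α ^ 2 * y| ≤ A * n ^ 2 ∧
      |α * y ^ 3 - α ^ 3 * y ^ 2 - (2 * α ^ 4 + α ^ 3) * y| ≤ A * n ^ 3 := by
  refine ⟨8 * (α + α ^ 2 + 2 * α ^ 3 + 2 * α ^ 4), by positivity, fun n y hn hy hyn => ?_⟩
  have n0 : 0 ≤ n := by linarith
  have n1 : n ≤ n ^ 2 := by nlinarith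
  have n2 : n ^ 2 ≤ n ^ 3 := by nlinarith [sq_nonneg n]
  have y2 : y ^ 2 ≤ 4 * n ^ 2 := by nlinarith
  have y3 : y ^ 3 ≤ 8 * n ^ 3 := by
    calc y ^ 3 ≤ (2 * n) ^ 3 := pow_le_pow_left₀ hy hyn 3
      _ = 8 * n ^ 3 := by ring
  have h2 : 0 < α ^ 2 := by positivity
  have h3 : 0 < α ^ 3 := by positivity
  have h4 : 0 < α ^ 4 := by positivity
  have e1 := mul_le_mul_of_nonneg_left hyn hα.le
  have e2 := mul_le_mul_of_nonneg_left y2 hα.le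
  have e3 := mul_le_mul_of_nonneg_left y3 hα.le
  have e4 := mul_le_mul_of_nonneg_left (hyn.trans (mul_le_mul_of_nonneg_left n1 two_pos.le)) h2.le
  have e5 := mul_le_mul_of_nonneg_left (y2.trans (mul_le_mul_of_nonneg_left n2 four_pos.le)) h3.le
  have e6 := mul_le_mul_of_nonneg_left
    (hyn.trans (mul_le_mul_of_nonneg_left (n1.trans n2) two_pos.le))
    (show 0 ≤ 2 * α ^ 4 + α ^ 3 by positivity)
  have p : ∀ c m : ℝ, 0 < c → 0 ≤ c * n ∧ 0 ≤ c * n ^ 2 ∧ 0 ≤ c * n ^ 3 := fun c m hc =>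
    ⟨by positivity, by positivity, by positivity⟩
  obtain ⟨a1, a2, a3⟩ := p α 0 hα
  obtain ⟨b1, b2, b3⟩ := p _ 0 h2
  obtain ⟨c1, c2, c3⟩ := p _ 0 h3
  obtain ⟨d1, d2, d3⟩ := p _ 0 h4
  have g1 : 0 ≤ α * y := by positivity
  have g2 : 0 ≤ α * y ^ 2 := by positivity
  have g3 : 0 ≤ α * y ^ 3 := by positivity
  have g4 : 0 ≤ α ^ 2 * y := by positivity
  have g5 : 0 ≤ α ^ 3 * y ^ 2 := by positivity
  have g6 : 0 ≤ (2 * α ^ 4 + α ^ 3) * y := by positivity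
  refine ⟨?_, ?_, ?_⟩
  · rw [abs_of_nonneg g1]; linarith
  · rw [abs_of_nonneg (by linarith)]; linarith
  · rw [abs_le]; constructor <;> linarith

/-- The `d`'s and `e`'s stand for the coefficients of the drop at `y` and `y + 1`. The subtracted
terms are those up to order `q ^ 4`; as `n * q ≤ 2`, each remaining monomial is of size `n ^ 3 * q ^
5`. -/
theorem overload_residual_aux {ρ A n q y d1 d2 d3 e1 e2 e3 : ℝ} (hρ : 0 < ρ) (hA : 0 < A)
    (hn : 1 ≤ n) (hq : 0 < q) (hnq : n * q ≤ 2) (hy : 0 ≤ y) (hyn : y ≤ n)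
    (h1 : |d1| ≤ A * n) (h2 : |d2| ≤ A * n ^ 2) (h3 : |d3| ≤ A * n ^ 3)
    (k1 : |e1| ≤ A * n) (k2 : |e2| ≤ A * n ^ 2) (k3 : |e3| ≤ A * n ^ 3) :
    |d1 * q ^ 2 + d2 * q ^ 3 + d3 * q ^ 4| ≤ 7 * A * (n * q ^ 2) ∧
    |e1 * q ^ 2 + e2 * q ^ 3 + e3 * q ^ 4| ≤ 7 * A * (n * q ^ 2) ∧
    |ρ * ((d1 * q ^ 2 + d2 * q ^ 3 + d3 * q ^ 4) ^ 2 - d1 ^ 2 * q ^ 4)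
      + ((e1 * q ^ 2 + e2 * q ^ 3 + e3 * q ^ 4) * (q + y * q ^ 2 + y ^ 2 * q ^ 3 + y ^ 3 * q ^ 4)
        - e1 * q ^ 3 - (e2 + y * e1) * q ^ 4)| ≤ (24 * ρ * A ^ 2 + 25 * A) * (n ^ 3 * q ^ 5) := by
  have n0 : 0 ≤ n := by linarith
  have hnq0 : 0 ≤ n * q := by positivity
  have w2 : ∀ {e}, |e| ≤ A * n ^ 2 → |e * q ^ 3| ≤ 2 * A * (n * q ^ 2) := fun {e} h => by
    rw [abs_mul, abs_of_pos (pow_pos hq 3)]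
    calc |e| * q ^ 3 ≤ A * n ^ 2 * q ^ 3 := mul_le_mul_of_nonneg_right h (by positivity)
      _ = A * (n * q ^ 2) * (n * q) := by ring
      _ ≤ A * (n * q ^ 2) * 2 := mul_le_mul_of_nonneg_left hnq (by positivity)
      _ = 2 * A * (n * q ^ 2) := by ring
  have w3 : ∀ {e}, |e| ≤ A * n ^ 3 → |e * q ^ 4| ≤ 2 * A * (n ^ 2 * q ^ 3) := fun {e} h => by
    rw [abs_mul, abs_of_pos (pow_pos hq 4)]
    calc |e| * q ^ 4 ≤ A * n ^ 3 * q ^ 4 := mul_le_mul_of_nonneg_right h (by positivity)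
      _ = A * (n ^ 2 * q ^ 3) * (n * q) := by ring
      _ ≤ A * (n ^ 2 * q ^ 3) * 2 := mul_le_mul_of_nonneg_left hnq (by positivity)
      _ = 2 * A * (n ^ 2 * q ^ 3) := by ring
  have w4 : n ^ 2 * q ^ 3 ≤ 2 * (n * q ^ 2) := by
    calc n ^ 2 * q ^ 3 = n * q ^ 2 * (n * q) := by ring
      _ ≤ n * q ^ 2 * 2 := mul_le_mul_of_nonneg_left hnq (by positivity)
      _ = 2 * (n * q ^ 2) := by ring
  have w1 : ∀ {e}, |e| ≤ A * n → |e * q ^ 2| ≤ A * (n * q ^ 2) := fun {e} h => by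
    rw [abs_mul, abs_of_pos (pow_pos hq 2)]
    calc |e| * q ^ 2 ≤ A * n * q ^ 2 := mul_le_mul_of_nonneg_right h (by positivity)
      _ = A * (n * q ^ 2) := by ring
  have hw4 := mul_le_mul_of_nonneg_left w4 hA.le
  have drop : ∀ {a b c}, |a| ≤ A * n → |b| ≤ A * n ^ 2 → |c| ≤ A * n ^ 3 →
      |a * q ^ 2 + b * q ^ 3 + c * q ^ 4| ≤ 7 * A * (n * q ^ 2) := fun {a b c} ha hb hc => by
    have := abs_add_three (a * q ^ 2) (b * q ^ 3) (c * q ^ 4)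
    linarith [w1 ha, w2 hb, w3 hc]
  have hD := drop h1 h2 h3
  have hE := drop k1 k2 k3
  refine ⟨hD, hE, ?_⟩
  have t1 : |(d1 * q ^ 2 + d2 * q ^ 3 + d3 * q ^ 4) ^ 2 - d1 ^ 2 * q ^ 4|
      ≤ 24 * A ^ 2 * (n ^ 3 * q ^ 5) := by
    have e : (d1 * q ^ 2 + d2 * q ^ 3 + d3 * q ^ 4) ^ 2 - d1 ^ 2 * q ^ 4
        = (d2 * q ^ 3 + d3 * q ^ 4) * ((d1 * q ^ 2 + d2 * q ^ 3 + d3 * q ^ 4) + d1 * q ^ 2) := by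
      ring
    have g1 : |d2 * q ^ 3 + d3 * q ^ 4| ≤ 3 * A * (n ^ 2 * q ^ 3) := by
      have g : |d2 * q ^ 3| ≤ A * (n ^ 2 * q ^ 3) := by
        rw [abs_mul, abs_of_pos (pow_pos hq 3)]
        calc |d2| * q ^ 3 ≤ A * n ^ 2 * q ^ 3 := mul_le_mul_of_nonneg_right h2 (by positivity)
          _ = A * (n ^ 2 * q ^ 3) := by ring
      linarith [abs_add_le (d2 * q ^ 3) (d3 * q ^ 4), w3 h3]
    have g2 : |(d1 * q ^ 2 + d2 * q ^ 3 + d3 * q ^ 4) + d1 * q ^ 2| ≤ 8 * A * (n * q ^ 2) := by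
      linarith [abs_add_le (d1 * q ^ 2 + d2 * q ^ 3 + d3 * q ^ 4) (d1 * q ^ 2), w1 h1]
    rw [e, abs_mul]
    calc _ ≤ 3 * A * (n ^ 2 * q ^ 3) * (8 * A * (n * q ^ 2)) :=
          mul_le_mul g1 g2 (abs_nonneg _) (by positivity)
      _ = 24 * A ^ 2 * (n ^ 3 * q ^ 5) := by ring
  have t2 : |(e1 * q ^ 2 + e2 * q ^ 3 + e3 * q ^ 4)
        * (q + y * q ^ 2 + y ^ 2 * q ^ 3 + y ^ 3 * q ^ 4)
        - e1 * q ^ 3 - (e2 + y * e1) * q ^ 4| ≤ 25 * A * (n ^ 3 * q ^ 5) := by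
    have e : (e1 * q ^ 2 + e2 * q ^ 3 + e3 * q ^ 4)
        * (q + y * q ^ 2 + y ^ 2 * q ^ 3 + y ^ 3 * q ^ 4)
        - e1 * q ^ 3 - (e2 + y * e1) * q ^ 4
        = e3 * q ^ 5 + y * e2 * q ^ 5 + e3 * q ^ 4 * (y * q ^ 2)
          + (y ^ 2 * q ^ 3 + y ^ 3 * q ^ 4) * (e1 * q ^ 2 + e2 * q ^ 3 + e3 * q ^ 4) := by ring
    have y2 : y ^ 2 ≤ n ^ 2 := pow_le_pow_left₀ hy hyn 2
    have y3 : y ^ 3 ≤ n ^ 3 := pow_le_pow_left₀ hy hyn 3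
    have g1 : |e3 * q ^ 5| ≤ A * (n ^ 3 * q ^ 5) := by
      rw [abs_mul, abs_of_pos (pow_pos hq 5), ← mul_assoc]
      exact mul_le_mul_of_nonneg_right k3 (by positivity)
    have g2 : |y * e2 * q ^ 5| ≤ A * (n ^ 3 * q ^ 5) := by
      rw [abs_mul, abs_mul, abs_of_pos (pow_pos hq 5), abs_of_nonneg hy, ← mul_assoc]
      refine mul_le_mul_of_nonneg_right ?_ (by positivity)
      calc y * |e2| ≤ n * (A * n ^ 2) := mul_le_mul hyn k2 (abs_nonneg _) n0
        _ = A * n ^ 3 := by ring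
    have g3 : |e3 * q ^ 4 * (y * q ^ 2)| ≤ 2 * A * (n ^ 3 * q ^ 5) := by
      rw [abs_mul, abs_of_nonneg (show 0 ≤ y * q ^ 2 by positivity)]
      calc _ ≤ 2 * A * (n ^ 2 * q ^ 3) * (n * q ^ 2) :=
            mul_le_mul (w3 k3) (mul_le_mul_of_nonneg_right hyn (by positivity)) (by positivity)
              (by positivity)
        _ = 2 * A * (n ^ 3 * q ^ 5) := by ring
    have g4 : |(y ^ 2 * q ^ 3 + y ^ 3 * q ^ 4) * (e1 * q ^ 2 + e2 * q ^ 3 + e3 * q ^ 4)|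
        ≤ 21 * A * (n ^ 3 * q ^ 5) := by
      have g5 : y ^ 2 * q ^ 3 + y ^ 3 * q ^ 4 ≤ 3 * (n ^ 2 * q ^ 3) := by
        have b1 := mul_le_mul_of_nonneg_right y2 (pow_pos hq 3).le
        have b2 := mul_le_mul_of_nonneg_right y3 (pow_pos hq 4).le
        have b3 := mul_le_mul_of_nonneg_left hnq (show 0 ≤ n ^ 2 * q ^ 3 by positivity)
        linarith
      rw [abs_mul, abs_of_nonneg (show 0 ≤ y ^ 2 * q ^ 3 + y ^ 3 * q ^ 4 by positivity)]
      calc _ ≤ 3 * (n ^ 2 * q ^ 3) * (7 * A * (n * q ^ 2)) :=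
            mul_le_mul g5 hE (abs_nonneg _) (by positivity)
        _ = 21 * A * (n ^ 3 * q ^ 5) := by ring
    rw [e]
    have b1 := abs_add_le (e3 * q ^ 5 + y * e2 * q ^ 5 + e3 * q ^ 4 * (y * q ^ 2))
      ((y ^ 2 * q ^ 3 + y ^ 3 * q ^ 4) * (e1 * q ^ 2 + e2 * q ^ 3 + e3 * q ^ 4))
    have b2 := abs_add_three (e3 * q ^ 5) (y * e2 * q ^ 5) (e3 * q ^ 4 * (y * q ^ 2))
    linarith
  refine (abs_add_le _ _).trans ?_
  rw [abs_mul, abs_of_pos hρ]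
  have := mul_le_mul_of_nonneg_left t1 hρ.le
  linarith

/-- The approximate eigenvector for load above one solves the recursion up to fifth order. -/
theorem overload_residual_bound {ρ α : ℝ} (hρ : 0 < ρ) (hα : 0 < α) (h : ρ * α = α + 1) :
    ∃ C, 0 < C ∧ ∀ q y : ℝ, 0 < q → q ≤ 1 → 0 ≤ y → (1 + y) * q ≤ 2 →
      |overloadDrop α q y| ≤ C * ((1 + y) * q ^ 2) ∧
      |overloadDrop α q (y + 1)| ≤ C * ((1 + y) * q ^ 2) ∧
      |ρ * (overloadDrop α q y + overloadDrop α q y ^ 2) - overloadDrop α q (y + 1)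
        - (1 - overloadDrop α q (y + 1)) * (q + y * q ^ 2 + y ^ 2 * q ^ 3 + y ^ 3 * q ^ 4)
        - overloadRate α q| ≤ C * ((1 + y) ^ 3 * q ^ 5) := by
  obtain ⟨A, hA, hb⟩ := overload_coeff_bounds hα
  refine ⟨24 * ρ * A ^ 2 + 25 * A, by positivity, fun q y hq hq1 hy hyq => ?_⟩
  obtain ⟨h1, h2, h3⟩ := hb (1 + y) y (by linarith) hy (by linarith)
  obtain ⟨k1, k2, k3⟩ := hb (1 + y) (y + 1) (by linarith) (by linarith) (by linarith)
  obtain ⟨g1, g2, g3⟩ := overload_residual_aux hρ hA (by linarith) hq hyq hy (by linarith)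
    h1 h2 h3 k1 k2 k3
  have hp : 0 ≤ (1 + y) * q ^ 2 := by positivity
  have hle : 7 * A * ((1 + y) * q ^ 2) ≤ (24 * ρ * A ^ 2 + 25 * A) * ((1 + y) * q ^ 2) := by
    refine mul_le_mul_of_nonneg_right ?_ hp
    have : 0 ≤ 24 * ρ * A ^ 2 := by positivity
    linarith
  refine ⟨g1.trans hle, g2.trans hle, ?_⟩
  convert g3 using 2
  simp only [overloadDrop, overloadRate]
  -- The relation for α is used at each order. For instance at `q ^ 2`, `ρ * α * y - α * (y + 1) - y
  -- = -α`, which is the second term of the rate.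
  linear_combination (y * q ^ 2 + (y ^ 2 + α * y) * q ^ 3
    + (y ^ 3 - α ^ 2 * y ^ 2 - (2 * α ^ 3 + α ^ 2) * y + α * y ^ 2) * q ^ 4) * h

theorem ratio_recursion {ρ a d e c : ℝ} (hd : d < 1) :
    ρ * a + (1 - 1 / c) * (a * (1 - d) * (1 - e)) - (1 + ρ) * (a * (1 - d))
      = (ρ * (d / (1 - d)) - e - (1 - e) / c) * (a * (1 - d)) := by
  have h : 1 - d ≠ 0 := by linarith
  have h1 : d / (1 - d) * (1 - d) = d := div_mul_cancel₀ d h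
  linear_combination (-ρ * a) * h1

/-- The test vector is the product of the factors `1 - d i`. Dividing the recursion at `j = i + 1`
by the entry there gives a first-order relation, and reflection becomes a sign of `d 0`. -/
theorem IsDecayRate.le_of_ratio {K : ℕ} {ρ θ lam : ℝ} (hK : 0 < K) (hρ : 0 < ρ)
    (h : IsDecayRate K ρ θ) (d : ℕ → ℝ) (hd : ∀ i < K, d i < 1) (h0 : 0 ≤ d 0)
    (hrec : ∀ i < K, ρ * (d i / (1 - d i)) - d (i + 1) - (1 - d (i + 1)) / ((K : ℝ) - i) ≤ lam) :
    θ ≤ lam := by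
  have hpos : ∀ j ≤ K, 0 < ∏ i ∈ Finset.range j, (1 - d i) := fun j hj =>
    Finset.prod_pos fun i hi => sub_pos.mpr (hd i ((Finset.mem_range.mp hi).trans_le hj))
  refine h.le_of_supersolution hK hρ (fun j => ∏ i ∈ Finset.range j, (1 - d i))
    (fun j _ hj => hpos j hj) (by simpa using h0) fun j h1 h2 => ?_
  obtain ⟨i, rfl⟩ : ∃ i, j = i + 1 := ⟨j - 1, by omega⟩
  have e : (K : ℝ) + 1 - ((i + 1 : ℕ) : ℝ) = (K : ℝ) - i := by push_cast; ring
  simp only [Nat.add_sub_cancel]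
  rw [Finset.prod_range_succ _ (i + 1), Finset.prod_range_succ _ i, e,
    ratio_recursion (hd i (by omega)), ← Finset.prod_range_succ]
  exact mul_le_mul_of_nonneg_right (hrec i (by omega)) (hpos _ h2).le

theorem IsDecayRate.ge_of_ratio {K : ℕ} {ρ θ lam : ℝ} (hρ : 0 < ρ)
    (h : IsDecayRate K ρ θ) (d : ℕ → ℝ) (J : ℕ) (hJ : 1 ≤ J) (hJK : J ≤ K)
    (hd : ∀ i < J, d i < 1) (hdJ : 1 ≤ d J) (h0 : d 0 ≤ 0)
    (hrec : ∀ i < J, lam ≤ ρ * (d i / (1 - d i)) - d (i + 1) - (1 - d (i + 1)) / ((K : ℝ) - i)) :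
    lam ≤ θ := by
  have hpos : ∀ j ≤ J, 0 < ∏ i ∈ Finset.range j, (1 - d i) := fun j hj =>
    Finset.prod_pos fun i hi => sub_pos.mpr (hd i ((Finset.mem_range.mp hi).trans_le hj))
  refine h.ge_of_subsolution hρ (fun j => ∏ i ∈ Finset.range j, (1 - d i)) J hJ hJK
    (fun j _ hj => hpos j hj) ?_ (by simpa using h0) fun j h1 h2 => ?_
  · rw [Finset.prod_range_succ]
    exact mul_nonpos_of_nonneg_of_nonpos (hpos J le_rfl).le (by linarith)
  · obtain ⟨i, rfl⟩ : ∃ i, j = i + 1 := ⟨j - 1, by omega⟩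
    have e : (K : ℝ) + 1 - ((i + 1 : ℕ) : ℝ) = (K : ℝ) - i := by push_cast; ring
    simp only [Nat.add_sub_cancel]
    rw [Finset.prod_range_succ _ (i + 1), Finset.prod_range_succ _ i, e,
      ratio_recursion (hd i (by omega)), ← Finset.prod_range_succ]
    exact mul_le_mul_of_nonneg_right (hrec i (by omega)) (hpos _ h2).le

theorem overloadDrop_zero (α q : ℝ) : overloadDrop α q 0 = 0 := by simp [overloadDrop]

theorem cube_le_of_quartic {C y : ℝ} (hC : 0 < C) (hy : 0 ≤ y) :
    C * (1 + y) ^ 3 ≤ y ^ 4 / 2 + (8 * C + 8 * C * (16 * C) ^ 3) := by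
  have h1 : (1 + y) ^ 3 ≤ 8 * 1 + 8 * y ^ 3 := by
    rcases le_total y 1 with h | h
    · have : (1 + y) ^ 3 ≤ 2 ^ 3 := pow_le_pow_left₀ (by linarith) (by linarith) 3
      have : 0 ≤ y ^ 3 := by positivity
      linarith
    · have : (1 + y) ^ 3 ≤ (2 * y) ^ 3 := pow_le_pow_left₀ (by linarith) (by linarith) 3
      rw [mul_pow] at this
      linarith
  have h2 := mul_le_mul_of_nonneg_left h1 hC.le
  rcases le_total y (16 * C) with h | h
  · have h3 := mul_le_mul_of_nonneg_left (pow_le_pow_left₀ hy h 3) hC.le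
    have : 0 ≤ y ^ 4 := by positivity
    linarith
  · have h3 := mul_le_mul_of_nonneg_right h (show 0 ≤ y ^ 3 by positivity)
    have : 0 ≤ 8 * C * (16 * C) ^ 3 := by positivity
    linarith

theorem one_div_sub_eq {K q y : ℝ} (hq : 0 < q) (hK : K * q = 1) (hy : y * q < 1) :
    1 / (K - y) = q + y * q ^ 2 + y ^ 2 * q ^ 3 + y ^ 3 * q ^ 4 + y ^ 4 * q ^ 5 / (1 - y * q) := by
  have h : (K - y) * q = 1 - y * q := by rw [sub_mul, hK]
  have h1 : 1 - y * q ≠ 0 := by linarith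
  have h2 : K - y ≠ 0 := by
    rintro h3
    rw [h3, zero_mul] at h
    exact h1 h.symm
  have h3 : K = 1 / q := by field_simp; linarith
  subst h3
  have h4 : 1 - q * y ≠ 0 := by rwa [mul_comm]
  field_simp
  ring

/-- The tail `y ^ 4 * q ^ 5 / (1 - y * q)` of the potential has the favourable sign and beats the
residual of size `(1 + y) ^ 3 * q ^ 5`, so the formal solution works on the whole queue. -/
theorem overload_decayRate_le {ρ α : ℝ} (hρ : 0 < ρ) (hα : 0 < α) (h : ρ * α = α + 1) :
    ∃ C q₀ : ℝ, 0 < q₀ ∧ ∀ (K : ℕ) (θ q : ℝ), IsDecayRate K ρ θ → 0 < q → q ≤ q₀ →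
      (K : ℝ) * q = 1 → θ ≤ overloadRate α q + C * q ^ 5 := by
  obtain ⟨C, hC, hb⟩ := overload_residual_bound hρ hα h
  set D := C + 2 * ρ * (4 * C ^ 3) with hD
  have hD0 : 0 < D := by positivity
  refine ⟨8 * D + 8 * D * (16 * D) ^ 3, min 1 (1 / (4 * C)), by positivity,
    fun K θ q hθ hq hqq hK => ?_⟩
  have hq1 : q ≤ 1 := hqq.trans (min_le_left _ _)
  have hqC : q * (4 * C) ≤ 1 := by
    rw [← le_div_iff₀ (by positivity)]; exact hqq.trans (min_le_right _ _)
  have hK0 : 0 < K := by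
    rcases Nat.eq_zero_or_pos K with rfl | h0
    · simp at hK
    · exact h0
  have hyK : ∀ i < K, ((i : ℝ) + 1) * q ≤ 1 := fun i hi => by
    refine le_trans (mul_le_mul_of_nonneg_right ?_ hq.le) hK.le
    exact_mod_cast hi
  have small : ∀ y x : ℝ, (1 + y) * q ≤ 2 → |x| ≤ C * ((1 + y) * q ^ 2) → |x| ≤ 1 / 2 :=
    fun y x h1 h2 => by
      have h3 := mul_le_mul_of_nonneg_left h1 (show 0 ≤ C * q by positivity)
      linarith
  refine hθ.le_of_ratio hK0 hρ (fun i => overloadDrop α q i) (fun i hi => ?_)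
    (by simp [overloadDrop_zero]) fun i hi => ?_
  · have h1 := hyK i hi
    obtain ⟨g1, -, -⟩ := hb q i hq hq1 (Nat.cast_nonneg i) (by linarith)
    have := (abs_le.mp (small i _ (by linarith) g1)).2
    linarith
  · have h1 := hyK i hi
    have hy : (0 : ℝ) ≤ i := Nat.cast_nonneg i
    obtain ⟨g1, g2, g3⟩ := hb q i hq hq1 hy (by linarith)
    have s1 := abs_le.mp (small i _ (by linarith) g1)
    have s2 := abs_le.mp (small i _ (by linarith) g2)
    have hyq : (i : ℝ) * q < 1 := by linarith
    push_cast
    rw [div_eq_mul_one_div (1 - overloadDrop α q (i + 1)), one_div_sub_eq hq hK hyq]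
    set y : ℝ := (i : ℝ) with hy'
    set d := overloadDrop α q y with hd
    set e := overloadDrop α q (y + 1) with he
    clear_value y d e
    have k1 : d / (1 - d) = d + d ^ 2 + d ^ 3 / (1 - d) := by
      have : 1 - d ≠ 0 := by linarith
      field_simp
      ring
    have k2 : d ^ 3 / (1 - d) ≤ 2 * (4 * C ^ 3) * ((1 + y) ^ 3 * q ^ 5) := by
      have b1 : |d| ^ 3 ≤ (C * ((1 + y) * q ^ 2)) ^ 3 := pow_le_pow_left₀ (abs_nonneg d) g1 3
      have b2 : d ^ 3 ≤ |d| ^ 3 := by rw [← abs_pow]; exact le_abs_self _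
      have b3 : (C * ((1 + y) * q ^ 2)) ^ 3 ≤ 4 * C ^ 3 * ((1 + y) ^ 3 * q ^ 5) := by
        have : q * (C ^ 3 * ((1 + y) ^ 3 * q ^ 5)) ≤ 1 * (C ^ 3 * ((1 + y) ^ 3 * q ^ 5)) :=
          mul_le_mul_of_nonneg_right hq1 (by positivity)
        have b4 : 0 ≤ C ^ 3 * ((1 + y) ^ 3 * q ^ 5) := by positivity
        linarith
      have b5 : 0 ≤ 4 * C ^ 3 * ((1 + y) ^ 3 * q ^ 5) := by positivity
      rw [div_le_iff₀ (by linarith)]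
      have b6 := mul_le_mul_of_nonneg_left (show 1 / 2 ≤ 1 - d by linarith) b5
      linarith
    have k3 : y ^ 4 * q ^ 5 ≤ y ^ 4 * q ^ 5 / (1 - y * q) := by
      rw [le_div_iff₀ (by linarith)]
      have : 0 ≤ y ^ 4 * q ^ 5 := by positivity
      have : 0 ≤ y * q := by positivity
      nlinarith
    have k4 := mul_le_mul (show 1 / 2 ≤ 1 - e by linarith) k3 (by positivity) (by linarith)
    have k5 := mul_le_mul_of_nonneg_right (cube_le_of_quartic hD0 hy) (pow_pos hq 5).le
    have k6 := mul_le_mul_of_nonneg_left k2 hρ.le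
    have k7 := (abs_le.mp g3).2
    rw [k1]
    have k8 : D * (1 + y) ^ 3 * q ^ 5 = C * ((1 + y) ^ 3 * q ^ 5)
        + ρ * (2 * (4 * C ^ 3) * ((1 + y) ^ 3 * q ^ 5)) := by rw [hD]; ring
    linarith

theorem overloadDrop_nonneg {α : ℝ} (hα : 0 < α) : ∃ ε, 0 < ε ∧ ∀ q y : ℝ, 0 < q → q ≤ 1 → 0 ≤ y →
    (1 + y) * q ≤ ε → 0 ≤ overloadDrop α q y := by
  set β := α ^ 3 + (2 * α ^ 4 + α ^ 3) with hβ
  have hβ0 : 0 < β := by positivity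
  refine ⟨α / β, by positivity, fun q y hq hq1 hy h => ?_⟩
  have h1 : β * ((1 + y) * q) ≤ α := by
    rw [le_div_iff₀ hβ0] at h; linarith
  have h2 : (α ^ 3 * y + (2 * α ^ 4 + α ^ 3)) * q ^ 2 ≤ α := by
    have e1 : α ^ 3 * y + (2 * α ^ 4 + α ^ 3) ≤ β * (1 + y) := by
      have : 0 ≤ (2 * α ^ 4 + α ^ 3) * y := by positivity
      have : 0 < α ^ 3 := by positivity
      rw [hβ]; linarith
    have e2 := mul_le_mul_of_nonneg_right e1 (sq_nonneg q)
    have e3 := mul_le_mul_of_nonneg_right hq1 (show 0 ≤ β * ((1 + y) * q) by positivity)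
    linarith
  have e : overloadDrop α q y = y * q ^ 2 * (α - (α ^ 3 * y + (2 * α ^ 4 + α ^ 3)) * q ^ 2
      + (α * y + α ^ 2) * q + α * y ^ 2 * q ^ 2) := by rw [overloadDrop]; ring
  rw [e]
  have h3 : 0 ≤ (α * y + α ^ 2) * q := by positivity
  have h4 : 0 ≤ α * y ^ 2 * q ^ 2 := by positivity
  exact mul_nonneg (by positivity) (by linarith)

theorem exists_mul_pow_ge (C : ℝ) {σ : ℝ} (hσ : 1 < σ) (p : ℕ) :
    ∃ M, 0 < M ∧ ∀ i : ℕ, C * ((i : ℝ) + 1) ^ p ≤ M * σ ^ i := by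
  have h1 := tendsto_pow_const_div_const_pow_of_one_lt p hσ
  have h2 := (tendsto_add_atTop_iff_nat 1).mpr h1
  obtain ⟨B, hB⟩ := h2.bddAbove_range
  have hB' : ∀ i : ℕ, ((i : ℝ) + 1) ^ p ≤ B * σ * σ ^ i := fun i => by
    have := hB ⟨i, rfl⟩
    simp only at this
    rw [div_le_iff₀ (by positivity)] at this
    push_cast at this
    rw [pow_succ] at this
    linarith
  refine ⟨|C| * |B * σ| + 1, by positivity, fun i => ?_⟩
  have hs : 0 < σ ^ i := by positivity
  calc C * ((i : ℝ) + 1) ^ p ≤ |C| * ((i : ℝ) + 1) ^ p :=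
        mul_le_mul_of_nonneg_right (le_abs_self C) (by positivity)
    _ ≤ |C| * (|B * σ| * σ ^ i) := by
        refine mul_le_mul_of_nonneg_left ((hB' i).trans ?_) (abs_nonneg C)
        exact mul_le_mul_of_nonneg_right (le_abs_self _) hs.le
    _ ≤ (|C| * |B * σ| + 1) * σ ^ i := by linarith

-- The tail of the potential now has the wrong sign. The drop is increased by `M * q ^ 5 * (σ ^ i -
-- 1)` with `1 < σ < ρ`. In the recursion this gains `M * q ^ 5 * ((ρ - σ) * σ ^ i - (ρ - 1))`: the
-- growing part pays for the residual, the constant part is the loss in the bound. The growth also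
-- lifts the drop to 1 no later than index `√K`, where the vector is cut.
set_option maxHeartbeats 1000000 in
theorem le_overload_decayRate {ρ α : ℝ} (hρ : 1 < ρ) (hα : 0 < α) (h : ρ * α = α + 1) :
    ∃ (C : ℝ) (K₀ : ℕ), ∀ (K : ℕ) (θ q : ℝ), K₀ ≤ K → IsDecayRate K ρ θ → 0 < q →
      (K : ℝ) * q = 1 → overloadRate α q - C * q ^ 5 ≤ θ := by
  obtain ⟨C, hC, hb⟩ := overload_residual_bound (by linarith) hα h
  obtain ⟨ε, hε, hnn⟩ := overloadDrop_nonneg hα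
  set σ := (1 + ρ) / 2 with hσ
  have hσ1 : 1 < σ := by rw [hσ]; linarith
  have hσρ : 0 < ρ - σ := by rw [hσ]; linarith
  obtain ⟨M, hM, hMb⟩ := exists_mul_pow_ge ((C + 2) / (ρ - σ)) hσ1 4
  have hMb' : ∀ i : ℕ, (C + 2) * ((i : ℝ) + 1) ^ 4 ≤ M * ((ρ - σ) * σ ^ i) := fun i => by
    have := mul_le_mul_of_nonneg_left (hMb i) hσρ.le
    have e : (ρ - σ) * ((C + 2) / (ρ - σ) * ((i : ℝ) + 1) ^ 4)
        = (C + 2) * ((i : ℝ) + 1) ^ 4 := by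
      field_simp
    linarith
  -- For `m` the integer square root of `K`, `(m + 1) ^ 2 * q ≥ 1`. The tenth power thus outweighs
  -- `q ^ 5`, and the drop at `m` is at least 1.
  have hgrow : ∀ᶠ m : ℕ in atTop, ((m : ℝ) + 1) ^ 10 ≤ M * (σ ^ m - 1) := by
    have h1 := tendsto_pow_const_div_const_pow_of_one_lt 10 hσ1
    have h2 := (tendsto_add_atTop_iff_nat 1).mpr h1
    have h3 : ∀ᶠ m : ℕ in atTop, ((m + 1 : ℕ) : ℝ) ^ 10 / σ ^ (m + 1) < M / (2 * σ) :=
      h2.eventually (gt_mem_nhds (by positivity))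
    have h4 : ∀ᶠ m : ℕ in atTop, 2 ≤ σ ^ m :=
      (tendsto_pow_atTop_atTop_of_one_lt hσ1).eventually_ge_atTop 2
    filter_upwards [h3, h4] with m h5 h6
    rw [div_lt_iff₀ (by positivity), pow_succ σ m] at h5
    have e : M / (2 * σ) * (σ ^ m * σ) = M * σ ^ m / 2 := by field_simp
    push_cast at h5
    rw [e] at h5
    nlinarith
  obtain ⟨m₀, hm₀⟩ := eventually_atTop.mp hgrow
  obtain ⟨m₁, hm₁⟩ := exists_nat_ge (2 / min ε (1 / 2))
  set m₂ := max (max m₀ m₁) 2 with hm₂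
  refine ⟨M * (ρ - 1), m₂ ^ 2, fun K θ q hK hθ hq hKq => ?_⟩
  set m := K.sqrt with hm
  have hmm : m₂ ≤ m := by rw [hm, Nat.le_sqrt']; exact hK
  have hmK : m ^ 2 ≤ K := Nat.sqrt_le' K
  have hKm : K < (m + 1) ^ 2 := Nat.lt_succ_sqrt' K
  have hm2 : 2 ≤ m := (le_max_right _ _).trans hmm
  have hmm0 : m₀ ≤ m := ((le_max_left _ _).trans (le_max_left _ _)).trans hmm
  have hmm1 : m₁ ≤ m := ((le_max_right _ _).trans (le_max_left _ _)).trans hmm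
  have hmR : (2 : ℝ) ≤ m := by exact_mod_cast hm2
  have hmq : (m : ℝ) ^ 2 * q ≤ 1 := by
    rw [← hKq]; exact mul_le_mul_of_nonneg_right (by exact_mod_cast hmK) hq.le
  have hmin : ((m : ℝ) + 1) * q ≤ min ε (1 / 2) := by
    have hmin0 : 0 < min ε (1 / 2) := by positivity
    have h1 : 2 / min ε (1 / 2) ≤ m := hm₁.trans (by exact_mod_cast hmm1)
    rw [div_le_iff₀ hmin0] at h1
    have h2 : ((m : ℝ) + 1) * q * m ≤ 2 := by nlinarith
    have h3 : ((m : ℝ) + 1) * q * m ≤ min ε (1 / 2) * m := by linarith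
    exact le_of_mul_le_mul_right h3 (by linarith)
  have hmε : ((m : ℝ) + 1) * q ≤ ε := hmin.trans (min_le_left _ _)
  have hm12 : ((m : ℝ) + 1) * q ≤ 1 / 2 := hmin.trans (min_le_right _ _)
  have hq1 : q ≤ 1 := by nlinarith
  have hq5 : 0 < q ^ 5 := by positivity
  set d : ℕ → ℝ := fun i => overloadDrop α q i + M * q ^ 5 * (σ ^ i - 1) with hd
  have hdm : 1 ≤ d m := by
    have h1 := hnn q m hq hq1 (by linarith) (by linarith)
    have h2 := mul_le_mul_of_nonneg_right (hm₀ m hmm0) hq5.le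
    have h3 : 1 ≤ ((m : ℝ) + 1) ^ 10 * q ^ 5 := by
      have h4 : 1 ≤ ((m : ℝ) + 1) ^ 2 * q := by
        refine hKq.symm.le.trans (mul_le_mul_of_nonneg_right ?_ hq.le)
        exact_mod_cast hKm.le
      calc (1 : ℝ) ≤ (((m : ℝ) + 1) ^ 2 * q) ^ 5 := one_le_pow₀ h4
        _ = ((m : ℝ) + 1) ^ 10 * q ^ 5 := by ring
    simp only [hd]
    linarith
  classical
  have hex : ∃ j, 1 ≤ d j := ⟨m, hdm⟩
  set J := Nat.find hex with hJ
  have hdJ : 1 ≤ d J := Nat.find_spec hex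
  have hJm : J ≤ m := Nat.find_min' hex hdm
  have hlt : ∀ i < J, d i < 1 := fun i hi => not_le.mp (Nat.find_min hex hi)
  have hd0 : d 0 = 0 := by simp [hd, overloadDrop_zero]
  have hJ1 : 1 ≤ J := by
    by_contra h0
    have : J = 0 := by omega
    rw [this, hd0] at hdJ
    linarith
  have hmK' : m ≤ K := (Nat.le_self_pow two_ne_zero m).trans hmK
  refine hθ.ge_of_ratio (by linarith) d J hJ1 (hJm.trans hmK') hlt hdJ hd0.le fun i hi => ?_
  have him : (i : ℝ) + 1 ≤ m := by exact_mod_cast (show i + 1 ≤ m by omega)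
  have hy : (0 : ℝ) ≤ i := Nat.cast_nonneg i
  have himq : ((i : ℝ) + 1 + 1) * q ≤ (m + 1) * q := mul_le_mul_of_nonneg_right (by linarith) hq.le
  obtain ⟨-, -, g3⟩ := hb q i hq hq1 hy (by linarith)
  have n1 := hnn q i hq hq1 hy (by linarith)
  have n2 := hnn q (i + 1) hq hq1 (by linarith) (by linarith)
  have hyq : (i : ℝ) * q ≤ 1 / 2 := by linarith
  have hi1 := hlt i hi
  have hpow : 1 ≤ σ ^ i := one_le_pow₀ hσ1.le
  have hMi := hMb' i
  simp only [hd] at hi1 ⊢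
  push_cast
  rw [div_eq_mul_one_div (1 - (overloadDrop α q (i + 1) + M * q ^ 5 * (σ ^ (i + 1) - 1))),
    one_div_sub_eq hq hKq (by linarith), pow_succ σ i]
  set y : ℝ := (i : ℝ) with hy'
  set P := σ ^ i with hP
  set a := overloadDrop α q y with ha
  set e := overloadDrop α q (y + 1) with he
  set S := q + y * q ^ 2 + y ^ 2 * q ^ 3 + y ^ 3 * q ^ 4 with hS
  set T := y ^ 4 * q ^ 5 / (1 - y * q) with hT
  clear_value y P a e
  have hS0 : 0 ≤ S := by positivity
  have hT0 : 0 ≤ T := div_nonneg (by positivity) (by linarith)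
  have hT2 : T ≤ 2 * (1 + y) ^ 4 * q ^ 5 := by
    rw [hT, div_le_iff₀ (by linarith)]
    have b1 : y ^ 4 ≤ (1 + y) ^ 4 := pow_le_pow_left₀ hy (by linarith) 4
    have b2 := mul_le_mul_of_nonneg_right b1 hq5.le
    have b3 := mul_le_mul_of_nonneg_left (show 1 / 2 ≤ 1 - y * q by linarith)
      (show 0 ≤ 2 * (1 + y) ^ 4 * q ^ 5 by positivity)
    linarith
  clear_value S T
  set E := M * q ^ 5 * (P - 1) with hE
  set E' := M * q ^ 5 * (P * σ - 1) with hE'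
  have hE0 : 0 ≤ E := mul_nonneg (by positivity) (by linarith)
  have hE'0 : 0 ≤ E' := mul_nonneg (by positivity) (by nlinarith)
  have hgain : (C + 2) * (y + 1) ^ 4 * q ^ 5 ≤ ρ * E - E' + M * (ρ - 1) * q ^ 5 := by
    have := mul_le_mul_of_nonneg_right hMi hq5.le
    rw [hE, hE']
    linarith
  clear_value E E'
  have hquot : (a + E) + a ^ 2 ≤ (a + E) / (1 - (a + E)) := by
    rw [le_div_iff₀ (by linarith)]
    have hx : 0 ≤ a + E := by linarith
    have h1 : a ^ 2 ≤ (a + E) ^ 2 := pow_le_pow_left₀ n1 (by linarith) 2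
    have h2 : 0 ≤ a ^ 2 * (a + E) := by positivity
    linarith
  have hquot' := mul_le_mul_of_nonneg_left hquot (show 0 ≤ ρ by linarith)
  have g4 := (abs_le.mp g3).1
  have g5 : C * ((1 + y) ^ 3 * q ^ 5) ≤ C * (y + 1) ^ 4 * q ^ 5 := by
    have : (1 + y) ^ 3 * 1 ≤ (1 + y) ^ 3 * (1 + y) :=
      mul_le_mul_of_nonneg_left (by linarith) (by positivity)
    have := mul_le_mul_of_nonneg_left this (show 0 ≤ C * q ^ 5 by positivity)
    linarith
  have g6 : 0 ≤ (e + E') * T := mul_nonneg (by linarith) hT0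
  have g7 : 0 ≤ E' * S := mul_nonneg hE'0 hS0
  linarith

theorem overloadRate_eq {ρ q : ℝ} (hρ : 1 < ρ) :
    overloadRate (1 / (ρ - 1)) q = -q - 1 / (ρ - 1) * q ^ 2 - 1 / (ρ - 1) ^ 2 * q ^ 3
      + (ρ ^ 2 + 1) / (ρ - 1) ^ 4 * q ^ 4 := by
  have h : ρ - 1 ≠ 0 := by linarith
  rw [overloadRate]
  field_simp
  ring

/-- The expansion of the decay rate for a fixed load above one. -/
theorem decayRate_expansion_of_one_lt {ρ : ℝ} (hρ : 1 < ρ) :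
    ∃ (C : ℝ) (K₀ : ℕ), ∀ (K : ℕ) (θ q : ℝ), K₀ ≤ K → IsDecayRate K ρ θ → 0 < q →
      (K : ℝ) * q = 1 →
      |θ - (-q - 1 / (ρ - 1) * q ^ 2 - 1 / (ρ - 1) ^ 2 * q ^ 3
        + (ρ ^ 2 + 1) / (ρ - 1) ^ 4 * q ^ 4)| ≤ C * q ^ 5 := by
  have h1 : 0 < ρ - 1 := by linarith
  have hα : 0 < 1 / (ρ - 1) := by positivity
  have h : ρ * (1 / (ρ - 1)) = 1 / (ρ - 1) + 1 := by field_simp; ring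
  obtain ⟨C₁, q₀, hq₀, hup⟩ := overload_decayRate_le (by linarith) hα h
  obtain ⟨C₂, K₀, hlow⟩ := le_overload_decayRate hρ hα h
  obtain ⟨K₁, hK₁⟩ := exists_nat_ge (1 / q₀)
  refine ⟨|C₁| + |C₂|, max K₀ K₁, fun K θ q hK hθ hq hKq => ?_⟩
  have hq5 : 0 < q ^ 5 := by positivity
  have hqq : q ≤ q₀ := by
    have h2 : 1 / q₀ ≤ K := hK₁.trans (by exact_mod_cast (le_max_right _ _).trans hK)
    rw [div_le_iff₀ hq₀] at h2
    have h3 : (K : ℝ) * q ≤ K * q₀ := by linarith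
    have hK0 : 0 < (K : ℝ) := pos_of_mul_pos_left (by rw [hKq]; exact one_pos) hq.le
    exact le_of_mul_le_mul_left h3 hK0
  have a1 := hup K θ q hθ hq hqq hKq
  have a2 := hlow K θ q ((le_max_left _ _).trans hK) hθ hq hKq
  rw [overloadRate_eq hρ] at a1 a2
  have b1 := mul_le_mul_of_nonneg_right (le_abs_self C₁) hq5.le
  have b2 := mul_le_mul_of_nonneg_right (le_abs_self C₂) hq5.le
  have b3 : 0 ≤ |C₁| * q ^ 5 := by positivity
  have b4 : 0 ≤ |C₂| * q ^ 5 := by positivity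
  rw [abs_le]
  constructor <;> linarith

/-! ### The Airy integral is a recessive solution of the Airy equation. -/

theorem airy_exponent (x s y : ℝ) :
    Complex.I * (((s : ℂ) + y * Complex.I) ^ 3 / 3 + x * ((s : ℂ) + y * Complex.I))
      = ((y ^ 3 / 3 - s ^ 2 * y - x * y : ℝ) : ℂ)
        + ((s ^ 3 / 3 - s * y ^ 2 + x * s : ℝ) : ℂ) * Complex.I := by
  push_cast
  linear_combination ((s : ℂ) ^ 2 * y + s * y ^ 2 * Complex.I + y ^ 3 / 3 * (Complex.I ^ 2 - 1)
    + x * y) * Complex.I_sq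

theorem exp_ofReal_add_ofReal_mul_I_re (a b : ℝ) :
    (Complex.exp ((a : ℂ) + (b : ℂ) * Complex.I)).re = Real.exp a * Real.cos b := by
  simp [Complex.exp_re]

theorem exp_ofReal_add_ofReal_mul_I_im (a b : ℝ) :
    (Complex.exp ((a : ℂ) + (b : ℂ) * Complex.I)).im = Real.exp a * Real.sin b := by
  simp [Complex.exp_im]

/-- The integrand of the Airy function on the line of imaginary part one. -/
noncomputable def airyCos (x t : ℝ) : ℝ :=
  Real.exp (1 / 3 - x - t ^ 2) * Real.cos (t ^ 3 / 3 + (x - 1) * t)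

/-- The harmonic conjugate of `airyCos`. -/
noncomputable def airySin (x t : ℝ) : ℝ :=
  Real.exp (1 / 3 - x - t ^ 2) * Real.sin (t ^ 3 / 3 + (x - 1) * t)

theorem abs_airyCos_le (x t : ℝ) : |airyCos x t| ≤ Real.exp (1 / 3 - x - t ^ 2) := by
  rw [airyCos, abs_mul, abs_of_pos (Real.exp_pos _)]
  exact mul_le_of_le_one_right (Real.exp_pos _).le (Real.abs_cos_le_one _)

theorem abs_airySin_le (x t : ℝ) : |airySin x t| ≤ Real.exp (1 / 3 - x - t ^ 2) := by
  rw [airySin, abs_mul, abs_of_pos (Real.exp_pos _)]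
  exact mul_le_of_le_one_right (Real.exp_pos _).le (Real.abs_sin_le_one _)

theorem continuous_airyCos (x : ℝ) : Continuous (airyCos x) := by unfold airyCos; fun_prop

theorem continuous_airySin (x : ℝ) : Continuous (airySin x) := by unfold airySin; fun_prop

theorem integrable_exp_neg_half_sq (c : ℝ) :
    MeasureTheory.Integrable (fun t : ℝ => c * Real.exp (-(1 / 2) * t ^ 2))
      (MeasureTheory.volume.restrict (Set.Ioi 0)) :=
  ((integrable_exp_neg_mul_sq (by norm_num)).const_mul c).restrict

theorem exp_sub_sq_le (a t : ℝ) :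
    Real.exp (a - t ^ 2) * (1 + t ^ 2) ≤ 2 * Real.exp a * Real.exp (-(1 / 2) * t ^ 2) := by
  have h1 : 1 + t ^ 2 ≤ 2 * Real.exp (t ^ 2 / 2) := by
    linarith [Real.add_one_le_exp (t ^ 2 / 2)]
  calc Real.exp (a - t ^ 2) * (1 + t ^ 2)
      ≤ Real.exp (a - t ^ 2) * (2 * Real.exp (t ^ 2 / 2)) :=
        mul_le_mul_of_nonneg_left h1 (Real.exp_pos _).le
    _ = 2 * Real.exp a * Real.exp (-(1 / 2) * t ^ 2) := by
        rw [mul_left_comm, mul_assoc, ← Real.exp_add, ← Real.exp_add]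
        congr 2; ring

theorem integrable_of_abs_le {g : ℝ → ℝ} (hg : Continuous g) {a c : ℝ}
    (h : ∀ t, |g t| ≤ c * (Real.exp (a - t ^ 2) * (1 + t ^ 2))) (hc : 0 ≤ c) :
    MeasureTheory.Integrable g (MeasureTheory.volume.restrict (Set.Ioi 0)) :=
  (integrable_exp_neg_half_sq (c * (2 * Real.exp a))).mono' hg.aestronglyMeasurable
    (Eventually.of_forall fun t => (h t).trans (by
      rw [mul_assoc]; exact mul_le_mul_of_nonneg_left (exp_sub_sq_le a t) hc))

theorem integrable_airyCos (x : ℝ) :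
    MeasureTheory.Integrable (airyCos x) (MeasureTheory.volume.restrict (Set.Ioi 0)) :=
  integrable_of_abs_le (continuous_airyCos x) (a := 1 / 3 - x) (c := 1) (fun t => by
    rw [one_mul]
    exact (abs_airyCos_le x t).trans
      (le_mul_of_one_le_right (Real.exp_pos _).le (by nlinarith [sq_nonneg t]))) zero_le_one

/-- Cauchy's theorem on the rectangle with corners 0 and `R + i`. The side on the imaginary axis
contributes nothing, because the integrand is real there; the opposite side is the error term. -/
theorem integral_cos_cubic_eq (x R : ℝ) :
    ∫ t in (0 : ℝ)..R, Real.cos (t ^ 3 / 3 + x * t)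
      = (∫ t in (0 : ℝ)..R, airyCos x t) + ∫ y in (0 : ℝ)..1,
        Real.exp (y ^ 3 / 3 - R ^ 2 * y - x * y) * Real.sin (R ^ 3 / 3 - R * y ^ 2 + x * R) := by
  set F : ℂ → ℂ := fun z => Complex.exp (Complex.I * (z ^ 3 / 3 + x * z)) with hF
  have hdiff : Differentiable ℂ F := by fun_prop
  have hFc : Continuous F := hdiff.continuous
  have hFv : ∀ s y : ℝ, F (s + y * Complex.I) = Complex.exp
      (((y ^ 3 / 3 - s ^ 2 * y - x * y : ℝ) : ℂ)
        + ((s ^ 3 / 3 - s * y ^ 2 + x * s : ℝ) : ℂ) * Complex.I) := fun s y => by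
    simp only [hF]
    rw [airy_exponent]
  have hrect := Complex.integral_boundary_rect_eq_zero_of_differentiableOn F 0
    ((R : ℂ) + Complex.I) hdiff.differentiableOn
  simp only [Complex.zero_re, Complex.zero_im, Complex.add_re, Complex.add_im, Complex.ofReal_re,
    Complex.ofReal_im, Complex.I_re, Complex.I_im, add_zero, zero_add] at hrect
  have hre := congrArg Complex.re hrect
  have hint : ∀ (g : ℝ → ℂ) (a b : ℝ), Continuous g →
      (∫ t in a..b, g t).re = ∫ t in a..b, (g t).re := fun g a b hg => by
    have := (Complex.reCLM).intervalIntegral_comp_comm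
      (hg.intervalIntegrable (μ := MeasureTheory.volume) a b)
    simpa using this.symm
  have hint' : ∀ (g : ℝ → ℂ) (a b : ℝ), Continuous g →
      (∫ t in a..b, g t).im = ∫ t in a..b, (g t).im := fun g a b hg => by
    have := (Complex.imCLM).intervalIntegral_comp_comm
      (hg.intervalIntegrable (μ := MeasureTheory.volume) a b)
    simpa using this.symm
  simp only [Complex.sub_re, Complex.add_re, smul_eq_mul, Complex.mul_re, Complex.I_re,
    Complex.I_im, zero_mul, one_mul, zero_sub, Complex.zero_re] at hre
  rw [hint _ _ _ (by fun_prop), hint _ _ _ (by fun_prop), hint' _ _ _ (by fun_prop),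
    hint' _ _ _ (by fun_prop)] at hre
  have e1 : ∀ t : ℝ, (F (t + ((0 : ℝ) : ℂ) * Complex.I)).re = Real.cos (t ^ 3 / 3 + x * t) :=
    fun t => by rw [hFv, exp_ofReal_add_ofReal_mul_I_re]; simp
  have e2 : ∀ t : ℝ, (F (t + ((1 : ℝ) : ℂ) * Complex.I)).re = airyCos x t := fun t => by
    rw [hFv, exp_ofReal_add_ofReal_mul_I_re, airyCos]; congr 2 <;> ring
  have e3 : ∀ y : ℝ, (F (R + (y : ℂ) * Complex.I)).im
      = Real.exp (y ^ 3 / 3 - R ^ 2 * y - x * y) * Real.sin (R ^ 3 / 3 - R * y ^ 2 + x * R) :=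
    fun y => by rw [hFv, exp_ofReal_add_ofReal_mul_I_im]
  have e4 : ∀ y : ℝ, (F (((0 : ℝ) : ℂ) + (y : ℂ) * Complex.I)).im = 0 := fun y => by
    rw [hFv, exp_ofReal_add_ofReal_mul_I_im]; simp
  simp only [e1, e2, e3, e4, intervalIntegral.integral_zero] at hre
  linarith

/-- The vertical side carries `exp (-R ^ 2 * y)` and vanishes by dominated convergence. The limit is
an absolutely convergent integral with a Gaussian factor, which allows differentiation under the
integral. -/
theorem tendsto_airyAi (x : ℝ) :
    Tendsto (fun R : ℝ => (1 / Real.pi) * ∫ t in (0 : ℝ)..R, Real.cos (t ^ 3 / 3 + x * t)) atTop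
      (𝓝 ((1 / Real.pi) * ∫ t in Set.Ioi (0 : ℝ), airyCos x t)) := by
  refine Tendsto.const_mul _ ?_
  simp only [integral_cos_cubic_eq]
  rw [← add_zero (∫ t in Set.Ioi (0 : ℝ), airyCos x t)]
  refine (MeasureTheory.intervalIntegral_tendsto_integral_Ioi 0 (integrable_airyCos x)
    tendsto_id).add ?_
  have hle : ∀ R y : ℝ, |Real.exp (y ^ 3 / 3 - R ^ 2 * y - x * y)
      * Real.sin (R ^ 3 / 3 - R * y ^ 2 + x * R)| ≤ Real.exp (y ^ 3 / 3 - R ^ 2 * y - x * y) :=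
    fun R y => by
      rw [abs_mul, abs_of_pos (Real.exp_pos _)]
      exact mul_le_of_le_one_right (Real.exp_pos _).le (Real.abs_sin_le_one _)
  have key : Tendsto (fun R : ℝ => ∫ y in (0 : ℝ)..1, Real.exp (y ^ 3 / 3 - R ^ 2 * y - x * y)
      * Real.sin (R ^ 3 / 3 - R * y ^ 2 + x * R)) atTop (𝓝 (∫ _ in (0 : ℝ)..1, (0 : ℝ))) := by
    refine intervalIntegral.tendsto_integral_filter_of_dominated_convergence
      (fun y => Real.exp (y ^ 3 / 3 - x * y))
      (Eventually.of_forall fun R => (by fun_prop : Continuous fun y : ℝ =>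
        Real.exp (y ^ 3 / 3 - R ^ 2 * y - x * y)
          * Real.sin (R ^ 3 / 3 - R * y ^ 2 + x * R)).aestronglyMeasurable)
      (Eventually.of_forall fun R => Eventually.of_forall fun y hy => ?_)
      ((by fun_prop : Continuous fun y : ℝ => Real.exp (y ^ 3 / 3 - x * y)).intervalIntegrable _ _)
      (Eventually.of_forall fun y hy => ?_)
    · rw [Set.uIoc_of_le zero_le_one] at hy
      refine (hle R y).trans (Real.exp_le_exp.mpr ?_)
      have : 0 ≤ R ^ 2 * y := mul_nonneg (sq_nonneg R) hy.1.le
      linarith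
    · rw [Set.uIoc_of_le zero_le_one] at hy
      refine squeeze_zero_norm (fun R => hle R y) ?_
      refine Real.tendsto_exp_atBot.comp ?_
      have h1 : Tendsto (fun R : ℝ => R ^ 2 * y) atTop atTop :=
        (tendsto_pow_atTop two_ne_zero).atTop_mul_const hy.1
      have h2 := tendsto_atBot_add_const_left atTop (y ^ 3 / 3 - x * y)
        (tendsto_neg_atTop_atBot.comp h1)
      refine h2.congr fun R => ?_
      simp only [Function.comp]
      ring
  rwa [intervalIntegral.integral_zero] at key

theorem airyAi_eq (x : ℝ) : airyAi x = (1 / Real.pi) * ∫ t in Set.Ioi (0 : ℝ), airyCos x t :=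
  (tendsto_airyAi x).limUnder_eq

theorem hasDerivAt_airyCos (x t : ℝ) :
    HasDerivAt (fun x => airyCos x t) (-airyCos x t - t * airySin x t) x := by
  have h1 : HasDerivAt (fun x : ℝ => 1 / 3 - x - t ^ 2) (-1) x :=
    ((hasDerivAt_id x).const_sub (1 / 3)).sub_const (t ^ 2)
  have h2 : HasDerivAt (fun x : ℝ => t ^ 3 / 3 + (x - 1) * t) (1 * t) x :=
    (((hasDerivAt_id x).sub_const 1).mul_const t).const_add (t ^ 3 / 3)
  refine (h1.exp.fun_mul h2.cos).congr_deriv ?_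
  rw [airyCos, airySin]; ring

theorem hasDerivAt_airySin (x t : ℝ) :
    HasDerivAt (fun x => airySin x t) (-airySin x t + t * airyCos x t) x := by
  have h1 : HasDerivAt (fun x : ℝ => 1 / 3 - x - t ^ 2) (-1) x :=
    ((hasDerivAt_id x).const_sub (1 / 3)).sub_const (t ^ 2)
  have h2 : HasDerivAt (fun x : ℝ => t ^ 3 / 3 + (x - 1) * t) (1 * t) x :=
    (((hasDerivAt_id x).sub_const 1).mul_const t).const_add (t ^ 3 / 3)
  refine (h1.exp.fun_mul h2.sin).congr_deriv ?_
  rw [airyCos, airySin]; ring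

theorem hasDerivAt_airySin_right (x t : ℝ) :
    HasDerivAt (airySin x) (-2 * t * airySin x t + (t ^ 2 + x - 1) * airyCos x t) t := by
  have h1 : HasDerivAt (fun t : ℝ => 1 / 3 - x - t ^ 2) (-(2 * t)) t :=
    ((hasDerivAt_pow 2 t).const_sub (1 / 3 - x)).congr_deriv (by simp)
  have h2 : HasDerivAt (fun t : ℝ => t ^ 3 / 3 + (x - 1) * t) (t ^ 2 + (x - 1)) t :=
    (((hasDerivAt_pow 3 t).div_const 3).fun_add
      ((hasDerivAt_id t).const_mul (x - 1))).congr_deriv (by push_cast; ring)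
  refine (h1.exp.fun_mul h2.sin).congr_deriv ?_
  rw [airyCos, airySin]; ring

theorem abs_airyCos_le_of_mem {x₀ x : ℝ} (hx : x ∈ Metric.ball x₀ 1) (t : ℝ) :
    |airyCos x t| ≤ Real.exp (4 / 3 - x₀ - t ^ 2) ∧ |airySin x t| ≤ Real.exp (4 / 3 - x₀ - t ^ 2) := by
  have h := (abs_lt.mp (by simpa [Real.dist_eq] using hx : |x - x₀| < 1)).1
  have h1 : Real.exp (1 / 3 - x - t ^ 2) ≤ Real.exp (4 / 3 - x₀ - t ^ 2) :=
    Real.exp_le_exp.mpr (by linarith)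
  exact ⟨(abs_airyCos_le x t).trans h1, (abs_airySin_le x t).trans h1⟩

theorem abs_comb_le {c s a b E w p q : ℝ} (hc : |c| ≤ E) (hs : |s| ≤ E) (ha : |a| ≤ p)
    (hb : |b| ≤ q) (hw : p + q ≤ w) : |a * c + b * s| ≤ E * w := by
  have hE : 0 ≤ E := (abs_nonneg c).trans hc
  calc |a * c + b * s| ≤ |a| * |c| + |b| * |s| := by
        rw [← abs_mul, ← abs_mul]; exact abs_add_le _ _
    _ ≤ p * E + q * E := add_le_add
        (mul_le_mul ha hc (abs_nonneg _) ((abs_nonneg _).trans ha))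
        (mul_le_mul hb hs (abs_nonneg _) ((abs_nonneg _).trans hb))
    _ = E * (p + q) := by ring
    _ ≤ E * w := mul_le_mul_of_nonneg_left hw hE

/-- The derivative of the Airy function. -/
noncomputable def airyDeriv (x : ℝ) : ℝ :=
  (1 / Real.pi) * ∫ t in Set.Ioi (0 : ℝ), (-airyCos x t - t * airySin x t)

theorem abs_airyDeriv_integrand_le {x₀ x : ℝ} (hx : x ∈ Metric.ball x₀ 1) (t : ℝ) :
    |-airyCos x t - t * airySin x t| ≤ 2 * (Real.exp (4 / 3 - x₀ - t ^ 2) * (1 + t ^ 2)) := by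
  obtain ⟨h1, h2⟩ := abs_airyCos_le_of_mem hx t
  have := abs_comb_le (a := -1) (b := -t) (w := 2 * (1 + t ^ 2)) h1 h2 le_rfl le_rfl (by
    rw [abs_neg, abs_neg, abs_one]
    nlinarith [sq_abs t, sq_nonneg (|t| - 1)])
  have e : -1 * airyCos x t + -t * airySin x t = -airyCos x t - t * airySin x t := by ring
  rw [e] at this
  linarith

theorem abs_airyDeriv2_integrand_le {x₀ x : ℝ} (hx : x ∈ Metric.ball x₀ 1) (t : ℝ) :
    |(1 - t ^ 2) * airyCos x t + 2 * t * airySin x t|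
      ≤ 2 * (Real.exp (4 / 3 - x₀ - t ^ 2) * (1 + t ^ 2)) := by
  obtain ⟨h1, h2⟩ := abs_airyCos_le_of_mem hx t
  have := abs_comb_le (a := 1 - t ^ 2) (b := 2 * t) (w := 2 * (1 + t ^ 2)) (p := 1 + t ^ 2)
    (q := 1 + t ^ 2) h1 h2
    (by rw [abs_le]; constructor <;> nlinarith [sq_nonneg t])
    (by rw [abs_le]; constructor <;> nlinarith [sq_nonneg (t - 1), sq_nonneg (t + 1)])
    (by linarith)
  linarith

theorem hasDerivAt_airyAi (x : ℝ) : HasDerivAt airyAi (airyDeriv x) x := by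
  rw [show airyAi = fun x => (1 / Real.pi) * ∫ t in Set.Ioi (0 : ℝ), airyCos x t from
    funext airyAi_eq]
  refine HasDerivAt.const_mul _ ?_
  refine (hasDerivAt_integral_of_dominated_loc_of_deriv_le (F := airyCos)
    (F' := fun x t => -airyCos x t - t * airySin x t)
    (bound := fun t => 2 * (2 * Real.exp (4 / 3 - x)) * Real.exp (-(1 / 2) * t ^ 2))
    (Metric.ball_mem_nhds x one_pos)
    (Eventually.of_forall fun y => (continuous_airyCos y).aestronglyMeasurable)
    (integrable_airyCos x) ?_ (Eventually.of_forall fun t y hy => ?_)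
    (integrable_exp_neg_half_sq _)
    (Eventually.of_forall fun t y _ => hasDerivAt_airyCos y t)).2
  · have h1 := continuous_airyCos x
    have h2 := continuous_airySin x
    exact (by fun_prop : Continuous fun t => -airyCos x t - t * airySin x t).aestronglyMeasurable
  · refine (abs_airyDeriv_integrand_le hy t).trans ?_
    rw [mul_assoc 2]
    exact mul_le_mul_of_nonneg_left (exp_sub_sq_le _ t) two_pos.le

theorem deriv_airyAi : deriv airyAi = airyDeriv := funext fun x => (hasDerivAt_airyAi x).deriv

theorem hasDerivAt_airyDeriv_aux (x : ℝ) :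
    HasDerivAt airyDeriv ((1 / Real.pi) * ∫ t in Set.Ioi (0 : ℝ),
      ((1 - t ^ 2) * airyCos x t + 2 * t * airySin x t)) x := by
  unfold airyDeriv
  refine HasDerivAt.const_mul _ ?_
  have h1 := continuous_airyCos
  have h2 := continuous_airySin
  refine (hasDerivAt_integral_of_dominated_loc_of_deriv_le
    (F := fun x t => -airyCos x t - t * airySin x t)
    (F' := fun x t => (1 - t ^ 2) * airyCos x t + 2 * t * airySin x t)
    (bound := fun t => 2 * (2 * Real.exp (4 / 3 - x)) * Real.exp (-(1 / 2) * t ^ 2))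
    (Metric.ball_mem_nhds x one_pos) (Eventually.of_forall fun y => ?_) ?_ ?_
    (Eventually.of_forall fun t y hy => ?_)
    (integrable_exp_neg_half_sq _)
    (Eventually.of_forall fun t y _ => ?_)).2
  · have h1 := continuous_airyCos y
    have h2 := continuous_airySin y
    exact (by fun_prop : Continuous fun t => -airyCos y t - t * airySin y t).aestronglyMeasurable
  · have h1 := continuous_airyCos x
    have h2 := continuous_airySin x
    exact integrable_of_abs_le (by fun_prop)
      (abs_airyDeriv_integrand_le (Metric.mem_ball_self one_pos)) two_pos.le
  · have h1 := continuous_airyCos x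
    have h2 := continuous_airySin x
    exact (by fun_prop : Continuous fun t =>
      (1 - t ^ 2) * airyCos x t + 2 * t * airySin x t).aestronglyMeasurable
  · refine (abs_airyDeriv2_integrand_le hy t).trans ?_
    rw [mul_assoc 2]
    exact mul_le_mul_of_nonneg_left (exp_sub_sq_le _ t) two_pos.le
  · refine ((hasDerivAt_airyCos y t).fun_neg.fun_sub
      ((hasDerivAt_airySin y t).const_mul t)).congr_deriv ?_
    ring

/-- The integrands of `x * Ai` and `Ai''` differ by the `t`-derivative of `airySin x`, which
vanishes at 0 and at infinity. -/
theorem airy_isAirySolution : IsAirySolution airyAi airyDeriv where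
  deriv_fst := hasDerivAt_airyAi
  deriv_snd x := by
    refine (hasDerivAt_airyDeriv_aux x).congr_deriv ?_
    have hx : ∫ t in Set.Ioi (0 : ℝ), x * airyCos x t = x * ∫ t in Set.Ioi (0 : ℝ), airyCos x t :=
      MeasureTheory.integral_const_mul x _
    rw [airyAi_eq, mul_left_comm, ← hx]
    congr 1
    have h1 := continuous_airyCos x
    have h2 := continuous_airySin x
    have hi1 : MeasureTheory.Integrable
        (fun t => (1 - t ^ 2) * airyCos x t + 2 * t * airySin x t)
        (MeasureTheory.volume.restrict (Set.Ioi 0)) :=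
      integrable_of_abs_le (by fun_prop)
        (abs_airyDeriv2_integrand_le (Metric.mem_ball_self one_pos)) two_pos.le
    have hi2 := (integrable_airyCos x).const_mul x
    have hz := MeasureTheory.integral_Ioi_of_hasDerivAt_of_tendsto' (a := 0) (f := airySin x)
      (m := 0) (fun t _ => hasDerivAt_airySin_right x t)
      ((hi2.sub hi1).congr (Eventually.of_forall fun t => by
        simp only [Pi.sub_apply]; ring)) (by
        refine squeeze_zero_norm (abs_airySin_le x) (Real.tendsto_exp_atBot.comp ?_)
        exact tendsto_atBot_add_const_left atTop (1 / 3 - x)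
          (tendsto_neg_atTop_atBot.comp (tendsto_pow_atTop two_ne_zero)))
    have h0 : airySin x 0 = 0 := by simp [airySin]
    rw [h0, sub_zero] at hz
    have hd := MeasureTheory.integral_sub hi2 hi1
    have he : (∫ t in Set.Ioi (0 : ℝ), (x * airyCos x t
        - ((1 - t ^ 2) * airyCos x t + 2 * t * airySin x t))) = 0 := by
      refine Eq.trans ?_ hz
      congr 1
      ext t
      ring
    rw [he] at hd
    linarith

theorem integral_pow_six_mul_exp_neg_sq :
    ∫ t in Set.Ioi (0 : ℝ), t ^ 6 * Real.exp (-t ^ 2) = 15 / 16 * √Real.pi := by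
  have h := integral_rpow_mul_exp_neg_rpow (p := 2) (q := 6) two_pos (by norm_num)
  have e : ((6 : ℝ) + 1) / 2 = (3 : ℕ) + 1 / 2 := by norm_num
  rw [e, Real.Gamma_nat_add_half] at h
  have h2 : ∀ t : ℝ, t ^ (6 : ℝ) * Real.exp (-t ^ (2 : ℝ)) = t ^ 6 * Real.exp (-t ^ 2) :=
    fun t => by norm_cast
  simp only [h2] at h
  rw [h]
  norm_num [Nat.doubleFactorial]
  ring

/-- A nonintegrable function has integral 0 by convention, whereas the computed value is positive.
-/
theorem integrable_pow_six_mul_exp_neg_sq :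
    MeasureTheory.IntegrableOn (fun t : ℝ => t ^ 6 * Real.exp (-t ^ 2)) (Set.Ioi 0) := by
  by_contra h
  have := MeasureTheory.integral_undef h
  rw [integral_pow_six_mul_exp_neg_sq] at this
  have hp := Real.sqrt_pos.mpr Real.pi_pos
  linarith

/-- At `x = 1` the phase reduces to `t ^ 3 / 3`. With `cos u ≥ 1 - u ^ 2 / 2`, positivity follows
from the Gaussian moments, as `1 / 2 > (1 / 18) * (15 / 16)`. -/
theorem airyAi_one_pos : 0 < airyAi 1 := by
  rw [airyAi_eq]
  refine mul_pos (by positivity) ?_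
  have hg := integral_gaussian_Ioi 1
  have hgi : MeasureTheory.IntegrableOn (fun t : ℝ => Real.exp (-1 * t ^ 2)) (Set.Ioi 0) :=
    (integrable_exp_neg_mul_sq one_pos).integrableOn
  have hlow : ∫ t in Set.Ioi (0 : ℝ), Real.exp (-(2 / 3)) *
      (Real.exp (-1 * t ^ 2) - 1 / 18 * (t ^ 6 * Real.exp (-t ^ 2)))
      ≤ ∫ t in Set.Ioi (0 : ℝ), airyCos 1 t := by
    refine MeasureTheory.integral_mono
      ((hgi.sub (integrable_pow_six_mul_exp_neg_sq.const_mul (1 / 18))).const_mul _)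
      (integrable_airyCos 1) fun t => ?_
    have hc := Real.one_sub_sq_div_two_le_cos (x := t ^ 3 / 3 + (1 - 1) * t)
    have e1 : Real.exp (1 / 3 - 1 - t ^ 2) = Real.exp (-(2 / 3)) * Real.exp (-t ^ 2) := by
      rw [← Real.exp_add]; congr 1; ring
    have e2 : -1 * t ^ 2 = -t ^ 2 := by ring
    simp only [airyCos]
    rw [e1, e2, mul_assoc]
    refine mul_le_mul_of_nonneg_left ?_ (Real.exp_pos _).le
    have := mul_le_mul_of_nonneg_left hc (Real.exp_pos (-t ^ 2)).le
    linarith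
  refine lt_of_lt_of_le ?_ hlow
  rw [MeasureTheory.integral_const_mul]
  refine mul_pos (Real.exp_pos _) ?_
  rw [MeasureTheory.integral_sub hgi (integrable_pow_six_mul_exp_neg_sq.const_mul _),
    MeasureTheory.integral_const_mul, integral_pow_six_mul_exp_neg_sq, hg, div_one]
  have hp := Real.sqrt_pos.mpr Real.pi_pos
  linarith

theorem airy_isRecessive : IsRecessiveAiry airyAi airyDeriv where
  toIsAirySolution := airy_isAirySolution
  bounded := by
    refine ⟨(1 / Real.pi) * ∫ t in Set.Ioi (0 : ℝ),
      2 * Real.exp (1 / 3) * Real.exp (-(1 / 2) * t ^ 2), fun y hy => ?_⟩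
    rw [airyAi_eq, abs_mul, abs_of_pos (by positivity : 0 < 1 / Real.pi)]
    refine mul_le_mul_of_nonneg_left ?_ (by positivity)
    refine MeasureTheory.norm_integral_le_of_norm_le (f := airyCos y) (integrable_exp_neg_half_sq _)
      (Eventually.of_forall fun t => (abs_airyCos_le y t).trans ?_)
    refine le_trans ?_ (exp_sub_sq_le (1 / 3) t)
    refine (Real.exp_le_exp.mpr (by linarith)).trans
      (le_mul_of_one_le_right (Real.exp_pos _).le (by nlinarith [sq_nonneg t]))
  pos_one := airyAi_one_pos

/-! ### Numerical location of the largest Airy zero. -/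

/-- Taylor coefficients of the solution of the Airy equation with `f 0 = 1`, `f' 0 = 0`. -/
noncomputable def airyCoeffA (k : ℕ) : ℝ :=
  ∏ j ∈ Finset.range k, 1 / ((3 * (j : ℝ) + 3) * (3 * j + 2))

/-- Taylor coefficients of the solution of the Airy equation with `f 0 = 0`, `f' 0 = 1`. -/
noncomputable def airyCoeffB (k : ℕ) : ℝ :=
  ∏ j ∈ Finset.range k, 1 / ((3 * (j : ℝ) + 4) * (3 * j + 3))

/-- Taylor polynomial of the solution of the Airy equation with `f 0 = 1`, `f' 0 = 0`. -/
noncomputable def airyPolyA (N : ℕ) (x : ℝ) : ℝ :=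
  1 + ∑ k ∈ Finset.range N, airyCoeffA (k + 1) * x ^ (3 * k + 3)

/-- Derivative of `airyPolyA`. -/
noncomputable def airyPolyA1 (N : ℕ) (x : ℝ) : ℝ :=
  ∑ k ∈ Finset.range N, airyCoeffA (k + 1) * ((3 * (k : ℝ) + 3) * x ^ (3 * k + 2))

/-- Taylor polynomial of the solution of the Airy equation with `f 0 = 0`, `f' 0 = 1`. -/
noncomputable def airyPolyB (N : ℕ) (x : ℝ) : ℝ :=
  x + ∑ k ∈ Finset.range N, airyCoeffB (k + 1) * x ^ (3 * k + 4)

/-- Derivative of `airyPolyB`. -/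
noncomputable def airyPolyB1 (N : ℕ) (x : ℝ) : ℝ :=
  1 + ∑ k ∈ Finset.range N, airyCoeffB (k + 1) * ((3 * (k : ℝ) + 4) * x ^ (3 * k + 3))

theorem airyCoeffA_nonneg (k : ℕ) : 0 ≤ airyCoeffA k :=
  Finset.prod_nonneg fun j _ => by positivity

theorem airyCoeffB_nonneg (k : ℕ) : 0 ≤ airyCoeffB k :=
  Finset.prod_nonneg fun j _ => by positivity

theorem hasDerivAt_airyPolyA (N : ℕ) (x : ℝ) :
    HasDerivAt (airyPolyA N) (airyPolyA1 N x) x := by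
  refine (HasDerivAt.fun_sum fun k _ =>
    (hasDerivAt_pow (3 * k + 3) x).const_mul (airyCoeffA (k + 1))).const_add 1 |>.congr_deriv ?_
  refine Finset.sum_congr rfl fun k _ => ?_
  push_cast
  rfl

theorem hasDerivAt_airyPolyB (N : ℕ) (x : ℝ) :
    HasDerivAt (airyPolyB N) (airyPolyB1 N x) x := by
  refine ((hasDerivAt_id x).fun_add (HasDerivAt.fun_sum fun k _ =>
    (hasDerivAt_pow (3 * k + 4) x).const_mul (airyCoeffB (k + 1)))).congr_deriv ?_
  rw [airyPolyB1]
  congr 1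
  refine Finset.sum_congr rfl fun k _ => ?_
  push_cast
  rfl

theorem airyPolyA_sub (N : ℕ) (x : ℝ) : airyPolyA N x - airyCoeffA N * x ^ (3 * N)
    = ∑ k ∈ Finset.range N, airyCoeffA k * x ^ (3 * k) := by
  have h := Finset.sum_range_succ' (fun k => airyCoeffA k * x ^ (3 * k)) N
  rw [Finset.sum_range_succ] at h
  have h0 : airyCoeffA 0 * x ^ (3 * 0) = 1 := by simp [airyCoeffA]
  rw [h0] at h
  rw [airyPolyA]
  have e : ∀ k, 3 * (k + 1) = 3 * k + 3 := fun k => by ring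
  simp only [e] at h
  linarith

theorem airyPolyB_sub (N : ℕ) (x : ℝ) : airyPolyB N x - airyCoeffB N * x ^ (3 * N + 1)
    = ∑ k ∈ Finset.range N, airyCoeffB k * x ^ (3 * k + 1) := by
  have h := Finset.sum_range_succ' (fun k => airyCoeffB k * x ^ (3 * k + 1)) N
  rw [Finset.sum_range_succ] at h
  have h0 : airyCoeffB 0 * x ^ (3 * 0 + 1) = x := by simp [airyCoeffB]
  rw [h0] at h
  rw [airyPolyB]
  have e : ∀ k, 3 * (k + 1) + 1 = 3 * k + 4 := fun k => by ring
  simp only [e] at h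
  linarith

theorem airyCoeffA_succ (k : ℕ) :
    airyCoeffA (k + 1) * ((3 * (k : ℝ) + 3) * (3 * k + 2)) = airyCoeffA k := by
  have : (3 * (k : ℝ) + 3) * (3 * k + 2) ≠ 0 := by positivity
  rw [airyCoeffA, Finset.prod_range_succ, mul_assoc, one_div_mul_cancel this, mul_one, airyCoeffA]

theorem airyCoeffB_succ (k : ℕ) :
    airyCoeffB (k + 1) * ((3 * (k : ℝ) + 4) * (3 * k + 3)) = airyCoeffB k := by
  have : (3 * (k : ℝ) + 4) * (3 * k + 3) ≠ 0 := by positivity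
  rw [airyCoeffB, Finset.prod_range_succ, mul_assoc, one_div_mul_cancel this, mul_one, airyCoeffB]

/-- The Taylor polynomial fails the Airy equation by exactly its last term, so Wronskians with it
are almost constant, with an explicit defect. -/
theorem hasDerivAt_airyPolyA1 (N : ℕ) (x : ℝ) :
    HasDerivAt (airyPolyA1 N) (x * (airyPolyA N x - airyCoeffA N * x ^ (3 * N))) x := by
  refine (HasDerivAt.fun_sum fun k _ => ((hasDerivAt_pow (3 * k + 2) x).const_mul
    (3 * (k : ℝ) + 3)).const_mul (airyCoeffA (k + 1))).congr_deriv ?_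
  rw [airyPolyA_sub, Finset.mul_sum]
  refine Finset.sum_congr rfl fun k _ => ?_
  rw [← airyCoeffA_succ k]
  have e : 3 * k + 2 - 1 = 3 * k + 1 := by omega
  rw [e]
  push_cast
  ring

theorem hasDerivAt_airyPolyB1 (N : ℕ) (x : ℝ) :
    HasDerivAt (airyPolyB1 N) (x * (airyPolyB N x - airyCoeffB N * x ^ (3 * N + 1))) x := by
  refine ((HasDerivAt.fun_sum fun k _ => ((hasDerivAt_pow (3 * k + 3) x).const_mul
    (3 * (k : ℝ) + 4)).const_mul (airyCoeffB (k + 1))).const_add 1).congr_deriv ?_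
  rw [airyPolyB_sub, Finset.mul_sum]
  refine Finset.sum_congr rfl fun k _ => ?_
  rw [← airyCoeffB_succ k]
  have e : 3 * k + 3 - 1 = 3 * k + 2 := by omega
  rw [e]
  push_cast
  ring

theorem airyPolyA_zero (N : ℕ) : airyPolyA N 0 = 1 := by simp [airyPolyA]

theorem airyPolyA1_zero (N : ℕ) : airyPolyA1 N 0 = 0 := by simp [airyPolyA1]

theorem airyPolyB_zero (N : ℕ) : airyPolyB N 0 = 0 := by simp [airyPolyB]

theorem airyPolyB1_zero (N : ℕ) : airyPolyB1 N 0 = 1 := by simp [airyPolyB1]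

/-- The Wronskian with an approximate solution of the Airy equation. -/
theorem IsAirySolution.hasDerivAt_wronskian {f f' g g' e : ℝ → ℝ} (hf : IsAirySolution f f')
    (hg : ∀ x, HasDerivAt g (g' x) x) (hg' : ∀ x, HasDerivAt g' (x * (g x - e x)) x) (x : ℝ) :
    HasDerivAt (fun x => f x * g' x - f' x * g x) (-(x * e x * f x)) x := by
  refine (((hf.deriv_fst x).fun_mul (hg' x)).fun_sub
    ((hf.deriv_snd x).fun_mul (hg x))).congr_deriv ?_
  ring

namespace IsRecessiveAiry

variable {f f' : ℝ → ℝ}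

theorem le_zero_of_nonneg (hf : IsRecessiveAiry f f') {y : ℝ} (hy : 0 ≤ y) : f y ≤ f 0 := by
  have := sub_le_mul_of_deriv_le hy hf.deriv_fst (m := 0) fun u h1 _ => (hf.deriv_neg h1.le).le
  linarith

/-- On the right half-line the defect has a sign, and `f ≤ f 0` bounds its size. -/
theorem wronskian_bounds_right (hf : IsRecessiveAiry f f') {g g' : ℝ → ℝ} {a X ε : ℝ} {m : ℕ}
    (ha : 0 ≤ a) (hX : 0 ≤ X) (hε : a * X ^ (m + 2) ≤ ε) (hg : ∀ x, HasDerivAt g (g' x) x)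
    (hg' : ∀ x, HasDerivAt g' (x * (g x - a * x ^ m)) x) :
    f X * g' X - f' X * g X ≤ f 0 * g' 0 - f' 0 * g 0 ∧
      f 0 * g' 0 - f' 0 * g 0 - ε * f 0 ≤ f X * g' X - f' X * g X := by
  have hd := hf.hasDerivAt_wronskian hg hg'
  constructor
  · have := sub_le_mul_of_deriv_le hX hd (m := 0) fun u h1 _ => by
      have := hf.pos_of_nonneg h1.le
      have : 0 ≤ u * (a * u ^ m) * f u := by positivity
      linarith
    linarith
  · have := mul_le_sub_of_le_deriv hX hd (m := -(a * X ^ (m + 1) * f 0)) fun u h1 h2 => by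
      have k1 := hf.pos_of_nonneg h1.le
      have k2 := hf.le_zero_of_nonneg h1.le
      have k3 : u * (a * u ^ m) ≤ a * X ^ (m + 1) := by
        have := mul_le_mul_of_nonneg_left (pow_le_pow_left₀ h1.le h2.le (m + 1)) ha
        calc u * (a * u ^ m) = a * u ^ (m + 1) := by ring
          _ ≤ _ := this
      have := mul_le_mul k3 k2 k1.le (by positivity)
      linarith
    have h1 := mul_le_mul_of_nonneg_right hε (hf.pos_of_nonneg le_rfl).le
    have e : a * X ^ (m + 2) * f 0 = a * X ^ (m + 1) * f 0 * X := by ring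
    rw [e] at h1
    linarith

/-- A crude Gronwall bound suffices: `2 * 3 ^ 8 ≤ 200 ^ 2`, and it only multiplies the tiny last
Taylor term. -/
theorem abs_le_of_mem (hf : IsRecessiveAiry f f') {x : ℝ} (hx : -(234 / 100) ≤ x) (hx0 : x ≤ 0) :
    |f x| ≤ 200 * f 0 := by
  have h0 := hf.pos_of_nonneg le_rfl
  have h1 := hf.deriv_neg le_rfl
  have h2 := hf.neg_deriv_le le_rfl
  have h3 := hf.energy_le (y := 0) (ξ := x) (R := 234 / 100) fun t ht => by
    rw [Set.uIcc_of_ge hx0] at ht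
    rw [abs_of_nonpos ht.2]; linarith [ht.1]
  have h4 : Real.exp ((1 + 234 / 100) * |x - 0|) ≤ 3 ^ 8 := by
    rw [sub_zero, abs_of_nonpos hx0]
    calc Real.exp ((1 + 234 / 100) * -x) ≤ Real.exp ((8 : ℕ) * 1) :=
          Real.exp_le_exp.mpr (by push_cast; linarith)
      _ = Real.exp 1 ^ 8 := Real.exp_nat_mul 1 8
      _ ≤ 3 ^ 8 := pow_le_pow_left₀ (Real.exp_pos 1).le Real.exp_one_lt_three.le 8
  have h5 : f 0 ^ 2 + f' 0 ^ 2 ≤ 2 * f 0 ^ 2 := by nlinarith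
  have h6 := mul_le_mul h5 h4 (Real.exp_pos _).le (by positivity)
  refine abs_le_of_sq_le_sq ?_ (by positivity)
  nlinarith [sq_nonneg (f' x), sq_nonneg (f 0)]

theorem wronskian_bounds_left (hf : IsRecessiveAiry f f') {g g' : ℝ → ℝ} {a X ε : ℝ} {m : ℕ}
    (ha : 0 ≤ a) (hε : a * (234 / 100) ^ (m + 2) * 200 ≤ ε) (hX : X ≤ 0) (hX' : -(234 / 100) ≤ X) (hg : ∀ x, HasDerivAt g (g' x) x)
    (hg' : ∀ x, HasDerivAt g' (x * (g x - a * x ^ m)) x) :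
    |(f X * g' X - f' X * g X) - (f 0 * g' 0 - f' 0 * g 0)|
      ≤ ε * f 0 := by
  have hd := hf.hasDerivAt_wronskian hg hg'
  have h0 := hf.pos_of_nonneg le_rfl
  set B := a * (234 / 100) ^ (m + 1) * (200 * f 0) with hB
  have hB0 : 0 ≤ B := by positivity
  have key : ∀ u, X < u → u < 0 → |-(u * (a * u ^ m) * f u)| ≤ B := fun u h1 h2 => by
    have k1 : |u| ≤ 234 / 100 := by rw [abs_of_neg h2]; linarith
    have k2 := hf.abs_le_of_mem (x := u) (by linarith) h2.le
    have e : u * (a * u ^ m) = a * u ^ (m + 1) := by ring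
    rw [abs_neg, abs_mul, e, abs_mul, abs_of_nonneg ha, abs_pow]
    exact mul_le_mul (mul_le_mul_of_nonneg_left (pow_le_pow_left₀ (abs_nonneg u) k1 _) ha) k2
      (abs_nonneg _) (by positivity)
  have b1 := sub_le_mul_of_deriv_le hX hd (m := B) fun u h1 h2 => (abs_le.mp (key u h1 h2)).2
  have b2 := mul_le_sub_of_le_deriv hX hd (m := -B) fun u h1 h2 => (abs_le.mp (key u h1 h2)).1
  have b3 : B * (0 - X) ≤ ε * f 0 := by
    have := mul_le_mul_of_nonneg_left (show 0 - X ≤ 234 / 100 by linarith) hB0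
    refine this.trans ((le_of_eq ?_).trans (mul_le_mul_of_nonneg_right hε h0.le))
    rw [hB]; ring
  rw [abs_le]
  constructor <;> linarith

end IsRecessiveAiry

theorem airyCoeff_error_right :
    airyCoeffA 13 * 4 ^ (3 * 13 + 2) ≤ 1 / 100000 ∧
      airyCoeffB 13 * 4 ^ (3 * 13 + 1 + 2) ≤ 1 / 100000 := by
  simp only [airyCoeffA, airyCoeffB, Finset.prod_range_succ, Finset.prod_range_zero]
  norm_num

theorem airyCoeff_error_left :
    airyCoeffA 13 * (234 / 100) ^ (3 * 13 + 2) * 200 ≤ 1 / 100000000 ∧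
      airyCoeffB 13 * (234 / 100) ^ (3 * 13 + 1 + 2) * 200 ≤ 1 / 100000000 := by
  simp only [airyCoeffA, airyCoeffB, Finset.prod_range_succ, Finset.prod_range_zero]
  norm_num

theorem airyPoly_values_right :
    72897 / 100000 * airyPolyB 13 4 ≤ airyPolyA 13 4 ∧
      airyPolyA 13 4 ≤ 72904 / 100000 * airyPolyB 13 4 ∧
      72897 / 100000 * airyPolyB1 13 4 ≤ airyPolyA1 13 4 ∧
      airyPolyA1 13 4 ≤ 72904 / 100000 * airyPolyB1 13 4 := by
  simp only [airyPolyA, airyPolyB, airyPolyA1, airyPolyB1, airyCoeffA, airyCoeffB,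
    Finset.sum_range_succ, Finset.prod_range_succ, Finset.sum_range_zero, Finset.prod_range_zero]
  norm_num

theorem airyPoly_values_below_zero :
    0 < airyPolyA 13 (-2.33815) * airyPolyB1 13 (-2.33815)
        - airyPolyA1 13 (-2.33815) * airyPolyB 13 (-2.33815) ∧
      airyPolyB 13 (-2.33815) < 0 ∧ -1 ≤ airyPolyB 13 (-2.33815) ∧
      |airyPolyA 13 (-2.33815)| ≤ 1 ∧
      airyPolyA 13 (-2.33815) - 72906 / 100000 * airyPolyB 13 (-2.33815) ≤ -1 / 100000 := by
  simp only [abs_le, airyPolyA, airyPolyB, airyPolyA1, airyPolyB1, airyCoeffA, airyCoeffB,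
    Finset.sum_range_succ, Finset.prod_range_succ, Finset.sum_range_zero, Finset.prod_range_zero]
  norm_num

theorem airyPoly_values_above_zero :
    0 < airyPolyA 13 (-2.33805) * airyPolyB1 13 (-2.33805)
        - airyPolyA1 13 (-2.33805) * airyPolyB 13 (-2.33805) ∧
      airyPolyB 13 (-2.33805) < 0 ∧ -2 ≤ airyPolyB 13 (-2.33805) ∧
      |airyPolyA 13 (-2.33805)| ≤ 1 ∧
      1 / 100000 ≤ airyPolyA 13 (-2.33805) - 72896 / 100000 * airyPolyB 13 (-2.33805) := by
  simp only [abs_le, airyPolyA, airyPolyB, airyPolyA1, airyPolyB1, airyCoeffA, airyCoeffB,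
    Finset.sum_range_succ, Finset.prod_range_succ, Finset.sum_range_zero, Finset.prod_range_zero]
  norm_num

theorem airyPoly_values_middle :
    0 < airyPolyA 13 (-1.2) * airyPolyB1 13 (-1.2)
        - airyPolyA1 13 (-1.2) * airyPolyB 13 (-1.2) ∧
      airyPolyB 13 (-1.2) < 0 ∧ -2 ≤ airyPolyB 13 (-1.2) ∧
      |airyPolyA 13 (-1.2)| ≤ 1 ∧
      1 / 100000 ≤ airyPolyA 13 (-1.2) - 72896 / 100000 * airyPolyB 13 (-1.2) := by
  simp only [abs_le, airyPolyA, airyPolyB, airyPolyA1, airyPolyB1, airyCoeffA, airyCoeffB,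
    Finset.sum_range_succ, Finset.prod_range_succ, Finset.sum_range_zero, Finset.prod_range_zero]
  norm_num

namespace IsRecessiveAiry

variable {f f' : ℝ → ℝ}

/-- The Wronskians with the two Taylor polynomials are close to `-f' 0` and `f 0`. Evaluated at 4,
where `f > 0 > f'`, they make `-f' 0 / f 0` nearly a mediant of `airyPolyA / airyPolyB` and
`airyPolyA1 / airyPolyB1`, two quotients that agree to four digits. -/
theorem deriv_zero_bounds (hf : IsRecessiveAiry f f') :
    72896 / 100000 * f 0 ≤ -f' 0 ∧ -f' 0 ≤ 72906 / 100000 * f 0 := by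
  obtain ⟨a1, a2⟩ := hf.wronskian_bounds_right (airyCoeffA_nonneg 13) (by norm_num)
    airyCoeff_error_right.1 (hasDerivAt_airyPolyA 13) (hasDerivAt_airyPolyA1 13)
  obtain ⟨b1, b2⟩ := hf.wronskian_bounds_right (airyCoeffB_nonneg 13) (by norm_num)
    airyCoeff_error_right.2 (hasDerivAt_airyPolyB 13) (hasDerivAt_airyPolyB1 13)
  rw [airyPolyA_zero, airyPolyA1_zero] at a1 a2
  rw [airyPolyB_zero, airyPolyB1_zero] at b1 b2
  obtain ⟨v1, v2, v3, v4⟩ := airyPoly_values_right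
  have h4 := hf.pos_of_nonneg (y := 4) (by norm_num)
  have g : 0 ≤ -f' 4 := by linarith [hf.deriv_neg (y := 4) (by norm_num)]
  have w1 := mul_le_mul_of_nonneg_left v1 g
  have w2 := mul_le_mul_of_nonneg_left v2 g
  have w3 := mul_le_mul_of_nonneg_left v3 h4.le
  have w4 := mul_le_mul_of_nonneg_left v4 h4.le
  have h0 : 0 < f 0 := hf.pos_of_nonneg le_rfl
  constructor <;> linarith

/-- Eliminating `f' x` from the two Wronskians expresses `f x` through the data at 0, so the sign of
`f x` can be read off from polynomial values. -/
theorem mul_wronskian_bound (hf : IsRecessiveAiry f f') {x : ℝ} (hx : -(234 / 100) ≤ x)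
    (hx0 : x ≤ 0) (hA : |airyPolyA 13 x| ≤ 1) (hB : |airyPolyB 13 x| ≤ 2) :
    |f x * (airyPolyA 13 x * airyPolyB1 13 x - airyPolyA1 13 x * airyPolyB 13 x)
      - (f 0 * airyPolyA 13 x - (-f' 0) * airyPolyB 13 x)| ≤ 1 / 10000000 * f 0 := by
  have a' := hf.wronskian_bounds_left (airyCoeffA_nonneg 13) airyCoeff_error_left.1 hx0 hx
    (hasDerivAt_airyPolyA 13) (hasDerivAt_airyPolyA1 13)
  have b' := hf.wronskian_bounds_left (airyCoeffB_nonneg 13) airyCoeff_error_left.2 hx0 hx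
    (hasDerivAt_airyPolyB 13) (hasDerivAt_airyPolyB1 13)
  rw [airyPolyA_zero, airyPolyA1_zero] at a'
  rw [airyPolyB_zero, airyPolyB1_zero] at b'
  have h0 : 0 < f 0 := hf.pos_of_nonneg le_rfl
  set P := airyPolyA 13 x
  set Q := airyPolyB 13 x
  set P1 := airyPolyA1 13 x
  set Q1 := airyPolyB1 13 x
  have e : f x * (P * Q1 - P1 * Q) - (f 0 * P - (-f' 0) * Q)
      = ((f x * Q1 - f' x * Q) - (f 0 * 1 - f' 0 * 0)) * P
        - ((f x * P1 - f' x * P) - (f 0 * 0 - f' 0 * 1)) * Q := by ring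
  rw [e]
  refine (abs_sub _ _).trans ?_
  rw [abs_mul, abs_mul]
  have c1 := mul_le_mul b' hA (abs_nonneg _) (by positivity)
  have c2 := mul_le_mul a' hB (abs_nonneg _) (by positivity)
  linarith

theorem pos_of_polynomial_values (hf : IsRecessiveAiry f f') {x : ℝ} (hx : -(234 / 100) ≤ x)
    (hx0 : x ≤ 0)
    (hw : 0 < airyPolyA 13 x * airyPolyB1 13 x - airyPolyA1 13 x * airyPolyB 13 x)
    (hB : airyPolyB 13 x < 0) (hB' : -2 ≤ airyPolyB 13 x) (hA : |airyPolyA 13 x| ≤ 1)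
    (hv : 1 / 100000 ≤ airyPolyA 13 x - 72896 / 100000 * airyPolyB 13 x) : 0 < f x := by
  have h := (abs_le.mp (hf.mul_wronskian_bound hx hx0 hA
    (abs_le.mpr ⟨hB', by linarith⟩))).1
  have h0 := hf.pos_of_nonneg le_rfl
  obtain ⟨c1, -⟩ := hf.deriv_zero_bounds
  have k1 := mul_le_mul_of_nonneg_right c1 (show 0 ≤ -airyPolyB 13 x by linarith)
  have k2 := mul_le_mul_of_nonneg_left hv h0.le
  have k3 : 0 < f x * (airyPolyA 13 x * airyPolyB1 13 x - airyPolyA1 13 x * airyPolyB 13 x) := by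
    linarith
  exact pos_of_mul_pos_left k3 hw.le

theorem neg_at_lower_bound (hf : IsRecessiveAiry f f') : f (-2.33815) < 0 := by
  obtain ⟨hw, hB, hB', hA, hv⟩ := airyPoly_values_below_zero
  have h := (abs_le.mp (hf.mul_wronskian_bound (x := -2.33815) (by norm_num) (by norm_num) hA
    (abs_le.mpr ⟨by linarith, by linarith⟩))).2
  have h0 := hf.pos_of_nonneg le_rfl
  obtain ⟨-, c1⟩ := hf.deriv_zero_bounds
  have k1 := mul_le_mul_of_nonneg_right c1 (show 0 ≤ -airyPolyB 13 (-2.33815) by linarith)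
  have k2 := mul_le_mul_of_nonneg_left hv h0.le
  have k3 : f (-2.33815) * (airyPolyA 13 (-2.33815) * airyPolyB1 13 (-2.33815)
      - airyPolyA1 13 (-2.33815) * airyPolyB 13 (-2.33815)) < 0 := by
    linarith
  exact neg_of_mul_neg_left k3 hw.le

/-- A solution of the Airy equation that is positive at the ends of a short interval to the left
of the origin is positive in between. -/
theorem pos_of_pos_ends (hf : IsRecessiveAiry f f') {a b : ℝ} (ha : -(234 / 100) ≤ a) (hb : b ≤ 0)
    (hab : b - a ≤ 6 / 5) (hfa : 0 < f a) (hfb : 0 < f b) {y : ℝ} (hay : a ≤ y) (hyb : y ≤ b) :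
    0 < f y := by
  obtain ⟨m, hm, hmin⟩ := isCompact_Icc.exists_isMinOn (Set.nonempty_Icc.mpr (hay.trans hyb))
    hf.continuous.continuousOn
  refine lt_of_lt_of_le ?_ (hmin ⟨hay, hyb⟩ : f m ≤ f y)
  by_contra hcon
  push Not at hcon
  have ham : a < m := lt_of_le_of_ne hm.1 (by rintro rfl; linarith)
  have hmb : m < b := lt_of_le_of_ne hm.2 (by rintro rfl; linarith)
  have hm' : f' m = 0 :=
    (hmin.isLocalMin (Icc_mem_nhds ham hmb)).hasDerivAt_eq_zero (hf.deriv_fst m)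
  have hlt : f m < 0 := by
    refine lt_of_le_of_ne hcon fun h => ?_
    have := hf.eq_zero_of_eq_zero h hm' a
    linarith
  -- `B` bounds `f''` from above. Within distance `3 / 5` of the negative minimum `f` can rise by at
  -- most `2.34 * 0.36 * |f m| < |f m|`, so it cannot be positive at the nearer end.
  set B := 234 / 100 * (-f m) with hB
  have hB0 : 0 ≤ B := mul_nonneg (by norm_num) (by linarith)
  have h2 : ∀ u, a ≤ u → u ≤ b → u * f u ≤ B := fun u h1 h2 => by
    have h3 : f m ≤ f u := hmin ⟨h1, h2⟩
    have h4 : -u * -f u ≤ -u * -f m := mul_le_mul_of_nonneg_left (by linarith) (by linarith)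
    have h5 : -u * -f m ≤ 234 / 100 * -f m := mul_le_mul_of_nonneg_right (by linarith) (by linarith)
    linarith
  rcases le_total (b - m) (3 / 5) with h | h
  · have k1 : ∀ u, m < u → u < b → f' u ≤ B * (b - m) := fun u h3 h4 => by
      have := sub_le_mul_of_deriv_le h3.le hf.deriv_snd (m := B) fun v h5 h6 =>
        h2 v (by linarith) (by linarith)
      have := mul_le_mul_of_nonneg_left (show u - m ≤ b - m by linarith) hB0
      linarith
    have k2 := sub_le_mul_of_deriv_le hmb.le hf.deriv_fst k1
    have k3 : (b - m) * (b - m) ≤ 3 / 5 * (3 / 5) :=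
      mul_le_mul h h (by linarith) (by norm_num)
    have k4 := mul_le_mul_of_nonneg_left k3 hB0
    linarith
  · have h' : m - a ≤ 3 / 5 := by linarith
    have k1 : ∀ u, a < u → u < m → -(B * (m - a)) ≤ f' u := fun u h3 h4 => by
      have := sub_le_mul_of_deriv_le h4.le hf.deriv_snd (m := B) fun v h5 h6 =>
        h2 v (by linarith) (by linarith)
      have := mul_le_mul_of_nonneg_left (show m - u ≤ m - a by linarith) hB0
      linarith
    have k2 := mul_le_sub_of_le_deriv ham.le hf.deriv_fst k1
    have k3 : (m - a) * (m - a) ≤ 3 / 5 * (3 / 5) :=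
      mul_le_mul h' h' (by linarith) (by norm_num)
    have k4 := mul_le_mul_of_nonneg_left k3 hB0
    linarith

/-- The largest zero of a recessive solution of the Airy equation. -/
theorem exists_isAiryWithZero (hf : IsRecessiveAiry f f') :
    ∃ z, IsAiryWithZero f f' z ∧ |z + 2.3381| < 0.00005 := by
  obtain ⟨z, hz, hz0, hfz, hpos⟩ := hf.exists_largest_zero hf.neg_at_lower_bound.le
  refine ⟨z, ⟨hf, hz0, hfz, hpos⟩, ?_⟩
  obtain ⟨hw, hB, hB', hA, hv⟩ := airyPoly_values_above_zero
  have h1 : 0 < f (-2.33805) :=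
    hf.pos_of_polynomial_values (by norm_num) (by norm_num) hw hB hB' hA hv
  obtain ⟨hw, hB, hB', hA, hv⟩ := airyPoly_values_middle
  have h2 : 0 < f (-1.2) :=
    hf.pos_of_polynomial_values (by norm_num) (by norm_num) hw hB hB' hA hv
  -- The points `-2.33805`, `-1.2` and 0 cut the range into intervals no longer than `6 / 5`.
  have h3 : z < -2.33805 := by
    by_contra hcon
    push Not at hcon
    have : 0 < f z := by
      rcases le_total z (-1.2) with h | h
      · exact hf.pos_of_pos_ends (by norm_num) (by norm_num) (by norm_num) h1 h2 hcon h
      · exact hf.pos_of_pos_ends (by norm_num) le_rfl (by norm_num) h2 (hf.pos_of_nonneg le_rfl) h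
          hz0.le
    linarith
  have h4 : z ≠ -2.33815 := by
    rintro rfl
    linarith [hf.neg_at_lower_bound]
  have h5 : -2.33815 < z := lt_of_le_of_ne hz (Ne.symm h4)
  rw [abs_lt]
  constructor <;> linarith

end IsRecessiveAiry

/-! ### Translation into powers of `K` and conclusion. -/

theorem exists_inv_cube_root {K : ℕ} (hK : 0 < K) : ∃ h : ℝ, 0 < h ∧ (K : ℝ) * h ^ 3 = 1 ∧
    (K : ℝ) = (h ^ 3)⁻¹ ∧ (K : ℝ) ^ (4 / 3 : ℝ) = (h ^ 4)⁻¹ ∧ (K : ℝ) ^ (5 / 3 : ℝ) = (h ^ 5)⁻¹ ∧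
    (K : ℝ) ^ (-(2 / 3) : ℝ) = h ^ 2 := by
  have hK' : (0 : ℝ) < K := by exact_mod_cast hK
  set h := (K : ℝ) ^ (-(1 / 3) : ℝ) with hh
  have hp : ∀ n : ℕ, h ^ n = (K : ℝ) ^ (-(n / 3) : ℝ) := fun n => by
    rw [hh, ← Real.rpow_natCast, ← Real.rpow_mul hK'.le]
    congr 1; ring
  have h3 : h ^ 3 = (K : ℝ)⁻¹ := by
    rw [hp, ← Real.rpow_neg_one]; norm_num
  refine ⟨h, Real.rpow_pos_of_pos hK' _, ?_, ?_, ?_, ?_, ?_⟩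
  · rw [h3, mul_inv_cancel₀ hK'.ne']
  · rw [h3, inv_inv]
  · rw [hp, ← Real.rpow_neg hK'.le]; norm_num
  · rw [hp, ← Real.rpow_neg hK'.le]; norm_num
  · rw [hp]; norm_num

theorem le_of_mul_cube_eq_one {K : ℕ} {h h₀ : ℝ} (hh₀ : 0 < h₀)
    (hK : (K : ℝ) * h ^ 3 = 1) (hle : ⌈1 / h₀ ^ 3⌉₊ ≤ K) : h ≤ h₀ := by
  have h1 : 1 / h₀ ^ 3 ≤ K := (Nat.le_ceil _).trans (by exact_mod_cast hle)
  rw [div_le_iff₀ (by positivity), ← hK] at h1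
  have hK0 : (0 : ℝ) < K := by
    rcases (Nat.cast_nonneg (α := ℝ) K).eq_or_lt with h2 | h2
    · rw [← h2] at hK; simp at hK
    · exact h2
  exact le_of_pow_le_pow_left₀ three_ne_zero hh₀.le (le_of_mul_le_mul_left h1 hK0)

theorem IsAiryWithZero.isBigO_of_lt_one {f f' : ℝ → ℝ} {z : ℝ} (hf : IsAiryWithZero f f' z)
    {θs : ℕ → ℝ → ℝ} (hθ : ∀ K ρ, 0 < K → 0 < ρ → IsDecayRate K ρ (θs K ρ)) {ρ : ℝ} (hρ : 0 < ρ)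
    (hρ1 : ρ < 1) :
    (fun K : ℕ => θs K ρ -
        (-(1 - √ρ) ^ 2 - √ρ / (K : ℝ) + √ρ * z / (K : ℝ) ^ (4 / 3 : ℝ)
          - 8 * √ρ * z ^ 2 / (15 * (K : ℝ) ^ (5 / 3 : ℝ))))
      =O[atTop] fun K : ℕ => 1 / (K : ℝ) ^ 2 := by
  obtain ⟨C, h₀, hh₀, hC⟩ := hf.decayRate_expansion_of_lt_one hρ hρ1
  refine IsBigO.of_bound C ?_
  filter_upwards [eventually_ge_atTop (max 1 ⌈1 / h₀ ^ 3⌉₊)] with K hK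
  have hK1 : 0 < K := (le_max_left _ _).trans hK
  obtain ⟨h, hh, e1, e2, e3, e4, -⟩ := exists_inv_cube_root hK1
  have := hC K _ h (hθ K ρ hK1 hρ) hh
    (le_of_mul_cube_eq_one hh₀ e1 ((le_max_right _ _).trans hK)) e1
  rw [Real.norm_eq_abs, Real.norm_eq_abs, abs_of_nonneg (by positivity : (0 : ℝ) ≤ 1 / (K : ℝ) ^ 2),
    e3, e4, e2]
  convert this using 2
  · field_simp
    ring
  · field_simp

theorem IsAiryWithZero.bound_near_one {f f' : ℝ → ℝ} {z : ℝ} (hf : IsAiryWithZero f f' z)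
    {θs : ℕ → ℝ → ℝ} (hθ : ∀ K ρ, 0 < K → 0 < ρ → IsDecayRate K ρ (θs K ρ)) {r₁ : ℝ → ℝ}
    (hr₁ : ∀ η, z < r₁ η + η ^ 2 / 4)
    (hr₁' : ∀ η, f' (r₁ η + η ^ 2 / 4) = -(η / 2) * f (r₁ η + η ^ 2 / 4)) (B : ℝ) :
    ∃ (C : ℝ) (K₀ : ℕ), ∀ K : ℕ, K₀ ≤ K → ∀ η : ℝ, |η| ≤ B →
      |θs K (1 + η * (K : ℝ) ^ (-(2 / 3) : ℝ)) -
          (-1 / (K : ℝ) + r₁ η / (K : ℝ) ^ (4 / 3 : ℝ)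
            - (16 * r₁ η ^ 3 + 8 * η ^ 2 * r₁ η ^ 2 + (η ^ 4 + 19 * η) * r₁ η + η ^ 3 + 9)
              / (30 * r₁ η * (K : ℝ) ^ (5 / 3 : ℝ)))|
        ≤ C / (K : ℝ) ^ 2 := by
  obtain ⟨C, h₀, hh₀, hC⟩ := hf.decayRate_expansion_near_one B
  set h₁ := min h₀ (1 / (1 + |B|)) with hh₁
  have hh₁0 : 0 < h₁ := by positivity
  refine ⟨C, max 1 ⌈1 / h₁ ^ 3⌉₊, fun K hK η hη => ?_⟩
  have hK1 : 0 < K := (le_max_left _ _).trans hK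
  obtain ⟨h, hh, e1, e2, e3, e4, e5⟩ := exists_inv_cube_root hK1
  have hle := le_of_mul_cube_eq_one hh₁0 e1 ((le_max_right _ _).trans hK)
  have hB : h * (1 + |B|) ≤ 1 := by
    rw [← le_div_iff₀ (by positivity)]; exact hle.trans (min_le_right _ _)
  have hpos : 0 < 1 + η * h ^ 2 := by
    have g0 := abs_nonneg B
    have g1 : |η| * h < 1 := by
      have := mul_le_mul_of_nonneg_left (hη.trans (le_abs_self B)) hh.le
      linarith
    have g2 : |η| * h * h ≤ |η| * h * 1 := mul_le_mul_of_nonneg_left (by nlinarith) (by positivity)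
    have g3 : -(η * h ^ 2) ≤ |η| * h ^ 2 := by
      rw [← neg_mul]; exact mul_le_mul_of_nonneg_right (neg_le_abs η) (sq_nonneg h)
    linarith
  have := hC K _ h η (r₁ η) hη (hr₁ η) (hr₁' η) (hθ K _ hK1 hpos) hh
    (hle.trans (min_le_left _ _)) e1
  have hne : r₁ η ≠ 0 := by
    have := hf.sub_neg_of_deriv_eq (hr₁ η) (hr₁' η)
    linarith
  rw [e5, e3, e4, e2]
  convert this using 2
  · field_simp
  · field_simp

theorem isBigO_of_one_lt {θs : ℕ → ℝ → ℝ}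
    (hθ : ∀ K ρ, 0 < K → 0 < ρ → IsDecayRate K ρ (θs K ρ)) {ρ : ℝ} (hρ : 1 < ρ) :
    (fun K : ℕ => θs K ρ -
        (-1 / (K : ℝ) - 1 / ((ρ - 1) * (K : ℝ) ^ 2) - 1 / ((ρ - 1) ^ 2 * (K : ℝ) ^ 3)
          + (ρ ^ 2 + 1) / ((ρ - 1) ^ 4 * (K : ℝ) ^ 4)))
      =O[atTop] fun K : ℕ => 1 / (K : ℝ) ^ 5 := by
  obtain ⟨C, K₀, hC⟩ := decayRate_expansion_of_one_lt hρ
  refine IsBigO.of_bound C ?_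
  filter_upwards [eventually_ge_atTop (max 1 K₀)] with K hK
  have hK1 : 0 < K := (le_max_left _ _).trans hK
  have hK' : (0 : ℝ) < K := by exact_mod_cast hK1
  have := hC K _ (1 / K) ((le_max_right _ _).trans hK) (hθ K ρ hK1 (by linarith)) (by positivity)
    (mul_one_div_cancel hK'.ne')
  have hρ' : ρ - 1 ≠ 0 := by linarith
  rw [Real.norm_eq_abs, Real.norm_eq_abs, abs_of_nonneg (by positivity : (0 : ℝ) ≤ 1 / (K : ℝ) ^ 5)]
  convert this using 2
  · field_simp
  · field_simp

theorem theorem2p2 :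
    ∃ (θs : ℕ → ℝ → ℝ) (r₀ : ℝ) (r₁ : ℝ → ℝ),
      -- `θs K ρ` is the dominant singularity of every `p̂_n`, and it is negative
      (∀ (K : ℕ) (ρ : ℝ), 0 < K → 0 < ρ →
        θs K ρ < 0 ∧ ∀ n : Fin K, IsDominantSingularity (sojournDensity K ρ n) (θs K ρ)) ∧
      -- it is the tail exponent of `Pr[V > t]`, whatever the law `w` of `N(0⁻)` is
      (∀ (K : ℕ) (ρ : ℝ), 0 < K → 0 < ρ →
        ∀ w : Fin K → ℝ, (∀ n, 0 ≤ w n) → ∑ n, w n = 1 →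
          Tendsto (fun t : ℝ => t⁻¹ * Real.log (∑ n, w n * sojournTail K ρ n t))
            atTop (𝓝 (θs K ρ))) ∧
      -- `r₀ ≈ -2.3381` is the largest root of `Ai`
      IsGreatest {r : ℝ | airyAi r = 0} r₀ ∧
      |r₀ + 2.3381| < 0.00005 ∧
      -- `r₁ η` is the largest root of `Ai'(r + η²/4) / Ai(r + η²/4) = -η/2`
      (∀ η : ℝ,
        IsGreatest {r : ℝ | airyAi (r + η ^ 2 / 4) ≠ 0 ∧
          deriv airyAi (r + η ^ 2 / 4) / airyAi (r + η ^ 2 / 4) = -η / 2} (r₁ η) ∧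
        r₁ η ≠ 0) ∧
      -- the case `ρ < 1`
      (∀ ρ : ℝ, 0 < ρ → ρ < 1 →
        (fun K : ℕ => θs K ρ -
            (-(1 - √ρ) ^ 2 - √ρ / (K : ℝ) + √ρ * r₀ / (K : ℝ) ^ (4 / 3 : ℝ)
              - 8 * √ρ * r₀ ^ 2 / (15 * (K : ℝ) ^ (5 / 3 : ℝ))))
          =O[atTop] fun K : ℕ => 1 / (K : ℝ) ^ 2) ∧
      -- the case `ρ = 1 + η K^{-2/3}`, uniformly for bounded `η`
      (∀ B : ℝ, ∃ (C : ℝ) (K₀ : ℕ), ∀ K : ℕ, K₀ ≤ K → ∀ η : ℝ, |η| ≤ B →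
        |θs K (1 + η * (K : ℝ) ^ (-(2 / 3) : ℝ)) -
            (-1 / (K : ℝ) + r₁ η / (K : ℝ) ^ (4 / 3 : ℝ)
              - (16 * r₁ η ^ 3 + 8 * η ^ 2 * r₁ η ^ 2 + (η ^ 4 + 19 * η) * r₁ η + η ^ 3 + 9)
                / (30 * r₁ η * (K : ℝ) ^ (5 / 3 : ℝ)))|
          ≤ C / (K : ℝ) ^ 2) ∧
      -- the case `ρ > 1`
      (∀ ρ : ℝ, 1 < ρ →
        (fun K : ℕ => θs K ρ -
            (-1 / (K : ℝ) - 1 / ((ρ - 1) * (K : ℝ) ^ 2) - 1 / ((ρ - 1) ^ 2 * (K : ℝ) ^ 3)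
              + (ρ ^ 2 + 1) / ((ρ - 1) ^ 4 * (K : ℝ) ^ 4)))
          =O[atTop] fun K : ℕ => 1 / (K : ℝ) ^ 5) := by
  have hex : ∀ (K : ℕ) (ρ : ℝ), ∃ θ : ℝ, 0 < K → 0 < ρ → IsDecayRate K ρ θ := fun K ρ => by
    by_cases h : 0 < K ∧ 0 < ρ
    · obtain ⟨θ, hθ⟩ := exists_isDecayRate h.1 h.2
      exact ⟨θ, fun _ _ => hθ⟩
    -- A default value outside the range `0 < K`, `0 < ρ`, about which nothing is claimed.
    · exact ⟨0, fun h1 h2 => absurd ⟨h1, h2⟩ h⟩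
  choose θs hθ using hex
  obtain ⟨z, hz, hz'⟩ := airy_isRecessive.exists_isAiryWithZero
  -- The root is chosen in the variable of the Airy function and to the right of `z`; the shift by
  -- `η ^ 2 / 4` is undone in the witness below.
  choose r hr hr' using fun η : ℝ => hz.exists_deriv_eq (η / 2)
  refine ⟨θs, z, fun η => r η - η ^ 2 / 4, fun K ρ hK hρ =>
    ⟨(hθ K ρ hK hρ).neg hK, fun n => (hθ K ρ hK hρ).isDominantSingularity hK n⟩,
    fun K ρ hK hρ w hw hw1 => (hθ K ρ hK hρ).tendsto_log_tail w hw hw1, ⟨hz.map_zero, ?_⟩, hz',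
    fun η => ⟨?_, (hz.sub_neg_of_deriv_eq (hr η) (hr' η)).ne⟩,
    fun ρ hρ hρ1 => hz.isBigO_of_lt_one hθ hρ hρ1, hz.bound_near_one hθ ?_ ?_,
    fun ρ hρ => isBigO_of_one_lt hθ hρ⟩
  · intro y hy
    by_contra hcon
    exact (hz.pos y (not_le.mp hcon)).ne' hy
  · rw [deriv_airyAi]
    exact hz.isGreatest_of_deriv_eq (hr η) (hr' η)
  · intro η
    simpa using hr η
  · intro η
    simpa using hr' η
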